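/- Let $n\ge 1$, let $\Omega\subset\mathbb{R}^n$ be a smooth bounded domain, let $f:\partial\Omega\to(0,\infty)$ be Lipschitz continuous, and let $0<\alpha<\mathscr{L}^n(\Omega)$. For $1<p<\infty$ consider the problem $$(\mathfrak{P}_p)\qquad \min\Big\{\int_\Omega|\nabla u|^p\,dX \ :\ u\in W^{1,p}(\Omega),\ u=f \text{ on }\partial\Omega,\ \mathscr{L}^n(\{u>0\})\le\alpha\Big\},$$ where the boundary condition is understood in the sense of traces, i.e. $u-g\in W^{1,p}_0(\Omega)$ for a Lipschitz extension $g$ of $f$, and the problem $$(\mathfrak{P}_\infty)\qquad \min\Big\{\mathrm{Lip}(u)\ :\ u\in W^{1,\infty}(\Omega),\ u=f\text{ on }\partial\Omega,\ \mathscr{L}^n(\{u>0\})\le\alpha\Big\},\qquad \mathrm{Lip}(u)=\sup_{x,y\in\Omega,\ x\ne y}\frac{|u(x)-u(y)|}{|x-y|},$$ where functions in $W^{1,\infty}(\Omega)$ are identified with their representatives that are continuous on $\overline\Omega$. Let $p_k\to\infty$ with $p_k>1$, and for each $k$ let $u_{p_k}$ be a minimizer of $(\mathfrak{P}_{p_k})$.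 Then there are a subsequence (not relabeled) and a function $u_\infty$ on $\overline\Omega$ such that: 1. $u_{p_k}\to u_\infty$ uniformly on $\overline\Omega$ (each $u_{p_k}$ of the subsequence having a representative that is continuous on $\overline\Omega$), and $u_{p_k}\rightharpoonup u_\infty$ weakly in $W^{1,q}(\Omega)$ for every $1<q<\infty$ (for each $q$, $u_{p_k}\in W^{1,q}(\Omega)$ for all large $k$); 2. $u_\infty$ is a minimizer of $(\mathfrak{P}_\infty)$; 3. $\Delta_\infty u_\infty=0$ in $\{x\in\Omega: u_\infty(x)>0\}$ in the viscosity sense, where $\Delta_\infty u=Du\,D^2u\,(Du)^{t}$; that is, $u_\infty$ is continuous there, and for every $x_0$ in this set and every $C^2$ function $\phi$ on it with $\phi(x_0)=u_\infty(x_0)$, one has $-\Delta_\infty\phi(x_0)\ge 0$ if $u_\infty-\phi$ has a strict local minimum at $x_0$, and $-\Delta_\infty\phi(x_0)\le 0$ if $u_\infty-\phi$ has a strict local maximum at $x_0$. -/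

import Mathlib

open MeasureTheory Filter Topology
open scoped ENNReal NNReal ContDiff

/-- A smooth bounded domain: a nonempty connected bounded open set which near each of its boundary
points is the sublevel set `{ρ < 0}` of a smooth function with non-vanishing differential. -/
structure IsSmoothBoundedDomain {n : ℕ} (Ω : Set (EuclideanSpace ℝ (Fin n))) : Prop where
  isOpen : IsOpen Ω
  isConnected : IsConnected Ω
  isBounded : Bornology.IsBounded Ω
  smooth_boundary : ∀ x ∈ frontier Ω, ∃ V : Set (EuclideanSpace ℝ (Fin n)), IsOpen V ∧ x ∈ V ∧
    ∃ ρ : EuclideanSpace ℝ (Fin n) → ℝ, ContDiffOn ℝ ∞ ρ V ∧ fderiv ℝ ρ x ≠ 0 ∧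
      Ω ∩ V = {y | y ∈ V ∧ ρ y < 0}

/-- The test functions `C_c^∞(Ω)`. -/
structure IsTestFunction {n : ℕ} (Ω : Set (EuclideanSpace ℝ (Fin n)))
    (ψ : EuclideanSpace ℝ (Fin n) → ℝ) : Prop where
  contDiff : ContDiff ℝ ∞ ψ
  hasCompactSupport : HasCompactSupport ψ
  tsupport_subset : tsupport ψ ⊆ Ω

/-- `G` is a weak (distributional) gradient of `u` on `Ω`:
`∫_Ω u ∇ψ = - ∫_Ω ψ G` for all `ψ ∈ C_c^∞(Ω)`. -/
structure HasWeakGradient {n : ℕ} (Ω : Set (EuclideanSpace ℝ (Fin n)))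
    (u : EuclideanSpace ℝ (Fin n) → ℝ)
    (G : EuclideanSpace ℝ (Fin n) → EuclideanSpace ℝ (Fin n)) : Prop where
  locallyIntegrableOn : LocallyIntegrableOn u Ω
  locallyIntegrableOn_gradient : LocallyIntegrableOn G Ω
  integral_eq : ∀ ψ : EuclideanSpace ℝ (Fin n) → ℝ, IsTestFunction Ω ψ →
    ∫ x in Ω, u x • gradient ψ x = -∫ x in Ω, ψ x • G x

/-- On an open set the weak gradient is unique almost everywhere. -/
theorem HasWeakGradient.ae_eq {n : ℕ} {Ω : Set (EuclideanSpace ℝ (Fin n))} (hΩ : IsOpen Ω)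
    {u : EuclideanSpace ℝ (Fin n) → ℝ}
    {G H : EuclideanSpace ℝ (Fin n) → EuclideanSpace ℝ (Fin n)}
    (hG : HasWeakGradient Ω u G) (hH : HasWeakGradient Ω u H) :
    G =ᵐ[volume.restrict Ω] H := by
  have key : ∀ᵐ x, x ∈ Ω → (G - H) x = 0 := by
    refine hΩ.ae_eq_zero_of_integral_contDiff_smul_eq_zero
      (hG.locallyIntegrableOn_gradient.sub hH.locallyIntegrableOn_gradient) ?_
    intro ψ h1 h2 h3
    have hψ : IsTestFunction Ω ψ := ⟨h1, h2, h3⟩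
    have hint : ∀ K : EuclideanSpace ℝ (Fin n) → EuclideanSpace ℝ (Fin n),
        LocallyIntegrableOn K Ω → IntegrableOn (fun x => ψ x • K x) Ω := by
      intro K hK
      have hK' : IntegrableOn K (tsupport ψ) := hK.integrableOn_compact_subset h3 h2
      have : IntegrableOn (fun x => ψ x • K x) (tsupport ψ) :=
        hK'.continuousOn_smul h1.continuous.continuousOn h2
      refine (this.integrable_of_forall_notMem_eq_zero ?_).integrableOn
      intro x hx
      simp [image_eq_zero_of_notMem_tsupport hx]
    have hzero : ∀ x, x ∉ Ω → ψ x • (G - H) x = 0 := fun x hx => by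
      simp [image_eq_zero_of_notMem_tsupport (fun h => hx (h3 h))]
    rw [← setIntegral_eq_integral_of_forall_compl_eq_zero hzero]
    simp only [Pi.sub_apply, smul_sub]
    rw [integral_sub (hint G hG.locallyIntegrableOn_gradient)
      (hint H hH.locallyIntegrableOn_gradient)]
    have e := (hG.integral_eq ψ hψ).symm.trans (hH.integral_eq ψ hψ)
    rw [neg_inj.mp e, sub_self]
  rw [Filter.EventuallyEq, ae_restrict_iff' hΩ.measurableSet]
  filter_upwards [key] with x hx hxΩ
  exact sub_eq_zero.mp (hx hxΩ)

open Classical in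
/-- The weak gradient `∇u` on `Ω` (a representative of it; zero if there is none). -/
noncomputable def weakGradient {n : ℕ} (Ω : Set (EuclideanSpace ℝ (Fin n)))
    (u : EuclideanSpace ℝ (Fin n) → ℝ) : EuclideanSpace ℝ (Fin n) → EuclideanSpace ℝ (Fin n) :=
  if h : ∃ G, HasWeakGradient Ω u G then h.choose else 0

/-- `u ∈ W^{1,p}(Ω)`, for `1 ≤ p ≤ ∞`. Functions matter only up to null sets of `Ω`. -/
structure MemW1 {n : ℕ} (Ω : Set (EuclideanSpace ℝ (Fin n))) (p : ℝ≥0∞)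
    (u : EuclideanSpace ℝ (Fin n) → ℝ) : Prop where
  exists_weakGradient : ∃ G, HasWeakGradient Ω u G
  memLp : MemLp u p (volume.restrict Ω)
  memLp_weakGradient : MemLp (weakGradient Ω u) p (volume.restrict Ω)

/-- `u ∈ W_0^{1,p}(Ω)`: the closure of `C_c^∞(Ω)` in `W^{1,p}(Ω)`. -/
structure MemW1Zero {n : ℕ} (Ω : Set (EuclideanSpace ℝ (Fin n))) (p : ℝ≥0∞)
    (u : EuclideanSpace ℝ (Fin n) → ℝ) : Prop where
  memW1 : MemW1 Ω p u
  exists_approx : ∃ ψ : ℕ → EuclideanSpace ℝ (Fin n) → ℝ, (∀ j, IsTestFunction Ω (ψ j)) ∧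
    Tendsto (fun j => eLpNorm (fun x => u x - ψ j x) p (volume.restrict Ω)) atTop (𝓝 0) ∧
    Tendsto (fun j => eLpNorm (fun x => weakGradient Ω u x - gradient (ψ j) x) p
      (volume.restrict Ω)) atTop (𝓝 0)

/-- `u = f` on `∂Ω` in the sense of traces of `W^{1,p}(Ω)`, `p < ∞`, for a Lipschitz datum `f` on
`∂Ω`: `u - g ∈ W_0^{1,p}(Ω)` for a Lipschitz extension `g` of `f`. -/
def HasBoundaryTrace {n : ℕ} (Ω : Set (EuclideanSpace ℝ (Fin n))) (p : ℝ≥0∞)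
    (u f : EuclideanSpace ℝ (Fin n) → ℝ) : Prop :=
  ∃ g : EuclideanSpace ℝ (Fin n) → ℝ, (∃ K : ℝ≥0, LipschitzWith K g) ∧
    (∀ x ∈ frontier Ω, g x = f x) ∧ MemW1Zero Ω p (fun x => u x - g x)

/-- The positivity set `{u > 0}` in `Ω`. -/
def positivitySet {n : ℕ} (Ω : Set (EuclideanSpace ℝ (Fin n)))
    (u : EuclideanSpace ℝ (Fin n) → ℝ) : Set (EuclideanSpace ℝ (Fin n)) :=
  {x | x ∈ Ω ∧ 0 < u x}

/-- The competitors of the volume-constrained `p`-Dirichlet problem. -/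
structure IsAdmissibleP {n : ℕ} (Ω : Set (EuclideanSpace ℝ (Fin n)))
    (f : EuclideanSpace ℝ (Fin n) → ℝ) (α p : ℝ) (u : EuclideanSpace ℝ (Fin n) → ℝ) : Prop where
  memW1 : MemW1 Ω (ENNReal.ofReal p) u
  boundary : HasBoundaryTrace Ω (ENNReal.ofReal p) u f
  volume_le : volume (positivitySet Ω u) ≤ ENNReal.ofReal α

/-- The `p`-Dirichlet integral `∫_Ω |∇u|^p`. -/
noncomputable def dirichletEnergy {n : ℕ} (Ω : Set (EuclideanSpace ℝ (Fin n))) (p : ℝ)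
    (u : EuclideanSpace ℝ (Fin n) → ℝ) : ℝ≥0∞ :=
  ∫⁻ x in Ω, ‖weakGradient Ω u x‖ₑ ^ p

/-- `u` is a minimizer of the volume-constrained `p`-Dirichlet problem. -/
def IsMinimizerP {n : ℕ} (Ω : Set (EuclideanSpace ℝ (Fin n)))
    (f : EuclideanSpace ℝ (Fin n) → ℝ) (α p : ℝ) (u : EuclideanSpace ℝ (Fin n) → ℝ) : Prop :=
  IsAdmissibleP Ω f α p u ∧
    ∀ v, IsAdmissibleP Ω f α p v → dirichletEnergy Ω p u ≤ dirichletEnergy Ω p v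

/-- The Lipschitz constant `sup_{x,y ∈ Ω} |u(x) - u(y)| / |x - y|` (the quotient is `0` if
`x = y`). -/
noncomputable def lipConst {n : ℕ} (Ω : Set (EuclideanSpace ℝ (Fin n)))
    (u : EuclideanSpace ℝ (Fin n) → ℝ) : ℝ≥0∞ :=
  ⨆ x ∈ Ω, ⨆ y ∈ Ω, edist (u x) (u y) / edist x y

/-- The competitors of the limit problem: functions in `W^{1,∞}(Ω)`, represented by their
version that is continuous on the closure of `Ω`, with pointwise boundary values `f`. -/
structure IsAdmissibleInfty {n : ℕ} (Ω : Set (EuclideanSpace ℝ (Fin n)))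
    (f : EuclideanSpace ℝ (Fin n) → ℝ) (α : ℝ) (u : EuclideanSpace ℝ (Fin n) → ℝ) : Prop where
  memW1 : MemW1 Ω ∞ u
  continuousOn : ContinuousOn u (closure Ω)
  boundary : ∀ x ∈ frontier Ω, u x = f x
  volume_le : volume (positivitySet Ω u) ≤ ENNReal.ofReal α

/-- `u` is a minimizer of the limit problem. -/
def IsMinimizerInfty {n : ℕ} (Ω : Set (EuclideanSpace ℝ (Fin n)))
    (f : EuclideanSpace ℝ (Fin n) → ℝ) (α : ℝ) (u : EuclideanSpace ℝ (Fin n) → ℝ) : Prop :=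
  IsAdmissibleInfty Ω f α u ∧ ∀ v, IsAdmissibleInfty Ω f α v → lipConst Ω u ≤ lipConst Ω v

/-- Weak convergence `v k ⇀ w` in `W^{1,q}(Ω)`, `1 < q < ∞`: weak convergence in `L^q(Ω)`, tested
with `L^{q'}(Ω)`, of the functions and of their weak gradients. Finitely many `v k` need not lie
in `W^{1,q}(Ω)`. -/
structure TendstoWeaklyW1 {n : ℕ} (Ω : Set (EuclideanSpace ℝ (Fin n))) (q : ℝ)
    (v : ℕ → EuclideanSpace ℝ (Fin n) → ℝ) (w : EuclideanSpace ℝ (Fin n) → ℝ) : Prop where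
  eventually_memW1 : ∀ᶠ k in atTop, MemW1 Ω (ENNReal.ofReal q) (v k)
  memW1 : MemW1 Ω (ENNReal.ofReal q) w
  tendsto : ∀ h : EuclideanSpace ℝ (Fin n) → ℝ,
    MemLp h (ENNReal.ofReal (Real.conjExponent q)) (volume.restrict Ω) →
      Tendsto (fun k => ∫ x in Ω, v k x * h x) atTop (𝓝 (∫ x in Ω, w x * h x))
  tendsto_weakGradient : ∀ h : EuclideanSpace ℝ (Fin n) → EuclideanSpace ℝ (Fin n),
    MemLp h (ENNReal.ofReal (Real.conjExponent q)) (volume.restrict Ω) →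
      Tendsto (fun k => ∫ x in Ω, inner ℝ (weakGradient Ω (v k) x) (h x)) atTop
        (𝓝 (∫ x in Ω, inner ℝ (weakGradient Ω w x) (h x)))

/-- `u` is a viscosity supersolution of `F(x, Du, D²u) = 0` in the open set `U`. Second
derivatives enter as bilinear forms, first derivatives as gradients. -/
def IsViscositySupersolution {n : ℕ}
    (F : EuclideanSpace ℝ (Fin n) → EuclideanSpace ℝ (Fin n) →
      (EuclideanSpace ℝ (Fin n) →L[ℝ] EuclideanSpace ℝ (Fin n) →L[ℝ] ℝ) → ℝ)
    (U : Set (EuclideanSpace ℝ (Fin n))) (u : EuclideanSpace ℝ (Fin n) → ℝ) : Prop :=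
  LowerSemicontinuousOn u U ∧
    ∀ φ : EuclideanSpace ℝ (Fin n) → ℝ, ContDiffOn ℝ 2 φ U → ∀ x₀ ∈ U, u x₀ = φ x₀ →
      (∀ᶠ x in 𝓝[≠] x₀, φ x < u x) →
        0 ≤ F x₀ (gradient φ x₀) (fderiv ℝ (fderiv ℝ φ) x₀)

/-- `u` is a viscosity subsolution of `F(x, Du, D²u) = 0` in the open set `U`. -/
def IsViscositySubsolution {n : ℕ}
    (F : EuclideanSpace ℝ (Fin n) → EuclideanSpace ℝ (Fin n) →
      (EuclideanSpace ℝ (Fin n) →L[ℝ] EuclideanSpace ℝ (Fin n) →L[ℝ] ℝ) → ℝ)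
    (U : Set (EuclideanSpace ℝ (Fin n))) (u : EuclideanSpace ℝ (Fin n) → ℝ) : Prop :=
  UpperSemicontinuousOn u U ∧
    ∀ φ : EuclideanSpace ℝ (Fin n) → ℝ, ContDiffOn ℝ 2 φ U → ∀ x₀ ∈ U, u x₀ = φ x₀ →
      (∀ᶠ x in 𝓝[≠] x₀, u x < φ x) →
        F x₀ (gradient φ x₀) (fderiv ℝ (fderiv ℝ φ) x₀) ≤ 0

/-- `u` solves `-Δ_∞ u = 0` in the open set `U` in the viscosity sense, where
`Δ_∞ u = Du D²u (Du)^t`. -/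
def IsInfinityHarmonic {n : ℕ} (U : Set (EuclideanSpace ℝ (Fin n)))
    (u : EuclideanSpace ℝ (Fin n) → ℝ) : Prop :=
  IsViscositySupersolution (fun _ ξ X => -(X ξ ξ)) U u ∧
    IsViscositySubsolution (fun _ ξ X => -(X ξ ξ)) U u

/-! ### Weak gradients -/

/-! Compactness. Subtracting a large multiple of the distance to `Ωᶜ` from a Lipschitz extension `g`
of `f` gives one Lipschitz competitor for all exponents
(`exists_lipschitzWith_volume_positivitySet_le`), so minimality yields `‖∇u_p‖_p ≤ M |Ω|^(1/p)`.
Morrey's inequality with a constant bounded in `p` (`morrey_inequality`), applied to `u_p - g` in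
`W_0^{1,p}`, then gives Hölder bounds with exponents `1 - n/p → 1`, and Arzelà-Ascoli a uniform
limit `u_∞` that is Lipschitz (`exists_subseq_tendsto_lipschitzWith`). Weak convergence follows from
the bounded gradients and convergence in the sense of distributions.

Minimality. Any competitor with Lipschitz constant `M` can serve in the energy bound. Mollifying
`u_p` at a fixed scale turns that bound into a pointwise gradient bound tending to `M`, so `u_∞` is
`M`-Lipschitz along segments in `Ω` (`abs_sub_le_of_segment_subset`). On `∂Ω` it agrees with the
competitor, and a segment leaving `Ω` is cut at its first and last points outside `Ω`
(`abs_sub_le_of_segment_of_frontier`). The volume constraint survives because `{u_∞ > c}`, `c > 0`,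
lies in `{u_p > 0}` for large `p`.

Equation. Up to a positive factor the `p`-Laplacian of `φ` is `(p - 2) Δ_∞ φ + |∇φ|² Δφ`, so `Δ_∞
φ(x₀) > 0` makes `φ` a strict `p`-subsolution near `x₀` for large `p`. If `φ` also touches `u_∞`
strictly from below at `x₀`, a vertical translate of `φ` crosses `u_p`, and by convexity raising
`u_p` towards it lowers the energy (`exists_dirichletEnergy_lt`). As `u_p > 0` near `x₀`, the
positivity set does not grow, which contradicts minimality. Touching from above is the same
statement for `-u_p`; there `u_p` is lowered, which can only shrink the positivity set.

Pointwise calculus is done only for Lipschitz functions, through Rademacher's theorem; it reaches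
Sobolev functions because the weak gradient is closed and functions of `W_0^{1,p}`, `p ≥ 2 n`, are
uniform limits of test functions. -/

theorem MeasureTheory.LocallyIntegrableOn.congr_ae {X F : Type*} [MeasurableSpace X]
    [TopologicalSpace X] [NormedAddCommGroup F] {μ : Measure X} {s : Set X} {f g : X → F}
    (hf : LocallyIntegrableOn f s μ) (hfg : f =ᵐ[μ.restrict s] g) :
    LocallyIntegrableOn g s μ := by
  intro x hx
  obtain ⟨t, ht, hft⟩ := hf x hx
  refine ⟨t ∩ s, inter_mem ht self_mem_nhdsWithin, ?_⟩
  exact (hft.mono_set Set.inter_subset_left).congr_fun_ae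
    (ae_restrict_of_ae_restrict_of_subset Set.inter_subset_right hfg)

section

variable {n : ℕ} {Ω : Set (EuclideanSpace ℝ (Fin n))}
  {u v : EuclideanSpace ℝ (Fin n) → ℝ}
  {G H : EuclideanSpace ℝ (Fin n) → EuclideanSpace ℝ (Fin n)}

theorem norm_gradient_eq (h : EuclideanSpace ℝ (Fin n) → ℝ) (x : EuclideanSpace ℝ (Fin n)) :
    ‖gradient h x‖ = ‖fderiv ℝ h x‖ := by
  simp [gradient]

theorem LipschitzWith.norm_gradient_le {K : ℝ≥0} (hu : LipschitzWith K u)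
    (x : EuclideanSpace ℝ (Fin n)) : ‖gradient u x‖ ≤ K := by
  rw [norm_gradient_eq]; exact norm_fderiv_le_of_lipschitz ℝ hu

theorem measurable_gradient (u : EuclideanSpace ℝ (Fin n) → ℝ) : Measurable (gradient u) :=
  (InnerProductSpace.toDual ℝ (EuclideanSpace ℝ (Fin n))).symm.continuous.measurable.comp
    (measurable_fderiv ℝ u)

theorem ContDiff.continuous_gradient {m : WithTop ℕ∞} (hu : ContDiff ℝ m u) (hm : m ≠ 0) :
    Continuous (gradient u) :=
  (InnerProductSpace.toDual ℝ (EuclideanSpace ℝ (Fin n))).symm.continuous.comp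
    (hu.continuous_fderiv hm)

theorem support_gradient_subset (u : EuclideanSpace ℝ (Fin n) → ℝ) :
    Function.support (gradient u) ⊆ tsupport u := by
  intro x hx
  refine support_fderiv_subset ℝ (f := u) (Function.mem_support.2 ?_)
  simpa [gradient] using hx

theorem tsupport_gradient_subset (u : EuclideanSpace ℝ (Fin n) → ℝ) :
    tsupport (gradient u) ⊆ tsupport u :=
  closure_minimal (support_gradient_subset u) (isClosed_tsupport u)

theorem IsTestFunction.continuous_gradient {ψ : EuclideanSpace ℝ (Fin n) → ℝ}
    (hψ : IsTestFunction Ω ψ) : Continuous (gradient ψ) :=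
  hψ.contDiff.continuous_gradient (by simp)

theorem IsTestFunction.hasCompactSupport_gradient {ψ : EuclideanSpace ℝ (Fin n) → ℝ}
    (hψ : IsTestFunction Ω ψ) : HasCompactSupport (gradient ψ) :=
  hψ.hasCompactSupport.of_isClosed_subset (isClosed_tsupport _) (tsupport_gradient_subset ψ)

theorem IsTestFunction.exists_lipschitzWith {ψ : EuclideanSpace ℝ (Fin n) → ℝ}
    (hψ : IsTestFunction Ω ψ) : ∃ K, LipschitzWith K ψ :=
  ContDiff.lipschitzWith_of_hasCompactSupport hψ.hasCompactSupport hψ.contDiff (by simp)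

theorem IsTestFunction.eq_zero_of_notMem {ψ : EuclideanSpace ℝ (Fin n) → ℝ}
    (hψ : IsTestFunction Ω ψ) {x : EuclideanSpace ℝ (Fin n)} (hx : x ∉ Ω) : ψ x = 0 :=
  image_eq_zero_of_notMem_tsupport fun h => hx (hψ.tsupport_subset h)

theorem IsTestFunction.gradient_eq_zero_of_notMem {ψ : EuclideanSpace ℝ (Fin n) → ℝ}
    (hψ : IsTestFunction Ω ψ) {x : EuclideanSpace ℝ (Fin n)} (hx : x ∉ Ω) : gradient ψ x = 0 :=
  image_eq_zero_of_notMem_tsupport fun h => hx (hψ.tsupport_subset (tsupport_gradient_subset ψ h))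

theorem MeasureTheory.LocallyIntegrableOn.integrableOn_test_smul
    {ψ : EuclideanSpace ℝ (Fin n) → ℝ} (hψ : IsTestFunction Ω ψ) (hG : LocallyIntegrableOn G Ω) :
    IntegrableOn (fun x => ψ x • G x) Ω := by
  have : IntegrableOn (fun x => ψ x • G x) (tsupport ψ) :=
    (hG.integrableOn_compact_subset hψ.tsupport_subset hψ.hasCompactSupport).continuousOn_smul
      hψ.contDiff.continuous.continuousOn hψ.hasCompactSupport
  refine (this.integrable_of_forall_notMem_eq_zero fun x hx => ?_).integrableOn
  simp [image_eq_zero_of_notMem_tsupport hx]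

theorem MeasureTheory.LocallyIntegrableOn.integrableOn_smul_gradient_test
    {ψ : EuclideanSpace ℝ (Fin n) → ℝ} (hψ : IsTestFunction Ω ψ) (hu : LocallyIntegrableOn u Ω) :
    IntegrableOn (fun x => u x • gradient ψ x) Ω := by
  have : IntegrableOn (fun x => u x • gradient ψ x) (tsupport ψ) :=
    (hu.integrableOn_compact_subset hψ.tsupport_subset hψ.hasCompactSupport).smul_continuousOn
      hψ.continuous_gradient.continuousOn hψ.hasCompactSupport
  refine (this.integrable_of_forall_notMem_eq_zero fun x hx => ?_).integrableOn
  simp [image_eq_zero_of_notMem_tsupport fun h => hx (tsupport_gradient_subset ψ h)]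

theorem hasWeakGradient_weakGradient (h : ∃ G, HasWeakGradient Ω u G) :
    HasWeakGradient Ω u (weakGradient Ω u) := by
  rw [weakGradient, dif_pos h]
  exact h.choose_spec

theorem HasWeakGradient.weakGradient_ae_eq (hΩ : IsOpen Ω) (h : HasWeakGradient Ω u G) :
    weakGradient Ω u =ᵐ[volume.restrict Ω] G :=
  (hasWeakGradient_weakGradient ⟨G, h⟩).ae_eq hΩ h

theorem HasWeakGradient.congr_ae (h : HasWeakGradient Ω u G)
    (huv : u =ᵐ[volume.restrict Ω] v) (hGH : G =ᵐ[volume.restrict Ω] H) :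
    HasWeakGradient Ω v H where
  locallyIntegrableOn := h.locallyIntegrableOn.congr_ae huv
  locallyIntegrableOn_gradient := h.locallyIntegrableOn_gradient.congr_ae hGH
  integral_eq ψ hψ := by
    have h1 : ∫ x in Ω, v x • gradient ψ x = ∫ x in Ω, u x • gradient ψ x :=
      integral_congr_ae (huv.mono fun x hx => by simp only [hx])
    have h2 : ∫ x in Ω, ψ x • H x = ∫ x in Ω, ψ x • G x :=
      integral_congr_ae (hGH.mono fun x hx => by simp only [hx])
    rw [h1, h2, h.integral_eq ψ hψ]

theorem HasWeakGradient.add (hu : HasWeakGradient Ω u G) (hv : HasWeakGradient Ω v H) :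
    HasWeakGradient Ω (fun x => u x + v x) (fun x => G x + H x) where
  locallyIntegrableOn := hu.locallyIntegrableOn.add hv.locallyIntegrableOn
  locallyIntegrableOn_gradient :=
    hu.locallyIntegrableOn_gradient.add hv.locallyIntegrableOn_gradient
  integral_eq ψ hψ := by
    simp only [add_smul, smul_add]
    rw [integral_add (hu.locallyIntegrableOn.integrableOn_smul_gradient_test hψ)
        (hv.locallyIntegrableOn.integrableOn_smul_gradient_test hψ),
      integral_add (hu.locallyIntegrableOn_gradient.integrableOn_test_smul hψ)
        (hv.locallyIntegrableOn_gradient.integrableOn_test_smul hψ), hu.integral_eq ψ hψ,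
      hv.integral_eq ψ hψ, neg_add]

theorem HasWeakGradient.neg (hu : HasWeakGradient Ω u G) :
    HasWeakGradient Ω (fun x => -u x) (fun x => -G x) where
  locallyIntegrableOn := hu.locallyIntegrableOn.neg
  locallyIntegrableOn_gradient := hu.locallyIntegrableOn_gradient.neg
  integral_eq ψ hψ := by
    simp only [neg_smul, smul_neg, integral_neg, hu.integral_eq ψ hψ]

theorem HasWeakGradient.sub (hu : HasWeakGradient Ω u G) (hv : HasWeakGradient Ω v H) :
    HasWeakGradient Ω (fun x => u x - v x) (fun x => G x - H x) := by
  simpa only [sub_eq_add_neg] using hu.add hv.neg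

/-- A Lipschitz function has its almost everywhere gradient as weak gradient. -/
theorem LipschitzWith.hasWeakGradient {K : ℝ≥0} (hu : LipschitzWith K u)
    (Ω : Set (EuclideanSpace ℝ (Fin n))) :
    HasWeakGradient Ω u (gradient u) := by
  have hloc : LocallyIntegrable (gradient u) := by
    refine MemLp.locallyIntegrable (p := ∞) ?_ le_top
    exact memLp_top_of_bound (measurable_gradient u).aestronglyMeasurable K
      (Eventually.of_forall hu.norm_gradient_le)
  refine ⟨hu.continuous.locallyIntegrable.locallyIntegrableOn _, hloc.locallyIntegrableOn _, ?_⟩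
  intro ψ hψ
  obtain ⟨D, hD⟩ := hψ.exists_lipschitzWith
  -- In a fixed direction `v` the identity is integration by parts for line derivatives of Lipschitz
  -- functions; Rademacher's theorem turns the line derivative of `u` into its gradient.
  refine ext_inner_left ℝ fun v => ?_
  rw [inner_neg_right, ← integral_inner
      (hu.continuous.locallyIntegrable.locallyIntegrableOn Ω |>.integrableOn_smul_gradient_test hψ),
    ← integral_inner ((hloc.locallyIntegrableOn Ω).integrableOn_test_smul hψ),
    setIntegral_eq_integral_of_forall_compl_eq_zero
      (fun x hx => by simp [hψ.gradient_eq_zero_of_notMem hx]),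
    setIntegral_eq_integral_of_forall_compl_eq_zero
      (fun x hx => by simp [hψ.eq_zero_of_notMem hx])]
  have key := hu.integral_lineDeriv_mul_eq (μ := volume) hD hψ.hasCompactSupport v
  have h1 : ∫ x, inner ℝ v (u x • gradient ψ x) = -∫ x, lineDeriv ℝ ψ x (-v) * u x := by
    rw [← integral_neg]
    refine integral_congr_ae (Eventually.of_forall fun x => ?_)
    have : DifferentiableAt ℝ ψ x := hψ.contDiff.contDiffAt.differentiableAt (by simp)
    simp only [this.lineDeriv_eq_fderiv, inner_smul_right, inner_gradient_right, map_neg]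
    simp [mul_comm]
  have h2 : ∫ x, inner ℝ v (ψ x • gradient u x) = ∫ x, lineDeriv ℝ u x v * ψ x := by
    refine integral_congr_ae ?_
    filter_upwards [hu.ae_differentiableAt (μ := volume)] with x hx
    simp only [hx.lineDeriv_eq_fderiv, inner_smul_right, inner_gradient_right]
    simp [mul_comm]
  rw [h1, h2, key]

theorem eLpNorm_one_tendsto_zero {α F : Type*} [MeasurableSpace α] [NormedAddCommGroup F]
    {μ : Measure α} [IsFiniteMeasure μ] {p : ℝ≥0∞} (hp : 1 ≤ p) {f : ℕ → α → F}
    (hf : ∀ j, AEStronglyMeasurable (f j) μ)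
    (h : Tendsto (fun j => eLpNorm (f j) p μ) atTop (𝓝 0)) :
    Tendsto (fun j => eLpNorm (f j) 1 μ) atTop (𝓝 0) := by
  have hne : μ Set.univ ^ (1 / (1 : ℝ≥0∞).toReal - 1 / p.toReal) ≠ ⊤ := by
    refine ENNReal.rpow_ne_top_of_nonneg ?_ (measure_ne_top _ _)
    rcases eq_or_ne p ⊤ with rfl | hp'
    · simp
    · have : 1 ≤ p.toReal := by
        rw [← ENNReal.toReal_one]; exact ENNReal.toReal_mono hp' hp
      have : 1 / p.toReal ≤ 1 := by rw [div_le_one (by linarith)]; exact this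
      simpa using this
  refine tendsto_of_tendsto_of_tendsto_of_le_of_le tendsto_const_nhds ?_ (fun _ => zero_le)
    fun j => eLpNorm_le_eLpNorm_mul_rpow_measure_univ hp (hf j)
  simpa using ENNReal.Tendsto.mul_const h (Or.inr hne)

/-- The weak gradient is a closed operator. -/
theorem HasWeakGradient.of_tendsto (hΩ : volume Ω ≠ ⊤) {p : ℝ≥0∞} (hp : 1 ≤ p)
    (hu : MemLp u p (volume.restrict Ω)) (hG : MemLp G p (volume.restrict Ω))
    {U : ℕ → EuclideanSpace ℝ (Fin n) → ℝ}
    {V : ℕ → EuclideanSpace ℝ (Fin n) → EuclideanSpace ℝ (Fin n)}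
    (hUV : ∀ j, HasWeakGradient Ω (U j) (V j))
    (hU : ∀ j, MemLp (U j) p (volume.restrict Ω)) (hV : ∀ j, MemLp (V j) p (volume.restrict Ω))
    (hUu : Tendsto (fun j => eLpNorm (fun x => u x - U j x) p (volume.restrict Ω)) atTop (𝓝 0))
    (hVG : Tendsto (fun j => eLpNorm (fun x => G x - V j x) p (volume.restrict Ω)) atTop (𝓝 0)) :
    HasWeakGradient Ω u G := by
  have : IsFiniteMeasure (volume.restrict Ω) := isFiniteMeasure_restrict.2 hΩ
  have hu1 := hu.integrable hp
  have hG1 := hG.integrable hp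
  refine ⟨IntegrableOn.locallyIntegrableOn hu1, IntegrableOn.locallyIntegrableOn hG1, ?_⟩
  intro ψ hψ
  have hUu1 := eLpNorm_one_tendsto_zero hp (fun j => (hu.sub (hU j)).aestronglyMeasurable) hUu
  have hVG1 := eLpNorm_one_tendsto_zero hp (fun j => (hG.sub (hV j)).aestronglyMeasurable) hVG
  obtain ⟨C, hC⟩ := hψ.hasCompactSupport.exists_bound_of_continuous hψ.contDiff.continuous
  obtain ⟨D, hD⟩ := hψ.hasCompactSupport_gradient.exists_bound_of_continuous
    hψ.continuous_gradient
  have bound : ∀ {F : Type} [NormedAddCommGroup F] (g : ℕ → EuclideanSpace ℝ (Fin n) → F)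
      (g' : ℕ → EuclideanSpace ℝ (Fin n) → EuclideanSpace ℝ (Fin n)) (c : ℝ),
      Tendsto (fun j => eLpNorm (g j) 1 (volume.restrict Ω)) atTop (𝓝 0) →
      (∀ j x, ‖g' j x‖ ≤ c * ‖g j x‖) →
      Tendsto (fun j => eLpNorm (g' j) 1 (volume.restrict Ω)) atTop (𝓝 0) := by
    intro F _ g g' c hg hgg'
    refine tendsto_of_tendsto_of_tendsto_of_le_of_le tendsto_const_nhds
      (?_ : Tendsto (fun j => ENNReal.ofReal c * eLpNorm (g j) 1 (volume.restrict Ω)) _ _)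
      (fun _ => zero_le) fun j =>
        eLpNorm_le_mul_eLpNorm_of_ae_le_mul (Eventually.of_forall (hgg' j)) 1
    simpa using ENNReal.Tendsto.const_mul hg (Or.inr ENNReal.ofReal_ne_top)
  have t1 : Tendsto (fun j => ∫ x in Ω, U j x • gradient ψ x) atTop
      (𝓝 (∫ x in Ω, u x • gradient ψ x)) := by
    refine tendsto_integral_of_L1' _
      ((IntegrableOn.locallyIntegrableOn hu1).integrableOn_smul_gradient_test hψ).1
      (Eventually.of_forall fun j => (hUV j).locallyIntegrableOn.integrableOn_smul_gradient_test hψ)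
      ?_
    refine bound _ _ D hUu1 fun j x => ?_
    simp only [Pi.sub_apply]
    rw [← sub_smul, norm_smul, norm_sub_rev, mul_comm]
    exact mul_le_mul_of_nonneg_right (hD x) (norm_nonneg _)
  have t2 : Tendsto (fun j => ∫ x in Ω, ψ x • V j x) atTop (𝓝 (∫ x in Ω, ψ x • G x)) := by
    refine tendsto_integral_of_L1' _
      ((IntegrableOn.locallyIntegrableOn hG1).integrableOn_test_smul hψ).1
      (Eventually.of_forall fun j => (hUV j).locallyIntegrableOn_gradient.integrableOn_test_smul hψ)
      ?_
    refine bound _ _ C hVG1 fun j x => ?_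
    simp only [Pi.sub_apply]
    rw [← smul_sub, norm_smul, norm_sub_rev]
    exact mul_le_mul_of_nonneg_right (hC x) (norm_nonneg _)
  refine tendsto_nhds_unique t1 ?_
  simpa only [fun j => (hUV j).integral_eq ψ hψ] using t2.neg

end

/-! ### The spaces `W^{1,p}` and `W_0^{1,p}` -/

/-- Dominated convergence with a constant majorant. Gradients of approximations converge only in
this mode, hence the exclusion of `p = ∞` in the density results. -/
theorem eLpNorm_tendsto_zero_of_bounded {α F : Type*} [MeasurableSpace α] [NormedAddCommGroup F]
    {μ : Measure α} [IsFiniteMeasure μ] {p : ℝ≥0∞} (hp : 1 ≤ p) (hp' : p ≠ ⊤) {f : ℕ → α → F}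
    (hf : ∀ j, AEStronglyMeasurable (f j) μ) {C : ℝ} (hC : ∀ j, ∀ᵐ x ∂μ, ‖f j x‖ ≤ C)
    (h : ∀ᵐ x ∂μ, Tendsto (fun j => f j x) atTop (𝓝 0)) :
    Tendsto (fun j => eLpNorm (f j) p μ) atTop (𝓝 0) := by
  have hp0 : p ≠ 0 := (zero_lt_one.trans_le hp).ne'
  have hpr : 0 < p.toReal := ENNReal.toReal_pos hp0 hp'
  simp only [eLpNorm_eq_lintegral_rpow_enorm_toReal hp0 hp']
  have key : Tendsto (fun j => ∫⁻ x, ‖f j x‖ₑ ^ p.toReal ∂μ) atTop (𝓝 (∫⁻ _, 0 ∂μ)) := by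
    refine tendsto_lintegral_of_dominated_convergence' (fun _ => ENNReal.ofReal C ^ p.toReal)
      (fun j => (hf j).enorm.pow_const _) (fun j => ?_) ?_ ?_
    · filter_upwards [hC j] with x hx
      refine ENNReal.rpow_le_rpow ?_ hpr.le
      rw [← ofReal_norm]
      exact ENNReal.ofReal_le_ofReal hx
    · rw [lintegral_const]
      exact ENNReal.mul_ne_top (ENNReal.rpow_ne_top_of_nonneg hpr.le ENNReal.ofReal_ne_top)
        (measure_ne_top _ _)
    · filter_upwards [h] with x hx
      have h1 : Tendsto (fun j => ‖f j x‖ₑ) atTop (𝓝 0) := by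
        simpa [Function.comp_def] using (continuous_enorm.tendsto (0 : F)).comp hx
      simpa [ENNReal.zero_rpow_of_pos hpr] using h1.ennrpow_const p.toReal
  rw [lintegral_zero] at key
  simpa [ENNReal.zero_rpow_of_pos, hpr] using key.ennrpow_const (1 / p.toReal)

theorem eLpNorm_tendsto_zero_of_uniform {α F : Type*} [MeasurableSpace α] [NormedAddCommGroup F]
    {μ : Measure α} [IsFiniteMeasure μ] (p : ℝ≥0∞) {f : ℕ → α → F} {C : ℕ → ℝ}
    (hC : ∀ᶠ j in atTop, ∀ᵐ x ∂μ, ‖f j x‖ ≤ C j) (h : Tendsto C atTop (𝓝 0)) :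
    Tendsto (fun j => eLpNorm (f j) p μ) atTop (𝓝 0) := by
  refine tendsto_of_tendsto_of_tendsto_of_le_of_le' tendsto_const_nhds
    (?_ : Tendsto (fun j => μ Set.univ ^ p.toReal⁻¹ * ENNReal.ofReal (C j)) _ _)
    (Eventually.of_forall fun _ => zero_le) (hC.mono fun j hj => eLpNorm_le_of_ae_bound hj)
  have h1 : Tendsto (fun j => ENNReal.ofReal (C j)) atTop (𝓝 0) := by
    simpa using ENNReal.tendsto_ofReal h
  simpa using ENNReal.Tendsto.const_mul h1 (Or.inr
    (ENNReal.rpow_ne_top_of_nonneg (inv_nonneg.2 ENNReal.toReal_nonneg) (measure_ne_top μ _)))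

section

variable {n : ℕ} {Ω : Set (EuclideanSpace ℝ (Fin n))} {p : ℝ≥0∞}
  {u v : EuclideanSpace ℝ (Fin n) → ℝ}
  {G H : EuclideanSpace ℝ (Fin n) → EuclideanSpace ℝ (Fin n)}

theorem LipschitzWith.memLp_restrict {K : ℝ≥0} (hu : LipschitzWith K u)
    (hb : Bornology.IsBounded Ω) (p : ℝ≥0∞) : MemLp u p (volume.restrict Ω) := by
  have : IsFiniteMeasure (volume.restrict Ω) := isFiniteMeasure_restrict.2 hb.measure_lt_top.ne
  obtain ⟨C, hC⟩ := hb.isCompact_closure.exists_bound_of_continuousOn hu.continuous.continuousOn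
  exact MemLp.of_bound hu.continuous.aestronglyMeasurable C
    (ae_restrict_of_ae_restrict_of_subset subset_closure
      (ae_restrict_of_forall_mem isClosed_closure.measurableSet hC))

theorem LipschitzWith.memLp_gradient {K : ℝ≥0} (hu : LipschitzWith K u)
    (hb : Bornology.IsBounded Ω) (p : ℝ≥0∞) : MemLp (gradient u) p (volume.restrict Ω) := by
  have : IsFiniteMeasure (volume.restrict Ω) := isFiniteMeasure_restrict.2 hb.measure_lt_top.ne
  exact MemLp.of_bound (measurable_gradient u).aestronglyMeasurable K
    (Eventually.of_forall hu.norm_gradient_le)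

theorem MemW1.hasWeakGradient (h : MemW1 Ω p u) : HasWeakGradient Ω u (weakGradient Ω u) :=
  hasWeakGradient_weakGradient h.exists_weakGradient

theorem HasWeakGradient.memW1 (hΩ : IsOpen Ω) (h : HasWeakGradient Ω u G)
    (hu : MemLp u p (volume.restrict Ω)) (hG : MemLp G p (volume.restrict Ω)) : MemW1 Ω p u :=
  ⟨⟨G, h⟩, hu, hG.ae_eq (h.weakGradient_ae_eq hΩ).symm⟩

theorem LipschitzWith.weakGradient_ae_eq {K : ℝ≥0} (hu : LipschitzWith K u) (hΩ : IsOpen Ω) :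
    weakGradient Ω u =ᵐ[volume.restrict Ω] gradient u :=
  (hu.hasWeakGradient Ω).weakGradient_ae_eq hΩ

theorem LipschitzWith.memW1 {K : ℝ≥0} (hu : LipschitzWith K u) (hΩ : IsOpen Ω)
    (hb : Bornology.IsBounded Ω) (p : ℝ≥0∞) : MemW1 Ω p u :=
  (hu.hasWeakGradient Ω).memW1 hΩ (hu.memLp_restrict hb p) (hu.memLp_gradient hb p)

theorem MemW1.congr_ae (hΩ : IsOpen Ω) (hu : MemW1 Ω p u) (huv : u =ᵐ[volume.restrict Ω] v) :
    MemW1 Ω p v :=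
  (hu.hasWeakGradient.congr_ae huv EventuallyEq.rfl).memW1 hΩ (hu.memLp.ae_eq huv)
    hu.memLp_weakGradient

theorem weakGradient_congr_ae (hΩ : IsOpen Ω) (h : ∃ G, HasWeakGradient Ω u G)
    (huv : u =ᵐ[volume.restrict Ω] v) :
    weakGradient Ω u =ᵐ[volume.restrict Ω] weakGradient Ω v :=
  (((hasWeakGradient_weakGradient h).congr_ae huv EventuallyEq.rfl).weakGradient_ae_eq hΩ).symm

theorem MemW1.weakGradient_add_ae_eq (hΩ : IsOpen Ω) (hu : MemW1 Ω p u) (hv : MemW1 Ω p v) :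
    weakGradient Ω (fun x => u x + v x) =ᵐ[volume.restrict Ω]
      fun x => weakGradient Ω u x + weakGradient Ω v x :=
  (hu.hasWeakGradient.add hv.hasWeakGradient).weakGradient_ae_eq hΩ

theorem MemW1.weakGradient_sub_ae_eq (hΩ : IsOpen Ω) (hu : MemW1 Ω p u) (hv : MemW1 Ω p v) :
    weakGradient Ω (fun x => u x - v x) =ᵐ[volume.restrict Ω]
      fun x => weakGradient Ω u x - weakGradient Ω v x :=
  (hu.hasWeakGradient.sub hv.hasWeakGradient).weakGradient_ae_eq hΩ

theorem MemW1.weakGradient_neg_ae_eq (hΩ : IsOpen Ω) (hu : MemW1 Ω p u) :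
    weakGradient Ω (fun x => -u x) =ᵐ[volume.restrict Ω] fun x => -weakGradient Ω u x :=
  hu.hasWeakGradient.neg.weakGradient_ae_eq hΩ

theorem MemW1.add (hΩ : IsOpen Ω) (hu : MemW1 Ω p u) (hv : MemW1 Ω p v) :
    MemW1 Ω p (fun x => u x + v x) :=
  (hu.hasWeakGradient.add hv.hasWeakGradient).memW1 hΩ (hu.memLp.add hv.memLp)
    (hu.memLp_weakGradient.add hv.memLp_weakGradient)

theorem MemW1.neg (hΩ : IsOpen Ω) (hu : MemW1 Ω p u) : MemW1 Ω p (fun x => -u x) :=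
  hu.hasWeakGradient.neg.memW1 hΩ hu.memLp.neg hu.memLp_weakGradient.neg

/-- `W_0^{1,p}` is closed, and so is the weak gradient on it. -/
theorem MemW1Zero.of_tendsto (hΩ : IsOpen Ω) (hb : Bornology.IsBounded Ω) (hp : 1 ≤ p)
    (hu : MemLp u p (volume.restrict Ω)) (hG : MemLp G p (volume.restrict Ω))
    {U : ℕ → EuclideanSpace ℝ (Fin n) → ℝ} (hU : ∀ j, MemW1Zero Ω p (U j))
    (hUu : Tendsto (fun j => eLpNorm (fun x => u x - U j x) p (volume.restrict Ω)) atTop (𝓝 0))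
    (hVG : Tendsto (fun j => eLpNorm (fun x => G x - weakGradient Ω (U j) x) p
      (volume.restrict Ω)) atTop (𝓝 0)) :
    MemW1Zero Ω p u ∧ HasWeakGradient Ω u G := by
  have hw : HasWeakGradient Ω u G := HasWeakGradient.of_tendsto hb.measure_lt_top.ne hp hu hG
    (fun j => (hU j).memW1.hasWeakGradient) (fun j => (hU j).memW1.memLp)
    (fun j => (hU j).memW1.memLp_weakGradient) hUu hVG
  refine ⟨⟨hw.memW1 hΩ hu hG, ?_⟩, hw⟩
  -- Diagonal choice: one test function within `1 / (j + 1)` of each `U j`, for values and gradients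
  -- at once.
  have hex : ∀ j : ℕ, ∃ ψ, IsTestFunction Ω ψ ∧
      eLpNorm (fun x => U j x - ψ x) p (volume.restrict Ω) ≤ ENNReal.ofReal (1 / ((j : ℝ) + 1)) ∧
      eLpNorm (fun x => weakGradient Ω (U j) x - gradient ψ x) p (volume.restrict Ω) ≤
        ENNReal.ofReal (1 / ((j : ℝ) + 1)) := by
    intro j
    obtain ⟨ψ, hψ, h1, h2⟩ := (hU j).exists_approx
    have hpos : 0 < ENNReal.ofReal (1 / ((j : ℝ) + 1)) :=
      ENNReal.ofReal_pos.2 Nat.one_div_pos_of_nat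
    obtain ⟨i, hi1, hi2⟩ := ((ENNReal.tendsto_nhds_zero.1 h1 _ hpos).and
      (ENNReal.tendsto_nhds_zero.1 h2 _ hpos)).exists
    exact ⟨ψ i, hψ i, hi1, hi2⟩
  choose ψ hψ h1 h2 using hex
  have hlim : Tendsto (fun j : ℕ => ENNReal.ofReal (1 / ((j : ℝ) + 1))) atTop (𝓝 0) := by
    simpa using ENNReal.tendsto_ofReal tendsto_one_div_add_atTop_nhds_zero_nat
  refine ⟨ψ, hψ, ?_, ?_⟩
  · refine tendsto_of_tendsto_of_tendsto_of_le_of_le tendsto_const_nhds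
      (by simpa only [add_zero] using hUu.add hlim) (fun _ => zero_le) fun j => ?_
    have e : (fun x => u x - ψ j x) = (fun x => u x - U j x) + fun x => U j x - ψ j x := by
      ext x; simp
    rw [e]
    refine (eLpNorm_add_le (hu.sub (hU j).memW1.memLp).aestronglyMeasurable
      ((hU j).memW1.memLp.aestronglyMeasurable.sub
        (hψ j).contDiff.continuous.aestronglyMeasurable) hp).trans ?_
    exact add_le_add le_rfl (h1 j)
  · refine tendsto_of_tendsto_of_tendsto_of_le_of_le tendsto_const_nhds
      (by simpa only [add_zero] using hVG.add hlim) (fun _ => zero_le) fun j => ?_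
    have hae := hw.weakGradient_ae_eq hΩ
    have e : (fun x => weakGradient Ω u x - gradient (ψ j) x) =ᵐ[volume.restrict Ω]
        (fun x => G x - weakGradient Ω (U j) x) +
          fun x => weakGradient Ω (U j) x - gradient (ψ j) x := by
      filter_upwards [hae] with x hx
      simp [hx]
    rw [eLpNorm_congr_ae e]
    refine (eLpNorm_add_le (hG.sub (hU j).memW1.memLp_weakGradient).aestronglyMeasurable
      ((hU j).memW1.memLp_weakGradient.aestronglyMeasurable.sub
        (measurable_gradient _).aestronglyMeasurable) hp).trans ?_
    exact add_le_add le_rfl (h2 j)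

theorem IsTestFunction.add {ψ χ : EuclideanSpace ℝ (Fin n) → ℝ} (hψ : IsTestFunction Ω ψ)
    (hχ : IsTestFunction Ω χ) : IsTestFunction Ω (fun x => ψ x + χ x) where
  contDiff := hψ.contDiff.add hχ.contDiff
  hasCompactSupport := hψ.hasCompactSupport.add hχ.hasCompactSupport
  tsupport_subset := (tsupport_add ψ χ).trans
    (Set.union_subset hψ.tsupport_subset hχ.tsupport_subset)

theorem IsTestFunction.neg {ψ : EuclideanSpace ℝ (Fin n) → ℝ} (hψ : IsTestFunction Ω ψ) :
    IsTestFunction Ω (fun x => -ψ x) where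
  contDiff := hψ.contDiff.neg
  hasCompactSupport := by
    have := hψ.hasCompactSupport
    rw [hasCompactSupport_iff_eventuallyEq] at this ⊢
    filter_upwards [this] with x hx
    simp [hx]
  tsupport_subset := by
    refine (closure_mono ?_ : _ ⊆ tsupport ψ).trans hψ.tsupport_subset
    intro x hx
    simpa using hx

theorem gradient_fun_add {x : EuclideanSpace ℝ (Fin n)} (hu : DifferentiableAt ℝ u x)
    (hv : DifferentiableAt ℝ v x) :
    gradient (fun y => u y + v y) x = gradient u x + gradient v x := by
  simp only [gradient, fderiv_fun_add hu hv, map_add]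

theorem gradient_fun_neg (u : EuclideanSpace ℝ (Fin n) → ℝ) (x : EuclideanSpace ℝ (Fin n)) :
    gradient (fun y => -u y) x = -gradient u x := by
  simp only [gradient, fderiv_fun_neg, map_neg]

theorem IsTestFunction.differentiableAt {ψ : EuclideanSpace ℝ (Fin n) → ℝ}
    (hψ : IsTestFunction Ω ψ) (x : EuclideanSpace ℝ (Fin n)) : DifferentiableAt ℝ ψ x :=
  hψ.contDiff.contDiffAt.differentiableAt (by simp)

theorem MemW1Zero.add (hΩ : IsOpen Ω) (hp : 1 ≤ p) (hu : MemW1Zero Ω p u)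
    (hv : MemW1Zero Ω p v) : MemW1Zero Ω p (fun x => u x + v x) := by
  refine ⟨hu.memW1.add hΩ hv.memW1, ?_⟩
  obtain ⟨ψ, hψ, h1, h2⟩ := hu.exists_approx
  obtain ⟨χ, hχ, h3, h4⟩ := hv.exists_approx
  refine ⟨fun j x => ψ j x + χ j x, fun j => (hψ j).add (hχ j), ?_, ?_⟩
  · refine tendsto_of_tendsto_of_tendsto_of_le_of_le tendsto_const_nhds
      (by simpa using h1.add h3) (fun _ => zero_le) fun j => ?_
    have e : (fun x => u x + v x - (ψ j x + χ j x)) =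
        (fun x => u x - ψ j x) + fun x => v x - χ j x := by
      ext x; simp only [Pi.add_apply]; ring
    rw [e]
    exact eLpNorm_add_le (hu.memW1.memLp.aestronglyMeasurable.sub
      (hψ j).contDiff.continuous.aestronglyMeasurable) (hv.memW1.memLp.aestronglyMeasurable.sub
      (hχ j).contDiff.continuous.aestronglyMeasurable) hp
  · refine tendsto_of_tendsto_of_tendsto_of_le_of_le tendsto_const_nhds
      (by simpa using h2.add h4) (fun _ => zero_le) fun j => ?_
    have e : (fun x => weakGradient Ω (fun x => u x + v x) x -
        gradient (fun x => ψ j x + χ j x) x) =ᵐ[volume.restrict Ω]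
        (fun x => weakGradient Ω u x - gradient (ψ j) x) +
          fun x => weakGradient Ω v x - gradient (χ j) x := by
      filter_upwards [hu.memW1.weakGradient_add_ae_eq hΩ hv.memW1] with x hx
      rw [hx, gradient_fun_add ((hψ j).differentiableAt x) ((hχ j).differentiableAt x)]
      simp only [Pi.add_apply]; abel
    rw [eLpNorm_congr_ae e]
    exact eLpNorm_add_le (hu.memW1.memLp_weakGradient.aestronglyMeasurable.sub
      (measurable_gradient _).aestronglyMeasurable)
      (hv.memW1.memLp_weakGradient.aestronglyMeasurable.sub
      (measurable_gradient _).aestronglyMeasurable) hp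

theorem MemW1Zero.neg (hΩ : IsOpen Ω) (hu : MemW1Zero Ω p u) :
    MemW1Zero Ω p (fun x => -u x) := by
  refine ⟨hu.memW1.neg hΩ, ?_⟩
  obtain ⟨ψ, hψ, h1, h2⟩ := hu.exists_approx
  refine ⟨fun j x => -ψ j x, fun j => (hψ j).neg, ?_, ?_⟩
  · refine h1.congr fun j => ?_
    rw [← eLpNorm_neg]
    congr 1
    ext x
    simp only [Pi.neg_apply]; ring
  · refine h2.congr fun j => ?_
    rw [← eLpNorm_neg]
    refine eLpNorm_congr_ae ?_
    filter_upwards [hu.memW1.weakGradient_neg_ae_eq hΩ] with x hx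
    rw [hx, gradient_fun_neg]
    simp only [Pi.neg_apply]; abel

theorem MemW1Zero.congr_ae (hΩ : IsOpen Ω) (hu : MemW1Zero Ω p u)
    (huv : u =ᵐ[volume.restrict Ω] v) : MemW1Zero Ω p v := by
  refine ⟨hu.memW1.congr_ae hΩ huv, ?_⟩
  obtain ⟨ψ, hψ, h1, h2⟩ := hu.exists_approx
  refine ⟨ψ, hψ, h1.congr fun j => eLpNorm_congr_ae ?_, h2.congr fun j => eLpNorm_congr_ae ?_⟩
  · filter_upwards [huv] with x hx
    rw [hx]
  · filter_upwards [weakGradient_congr_ae hΩ hu.memW1.exists_weakGradient huv] with x hx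
    rw [hx]

/-! ### Mollification -/

/-- The gradient of a mollification is the mollification of the weak gradient. -/
theorem HasWeakGradient.hasGradientAt_convolution (h : HasWeakGradient Ω u G)
    (hu : LocallyIntegrable u) (φ : ContDiffBump (0 : EuclideanSpace ℝ (Fin n)))
    {x : EuclideanSpace ℝ (Fin n)} (hx : Metric.closedBall x φ.rOut ⊆ Ω) :
    HasGradientAt (convolution (φ.normed volume) u (ContinuousLinearMap.lsmul ℝ ℝ) volume)
      (∫ y in Ω, φ.normed volume (x - y) • G y) x := by
  set η := φ.normed (volume : Measure (EuclideanSpace ℝ (Fin n))) with hη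
  have hηs : ContDiff ℝ ∞ η := φ.contDiff_normed
  have hηc : HasCompactSupport η := φ.hasCompactSupport_normed
  rw [hasGradientAt_iff_hasFDerivAt]
  have hsub : ContDiff ℝ ∞ (fun y : EuclideanSpace ℝ (Fin n) => x - y) :=
    contDiff_const.sub contDiff_id
  -- The reflected kernel is an admissible test function since the ball of radius `φ.rOut` lies in
  -- `Ω`; the sign from the reflection cancels the one from integration by parts.
  have hψ : IsTestFunction Ω (fun y => η (x - y)) := by
    have hts : tsupport (fun y => η (x - y)) ⊆ Metric.closedBall x φ.rOut := by
      refine closure_minimal ?_ Metric.isClosed_closedBall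
      intro y hy
      have : x - y ∈ tsupport η := subset_tsupport η hy
      rw [hη, φ.tsupport_normed_eq] at this
      simpa [dist_eq_norm, norm_sub_rev] using this
    exact ⟨hηs.comp hsub,
      (isCompact_closedBall x φ.rOut).of_isClosed_subset (isClosed_tsupport _) hts, hts.trans hx⟩
  have hgrad : ∀ y v, inner ℝ v (gradient (fun y => η (x - y)) y) = -(fderiv ℝ η (x - y)) v := by
    intro y v
    rw [inner_gradient_right]
    have hd : HasFDerivAt η (fderiv ℝ η (x - y)) (x - y) :=
      (hηs.contDiffAt.differentiableAt (by simp)).hasFDerivAt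
    have : HasFDerivAt (fun y => η (x - y)) ((fderiv ℝ η (x - y)).comp
        (-ContinuousLinearMap.id ℝ (EuclideanSpace ℝ (Fin n)))) y :=
      hd.comp y ((hasFDerivAt_id y).const_sub x)
    rw [this.fderiv]
    simp
  have hconv := hηc.hasFDerivAt_convolution_left (ContinuousLinearMap.lsmul ℝ ℝ)
    (hηs.of_le (by simp)) hu x
  refine hconv.congr_fderiv ?_
  ext v
  rw [convolution_eq_swap, ContinuousLinearMap.integral_apply]
  · rw [InnerProductSpace.toDual_apply_apply, real_inner_comm]
    have e := h.integral_eq _ hψ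
    rw [← neg_eq_iff_eq_neg] at e
    rw [← e, inner_neg_right, ← integral_inner
      (h.locallyIntegrableOn.integrableOn_smul_gradient_test hψ), ← integral_neg,
      setIntegral_eq_integral_of_forall_compl_eq_zero
        (fun y hy => by rw [hψ.gradient_eq_zero_of_notMem hy]; simp)]
    refine integral_congr_ae (Eventually.of_forall fun y => ?_)
    simp only [inner_smul_right, hgrad]
    simp [mul_comm]
  · exact (HasCompactSupport.convolutionExists_left _ (hηc.fderiv ℝ)
      (hηs.continuous_fderiv (by simp)) hu x).integrable_swap

/-- Compactly supported Lipschitz functions are in `W_0^{1,p}`. -/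
theorem LipschitzWith.memW1Zero_of_hasCompactSupport {K : ℝ≥0} (hu : LipschitzWith K u)
    (hΩ : IsOpen Ω) (hb : Bornology.IsBounded Ω) (hp : 1 ≤ p) (hp' : p ≠ ⊤)
    (hc : HasCompactSupport u) (hs : tsupport u ⊆ Ω) : MemW1Zero Ω p u := by
  have : IsFiniteMeasure (volume.restrict Ω) := isFiniteMeasure_restrict.2 hb.measure_lt_top.ne
  refine ⟨hu.memW1 hΩ hb p, ?_⟩
  obtain ⟨δ, hδ, hδs⟩ := hc.isCompact.exists_cthickening_subset_open hΩ hs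
  -- The fixed ratio 2 of the radii is what the Lebesgue differentiation theorem for mollifiers asks
  -- for (`K := 2` below).
  let φ : ℕ → ContDiffBump (0 : EuclideanSpace ℝ (Fin n)) := fun i =>
    ⟨δ * (1 / ((i : ℝ) + 1)) / 2, δ * (1 / ((i : ℝ) + 1)),
      half_pos (mul_pos hδ Nat.one_div_pos_of_nat),
      half_lt_self (mul_pos hδ Nat.one_div_pos_of_nat)⟩
  have hrOut : ∀ i, (φ i).rOut = δ * (1 / ((i : ℝ) + 1)) := fun i => rfl
  have hrle : ∀ i, (φ i).rOut ≤ δ := fun i => by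
    rw [hrOut]
    refine mul_le_of_le_one_right hδ.le ?_
    rw [div_le_one (by positivity)]
    linarith [(Nat.cast_nonneg i : (0 : ℝ) ≤ i)]
  have hr0 : Tendsto (fun i => (φ i).rOut) atTop (𝓝 0) := by
    simpa [hrOut] using tendsto_one_div_add_atTop_nhds_zero_nat.const_mul δ
  let ψ : ℕ → EuclideanSpace ℝ (Fin n) → ℝ := fun i =>
    convolution ((φ i).normed volume) u (ContinuousLinearMap.lsmul ℝ ℝ) volume
  have hgrad : ∀ i x, gradient (ψ i) x =
      convolution ((φ i).normed volume) (gradient u) (ContinuousLinearMap.lsmul ℝ ℝ) volume x := by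
    intro i x
    have := ((hu.hasWeakGradient Set.univ).hasGradientAt_convolution
      hu.continuous.locallyIntegrable (φ i) (Set.subset_univ (Metric.closedBall x _))).gradient
    rw [this, convolution_eq_swap, setIntegral_univ]
    simp
  have hloc : LocallyIntegrable (gradient u) := by
    rw [← locallyIntegrableOn_univ]
    exact (hu.hasWeakGradient Set.univ).locallyIntegrableOn_gradient
  refine ⟨ψ, fun i => ⟨?_, ?_, ?_⟩, ?_, ?_⟩
  · exact (φ i).hasCompactSupport_normed.contDiff_convolution_left _
      (φ i).contDiff_normed hu.continuous.locallyIntegrable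
  · exact HasCompactSupport.convolution _ (φ i).hasCompactSupport_normed hc
  · refine (closure_minimal ?_ Metric.isClosed_cthickening).trans hδs
    refine (support_convolution_subset (ContinuousLinearMap.lsmul ℝ ℝ)).trans ?_
    rintro _ ⟨a, ha, b, hb', rfl⟩
    refine Metric.mem_cthickening_of_dist_le _ b _ _ (subset_tsupport u hb') ?_
    have ha' : a ∈ Metric.closedBall 0 (φ i).rOut := by
      rw [← (φ i).tsupport_normed_eq (μ := volume)]; exact subset_tsupport _ ha
    have : ‖a‖ ≤ (φ i).rOut := by simpa using ha'
    simpa using this.trans (hrle i)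
  · refine eLpNorm_tendsto_zero_of_uniform p (C := fun i => K * (φ i).rOut)
      (Eventually.of_forall fun i => Eventually.of_forall fun x => ?_) (by simpa using hr0.const_mul (K : ℝ))
    rw [← dist_eq_norm, dist_comm]
    refine ContDiffBump.dist_normed_convolution_le hu.continuous.aestronglyMeasurable fun y hy => ?_
    exact (hu.dist_le_mul y x).trans (mul_le_mul_of_nonneg_left (Metric.mem_ball.1 hy).le K.2)
  · have e : ∀ i, (fun x => weakGradient Ω u x - gradient (ψ i) x) =ᵐ[volume.restrict Ω]
        fun x => gradient u x - gradient (ψ i) x := fun i => by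
      filter_upwards [hu.weakGradient_ae_eq hΩ] with x hx
      rw [hx]
    simp only [fun i => eLpNorm_congr_ae (p := p) (e i)]
    refine eLpNorm_tendsto_zero_of_bounded hp hp' (C := K + K)
      (fun i => ((measurable_gradient _).sub (measurable_gradient _)).aestronglyMeasurable)
      (fun i => Eventually.of_forall fun x => ?_) ?_
    · refine (_root_.norm_sub_le _ _).trans (add_le_add (hu.norm_gradient_le x) ?_)
      rw [hgrad, convolution_eq_swap]
      refine (norm_integral_le_of_norm_le (g := fun t => (φ i).normed volume (x - t) * K)
        (((φ i).integrable_normed.comp_sub_left x).mul_const _)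
        (Eventually.of_forall fun t => ?_)).trans ?_
      · simp only [ContinuousLinearMap.lsmul_apply, norm_smul,
          Real.norm_of_nonneg ((φ i).nonneg_normed _)]
        exact mul_le_mul_of_nonneg_left (hu.norm_gradient_le t) ((φ i).nonneg_normed _)
      · rw [integral_mul_const, integral_sub_left_eq_self (fun t => (φ i).normed volume t),
          (φ i).integral_normed, one_mul]
    · have := ContDiffBump.ae_convolution_tendsto_right_of_locallyIntegrable (μ := volume)
        (φ := φ) (l := atTop) (K := 2) hr0 (Eventually.of_forall fun i => by
          change δ * (1 / ((i : ℝ) + 1)) ≤ 2 * (δ * (1 / ((i : ℝ) + 1)) / 2)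
          linarith) hloc
      filter_upwards [ae_restrict_of_ae this] with x hx
      simp only [hgrad]
      simpa using (tendsto_const_nhds (x := gradient u x)).sub hx

/-- The gradient of a Lipschitz function vanishes almost everywhere on its zero set. -/
theorem LipschitzWith.ae_gradient_eq_zero {K : ℝ≥0} (hu : LipschitzWith K u) :
    ∀ᵐ x, u x = 0 → gradient u x = 0 := by
  have habs : LipschitzWith (1 * K) (fun x => |u x|) := by
    simpa [Function.comp_def] using lipschitzWith_one_norm.comp hu
  filter_upwards [hu.ae_differentiableAt (μ := volume), habs.ae_differentiableAt (μ := volume)]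
    with x h1 h2 hx
  -- At a zero of `u` the function `|u|` is minimal, so its derivative vanishes. This says `|u y| =
  -- o(|y - x|)`, hence the derivative of `u` vanishes too.
  have hmin : IsLocalMin (fun y => |u y|) x := Eventually.of_forall fun y => by simp [hx]
  have h3 : HasFDerivAt (fun y => |u y|) (0 : EuclideanSpace ℝ (Fin n) →L[ℝ] ℝ) x := by
    rw [← hmin.fderiv_eq_zero]; exact h2.hasFDerivAt
  have h4 : HasFDerivAt u (0 : EuclideanSpace ℝ (Fin n) →L[ℝ] ℝ) x := by
    rw [hasFDerivAt_iff_isLittleO] at h3 ⊢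
    simpa [hx, Asymptotics.isLittleO_abs_left] using h3
  simp [gradient, h4.fderiv]

/-- Lipschitz functions which vanish outside `Ω` are in `W_0^{1,p}`. -/
theorem LipschitzWith.memW1Zero_of_eq_zero {K : ℝ≥0} (hu : LipschitzWith K u)
    (hΩ : IsOpen Ω) (hb : Bornology.IsBounded Ω) (hp : 1 ≤ p) (hp' : p ≠ ⊤)
    (h0 : ∀ x ∉ Ω, u x = 0) : MemW1Zero Ω p u := by
  have : IsFiniteMeasure (volume.restrict Ω) := isFiniteMeasure_restrict.2 hb.measure_lt_top.ne
  let ε : ℕ → ℝ := fun j => 1 / ((j : ℝ) + 1)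
  have hε : ∀ j, 0 < ε j := fun j => Nat.one_div_pos_of_nat
  have hε0 : Tendsto ε atTop (𝓝 0) := tendsto_one_div_add_atTop_nhds_zero_nat
  -- Removing the values in `[-ε, ε]` leaves a function supported in `{ε ≤ |u|}`, a compact subset
  -- of `Ω`.
  let U : ℕ → EuclideanSpace ℝ (Fin n) → ℝ := fun j x => u x - max (-ε j) (min (u x) (ε j))
  have hUL : ∀ j, LipschitzWith (K + K) (U j) := fun j =>
    hu.sub ((hu.min_const (ε j)).const_max (-ε j))
  have hUsmall : ∀ j x, |u x| ≤ ε j → U j x = 0 := by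
    intro j x hx
    rw [abs_le] at hx
    simp only [U, min_eq_left hx.2, max_eq_right hx.1, sub_self]
  have hUts : ∀ j, tsupport (U j) ⊆ Ω := by
    intro j
    have : tsupport (U j) ⊆ {x | ε j ≤ |u x|} := by
      refine closure_minimal (fun x hx => ?_) (isClosed_le continuous_const hu.continuous.abs)
      by_contra hlt
      exact hx (hUsmall j x (not_le.1 hlt).le)
    intro x hx
    by_contra hxΩ
    have := this hx
    simp only [Set.mem_ofPred_eq, h0 x hxΩ, abs_zero] at this
    exact absurd (hε j) (not_lt.2 this)
  have hUc : ∀ j, HasCompactSupport (U j) := fun j =>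
    hb.isCompact_closure.of_isClosed_subset (isClosed_tsupport _) ((hUts j).trans subset_closure)
  have hU0 : ∀ j, MemW1Zero Ω p (U j) := fun j =>
    (hUL j).memW1Zero_of_hasCompactSupport hΩ hb hp hp' (hUc j) (hUts j)
  have hdiff : ∀ j x, |u x - U j x| ≤ ε j := by
    intro j x
    simp only [U, sub_sub_cancel, abs_le]
    exact ⟨le_max_left _ _, max_le (by linarith [hε j]) (min_le_right _ _)⟩
  refine (MemW1Zero.of_tendsto hΩ hb hp (hu.memLp_restrict hb p) (hu.memLp_gradient hb p) hU0
    ?_ ?_).1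
  · exact eLpNorm_tendsto_zero_of_uniform p
      (Eventually.of_forall fun j => Eventually.of_forall fun x => hdiff j x) hε0
  · have e : ∀ i, (fun x => gradient u x - weakGradient Ω (U i) x) =ᵐ[volume.restrict Ω]
        fun x => gradient u x - gradient (U i) x := fun i => by
      filter_upwards [(hUL i).weakGradient_ae_eq hΩ] with x hx
      rw [hx]
    simp only [fun i => eLpNorm_congr_ae (p := p) (e i)]
    refine eLpNorm_tendsto_zero_of_bounded hp hp' (C := K + (K + K))
      (fun i => ((measurable_gradient _).sub (measurable_gradient _)).aestronglyMeasurable)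
      (fun i => Eventually.of_forall fun x => ?_) ?_
    · exact (_root_.norm_sub_le _ _).trans (add_le_add (hu.norm_gradient_le x)
        (by simpa using (hUL i).norm_gradient_le x))
    · filter_upwards [ae_restrict_of_ae hu.ae_gradient_eq_zero] with x hx
      refine tendsto_const_nhds.congr' ?_
      -- On `{u = 0}` both gradients vanish almost everywhere; elsewhere `U j` eventually differs
      -- from `u` by a constant near `x`.
      rcases eq_or_ne (u x) 0 with h | h
      · filter_upwards with j
        have hev : U j =ᶠ[𝓝 x] fun _ => 0 := by
          have : ∀ᶠ y in 𝓝 x, |u y| < ε j :=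
            hu.continuous.abs.continuousAt.eventually_lt_const (by simpa [h] using hε j)
          exact this.mono fun y hy => hUsmall j y hy.le
        rw [hx h, gradient, hev.fderiv_eq]
        simp
      · filter_upwards [hε0.eventually_lt_const (abs_pos.2 h)] with j hj
        rcases lt_or_gt_of_ne h with hneg | hpos
        · have hev : U j =ᶠ[𝓝 x] fun y => u y + ε j := by
            rw [abs_of_neg hneg] at hj
            filter_upwards [hu.continuous.continuousAt.eventually_lt_const
              (show u x < -ε j by linarith)] with y hy
            simp only [U]
            rw [min_eq_left (by linarith [hε j]), max_eq_left hy.le, sub_neg_eq_add]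
          rw [gradient, gradient, hev.fderiv_eq, fderiv_add_const, sub_self]
        · have hev : U j =ᶠ[𝓝 x] fun y => u y - ε j := by
            rw [abs_of_pos hpos] at hj
            filter_upwards [hu.continuous.continuousAt.eventually_const_lt hj] with y hy
            simp only [U]
            rw [min_eq_right hy.le, max_eq_right (by linarith [hε j])]
          rw [gradient, gradient, hev.fderiv_eq, fderiv_sub_const, sub_self]

end

/-! ### Morrey's inequality -/

section

variable {n : ℕ} {Ω : Set (EuclideanSpace ℝ (Fin n))}

theorem measureReal_unit_ball_pos (n : ℕ) :
    0 < volume.real (Metric.ball (0 : EuclideanSpace ℝ (Fin n)) 1) :=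
  ENNReal.toReal_pos (Metric.measure_ball_pos _ _ one_pos).ne' measure_ball_lt_top.ne

/-- The homothety with centre `x` and ratio `t` pushes Lebesgue measure forward to `t⁻ⁿ` times
itself. The resulting factor `t^(-n/p)` is where Morrey's inequality needs `p` large. -/
theorem eLpNorm_comp_homothety {F : Type*} [NormedAddCommGroup F]
    {f : EuclideanSpace ℝ (Fin n) → F} (hf : Continuous f) (x : EuclideanSpace ℝ (Fin n))
    {t : ℝ} (ht : 0 < t) {p : ℝ≥0∞} (hp : p ≠ ⊤) :
    eLpNorm (fun z => f (x + t • (z - x))) p volume =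
      ENNReal.ofReal ((t ^ n)⁻¹) ^ (1 / p).toReal * eLpNorm f p volume := by
  have hT : Measure.map (fun z : EuclideanSpace ℝ (Fin n) => x + t • (z - x)) volume =
      ENNReal.ofReal ((t ^ n)⁻¹) • volume := by
    have e : (fun z : EuclideanSpace ℝ (Fin n) => x + t • (z - x)) =
        (fun z => x + z) ∘ (fun z => t • z) ∘ (fun z => z - x) := rfl
    rw [e, ← Measure.map_map (by fun_prop) (by fun_prop),
      ← Measure.map_map (by fun_prop) (by fun_prop)]
    have h1 : Measure.map (fun z : EuclideanSpace ℝ (Fin n) => z - x) volume = volume := by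
      simpa [sub_eq_add_neg] using map_add_right_eq_self volume (-x)
    rw [h1, Measure.map_addHaar_smul _ ht.ne', Measure.map_smul, map_add_left_eq_self,
      abs_of_nonneg (by positivity), finrank_euclideanSpace_fin]
  have h2 : eLpNorm (f ∘ fun z => x + t • (z - x)) p volume =
      eLpNorm f p (Measure.map (fun z => x + t • (z - x)) volume) :=
    (eLpNorm_map_measure hf.aestronglyMeasurable (by fun_prop)).symm
  change eLpNorm (f ∘ fun z => x + t • (z - x)) p volume = _
  rw [h2, hT, eLpNorm_smul_measure_of_ne_top hp, smul_eq_mul, one_div, ENNReal.toReal_inv]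

/-- On `(0, 1]` the weight `t^(-1/2)` dominates `t^(-n/p)` for every `p ≥ 2 n`, so this one integral
keeps Morrey's constant bounded in `p`. -/
theorem lintegral_rpow_neg_half :
    ∫⁻ t in Set.Ioc (0 : ℝ) 1, ENNReal.ofReal (t ^ (-(1 / 2) : ℝ)) = 2 := by
  rw [← ofReal_integral_eq_lintegral_ofReal]
  · rw [← intervalIntegral.integral_of_le zero_le_one, integral_rpow (Or.inl (by norm_num))]
    norm_num
  · rw [← IntegrableOn, ← intervalIntegrable_iff_integrableOn_Ioc_of_le zero_le_one]
    exact intervalIntegral.intervalIntegrable_rpow' (by norm_num)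
  · exact (ae_restrict_mem measurableSet_Ioc).mono fun t ht => Real.rpow_nonneg ht.1.le _

theorem enorm_sub_le_lintegral_gradient {ψ : EuclideanSpace ℝ (Fin n) → ℝ} (hψ : ContDiff ℝ 1 ψ)
    (x z : EuclideanSpace ℝ (Fin n)) {R : ℝ} (hR : dist z x ≤ R) :
    ‖ψ z - ψ x‖ₑ ≤ ENNReal.ofReal R *
      ∫⁻ t in Set.Ioc (0 : ℝ) 1, ‖gradient ψ (x + t • (z - x))‖ₑ := by
  have hderiv : ∀ t : ℝ, HasDerivAt (fun t : ℝ => ψ (x + t • (z - x)))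
      (fderiv ℝ ψ (x + t • (z - x)) (z - x)) t := by
    intro t
    have h1 : HasDerivAt (fun t : ℝ => x + t • (z - x)) (z - x) t := by
      simpa using ((hasDerivAt_id t).smul_const (z - x)).const_add x
    exact ((hψ.contDiffAt.differentiableAt (by simp)).hasFDerivAt).comp_hasDerivAt t h1
  have hcont : Continuous fun t : ℝ => fderiv ℝ ψ (x + t • (z - x)) (z - x) :=
    ((hψ.continuous_fderiv (by simp)).comp (by fun_prop)).clm_apply continuous_const
  have hftc := intervalIntegral.integral_eq_sub_of_hasDerivAt (a := 0) (b := 1)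
    (fun t _ => hderiv t) (hcont.intervalIntegrable _ _)
  simp only [one_smul, add_sub_cancel, zero_smul, add_zero] at hftc
  rw [← hftc, intervalIntegral.integral_of_le zero_le_one]
  refine (enorm_integral_le_lintegral_enorm _).trans ?_
  rw [← lintegral_const_mul' _ _ ENNReal.ofReal_ne_top]
  refine lintegral_mono fun t => ?_
  rw [← ofReal_norm, ← ofReal_norm, ← ENNReal.ofReal_mul (dist_nonneg.trans hR),
    norm_gradient_eq, mul_comm]
  refine ENNReal.ofReal_le_ofReal ((ContinuousLinearMap.le_opNorm _ _).trans ?_)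
  rw [← dist_eq_norm]
  exact mul_le_mul_of_nonneg_left hR (norm_nonneg _)

/-- Integrate the fundamental theorem of calculus along segments from `x` over `z ∈ B`, exchange the
integrals, and use Hölder on `B` for each `t`. The norm on the right is over the whole space because
the contracted copies of `B` need not stay in `B`; `x` itself may lie outside `B`. -/
theorem lintegral_enorm_sub_le {ψ : EuclideanSpace ℝ (Fin n) → ℝ} (hψ : ContDiff ℝ 1 ψ)
    {p : ℝ} (hp : 2 * n ≤ p) (hp1 : 1 ≤ p) (x : EuclideanSpace ℝ (Fin n))
    {B : Set (EuclideanSpace ℝ (Fin n))} (hB : MeasurableSet B) {R : ℝ}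
    (hR : ∀ z ∈ B, dist z x ≤ R) :
    ∫⁻ z in B, ‖ψ z - ψ x‖ₑ ≤ ENNReal.ofReal R * (2 *
      (eLpNorm (gradient ψ) (ENNReal.ofReal p) volume * volume B ^ (1 - 1 / p))) := by
  have hpos : 0 < p := by linarith
  have hgc : Continuous (gradient ψ) := hψ.continuous_gradient (by simp)
  calc ∫⁻ z in B, ‖ψ z - ψ x‖ₑ
      ≤ ∫⁻ z in B, ENNReal.ofReal R *
        ∫⁻ t in Set.Ioc (0 : ℝ) 1, ‖gradient ψ (x + t • (z - x))‖ₑ :=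
        setLIntegral_mono' hB fun z hz => enorm_sub_le_lintegral_gradient hψ x z (hR z hz)
    _ = ENNReal.ofReal R * ∫⁻ t in Set.Ioc (0 : ℝ) 1,
          ∫⁻ z in B, ‖gradient ψ (x + t • (z - x))‖ₑ := by
        rw [lintegral_const_mul' _ _ ENNReal.ofReal_ne_top, lintegral_lintegral_swap]
        have : Continuous (Function.uncurry fun (z : EuclideanSpace ℝ (Fin n)) (t : ℝ) =>
            ‖gradient ψ (x + t • (z - x))‖ₑ) :=
          (hgc.comp (by fun_prop : Continuous fun q : EuclideanSpace ℝ (Fin n) × ℝ =>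
            x + q.2 • (q.1 - x))).enorm
        exact this.measurable.aemeasurable
    _ ≤ ENNReal.ofReal R * ∫⁻ t in Set.Ioc (0 : ℝ) 1, ENNReal.ofReal (t ^ (-(1 / 2) : ℝ)) *
          (eLpNorm (gradient ψ) (ENNReal.ofReal p) volume * volume B ^ (1 - 1 / p)) := by
        refine mul_le_mul_right (setLIntegral_mono' measurableSet_Ioc fun t ht => ?_) _
        have h1 := eLpNorm_le_eLpNorm_mul_rpow_measure_univ (p := 1) (q := ENNReal.ofReal p)
          (μ := volume.restrict B) (f := fun z => gradient ψ (x + t • (z - x)))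
          (by simpa using hp1) (hgc.comp (by fun_prop)).aestronglyMeasurable
        rw [eLpNorm_one_eq_lintegral_enorm] at h1
        refine h1.trans ?_
        simp only [Measure.restrict_apply_univ, ENNReal.toReal_one, ENNReal.toReal_ofReal hpos.le,
          div_one]
        rw [← mul_assoc]
        refine mul_le_mul_left ((eLpNorm_mono_measure _ Measure.restrict_le_self).trans ?_) _
        rw [eLpNorm_comp_homothety hgc x ht.1 ENNReal.ofReal_ne_top]
        refine mul_le_mul_left ?_ _
        rw [ENNReal.ofReal_rpow_of_pos (by have := ht.1; positivity)]
        refine ENNReal.ofReal_le_ofReal ?_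
        rw [one_div, ENNReal.toReal_inv, ENNReal.toReal_ofReal hpos.le,
          ← Real.rpow_natCast, ← Real.rpow_neg ht.1.le, ← Real.rpow_mul ht.1.le]
        refine Real.rpow_le_rpow_of_exponent_ge ht.1 ht.2 ?_
        rw [neg_mul, neg_le_neg_iff, ← div_eq_mul_inv, div_le_div_iff₀ hpos two_pos]
        linarith
    _ = _ := by
        rw [lintegral_mul_const _ (by fun_prop), lintegral_rpow_neg_half]

/-- Morrey's inequality for exponents `p ≥ 2 n`, with a constant that stays bounded as `p → ∞`. -/
theorem morrey_inequality (hn : 1 ≤ n) {ψ : EuclideanSpace ℝ (Fin n) → ℝ} (hψ : ContDiff ℝ 1 ψ)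
    {p : ℝ} (hp : 2 * n ≤ p) {N : ℝ} (hN : 0 ≤ N)
    (hψN : eLpNorm (gradient ψ) (ENNReal.ofReal p) volume ≤ ENNReal.ofReal N)
    (x y : EuclideanSpace ℝ (Fin n)) :
    |ψ x - ψ y| ≤ 6 * (volume.real (Metric.ball (0 : EuclideanSpace ℝ (Fin n)) 1)) ^ (-(1 / p)) *
      dist x y ^ (1 - n / p) * N := by
  have hn' : (1 : ℝ) ≤ n := by exact_mod_cast hn
  have hp1 : 1 ≤ p := by linarith
  have hpos : 0 < p := by linarith
  have hne : Nonempty (Fin n) := ⟨⟨0, hn⟩⟩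
  have hnt : Nontrivial (EuclideanSpace ℝ (Fin n)) := inferInstance
  rcases eq_or_ne x y with rfl | hxy
  · simp only [sub_self, abs_zero]
    positivity
  set r := dist x y with hr
  have hr0 : 0 < r := dist_pos.2 hxy
  set κ := volume.real (Metric.ball (0 : EuclideanSpace ℝ (Fin n)) 1) with hκ
  have hκ0 : 0 < κ := measureReal_unit_ball_pos n
  set B := Metric.ball x r with hB
  have hμB : volume B = ENNReal.ofReal (r ^ n * κ) := by
    rw [hB, Measure.addHaar_ball _ _ hr0.le, finrank_euclideanSpace_fin,
      ENNReal.ofReal_mul (by positivity), hκ, ofReal_measureReal]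
  set m := r ^ n * κ with hm
  have hm0 : 0 < m := by positivity
  -- Both values are compared with the values on `B`, whose points are within `r` of `x` and `2 r`
  -- of `y`; the constant 6 is `2 * (1 + 2)`.
  have hx := lintegral_enorm_sub_le hψ hp hp1 x (B := B) measurableSet_ball (R := r)
    fun z hz => (Metric.mem_ball.1 hz).le
  have hy := lintegral_enorm_sub_le hψ hp hp1 y (B := B) measurableSet_ball (R := 2 * r)
    fun z hz => by
      have := dist_triangle z x y
      have := Metric.mem_ball.1 hz
      linarith
  have hsum : ‖ψ x - ψ y‖ₑ * volume B ≤
      (∫⁻ z in B, ‖ψ z - ψ x‖ₑ) + ∫⁻ z in B, ‖ψ z - ψ y‖ₑ := by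
    rw [← lintegral_add_left (by
      have := hψ.continuous
      exact (by fun_prop : Continuous fun z => ‖ψ z - ψ x‖ₑ).measurable), ← setLIntegral_const]
    refine lintegral_mono fun z => ?_
    rw [← enorm_neg (ψ z - ψ x)]
    refine le_trans (le_of_eq ?_) (enorm_add_le _ _)
    congr 1; ring
  have hN' : eLpNorm (gradient ψ) (ENNReal.ofReal p) volume * volume B ^ (1 - 1 / p) ≤
      ENNReal.ofReal (N * m ^ (1 - 1 / p)) := by
    rw [ENNReal.ofReal_mul hN, ← ENNReal.ofReal_rpow_of_pos hm0, hμB]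
    exact mul_le_mul_left hψN _
  have htot : ‖ψ x - ψ y‖ₑ * volume B ≤ ENNReal.ofReal (6 * r * (N * m ^ (1 - 1 / p))) := by
    refine hsum.trans ((add_le_add (hx.trans (mul_le_mul_right (mul_le_mul_right hN' _) _))
      (hy.trans (mul_le_mul_right (mul_le_mul_right hN' _) _))).trans (le_of_eq ?_))
    have h2 : (2 : ℝ≥0∞) = ENNReal.ofReal 2 := by simp
    rw [h2, ← ENNReal.ofReal_mul (by norm_num), ← ENNReal.ofReal_mul (by positivity),
      ← ENNReal.ofReal_mul (by positivity), ← ENNReal.ofReal_add (by positivity) (by positivity)]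
    congr 1; ring
  rw [hμB, ← ofReal_norm, ← ENNReal.ofReal_mul (norm_nonneg _), ENNReal.ofReal_le_ofReal_iff
    (by positivity), Real.norm_eq_abs] at htot
  -- Splitting off a factor `m` lets it cancel against the measure of `B` on the left of `htot`.
  have hmpow : m ^ (1 - 1 / p) = m * (r ^ (-(n / p)) * κ ^ (-(1 / p))) := by
    rw [Real.rpow_sub hm0, Real.rpow_one, div_eq_mul_inv, ← Real.rpow_neg hm0.le]
    congr 1
    rw [hm, Real.mul_rpow (by positivity) hκ0.le, ← Real.rpow_natCast, ← Real.rpow_mul hr0.le]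
    congr 2; ring
  have hrpow : r ^ (1 - n / p) = r * r ^ (-(n / p)) := by
    rw [sub_eq_add_neg, Real.rpow_add hr0, Real.rpow_one]
  rw [hmpow] at htot
  rw [hrpow]
  refine le_of_mul_le_mul_right (htot.trans (le_of_eq ?_)) hm0
  ring

theorem IsTestFunction.eLpNorm_gradient_restrict {ψ : EuclideanSpace ℝ (Fin n) → ℝ}
    (hψ : IsTestFunction Ω ψ) (p : ℝ≥0∞) :
    eLpNorm (gradient ψ) p (volume.restrict Ω) = eLpNorm (gradient ψ) p volume :=
  eLpNorm_restrict_eq_of_support_subset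
    ((support_gradient_subset ψ).trans hψ.tsupport_subset)

/-- Functions in `W_0^{1,p}`, `p ≥ 2 n`, have a Hölder continuous representative, which is a uniform
limit of test functions. -/
theorem MemW1Zero.exists_continuous_representative (hn : 1 ≤ n) (hb : Bornology.IsBounded Ω)
    {p : ℝ} (hp : 2 * n ≤ p) {w : EuclideanSpace ℝ (Fin n) → ℝ}
    (hw : MemW1Zero Ω (ENNReal.ofReal p) w) :
    ∃ (W : EuclideanSpace ℝ (Fin n) → ℝ) (ψ : ℕ → EuclideanSpace ℝ (Fin n) → ℝ),
      Continuous W ∧ W =ᵐ[volume.restrict Ω] w ∧ (∀ x ∉ Ω, W x = 0) ∧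
      (∀ N : ℝ, 0 ≤ N →
        eLpNorm (weakGradient Ω w) (ENNReal.ofReal p) (volume.restrict Ω) ≤ ENNReal.ofReal N →
        ∀ x y, |W x - W y| ≤
          6 * (volume.real (Metric.ball (0 : EuclideanSpace ℝ (Fin n)) 1)) ^ (-(1 / p)) *
            dist x y ^ (1 - n / p) * N) ∧
      (∀ j, IsTestFunction Ω (ψ j)) ∧
      (∃ ε : ℕ → ℝ, Tendsto ε atTop (𝓝 0) ∧ ∀ j x, |ψ j x - W x| ≤ ε j) ∧
      Tendsto (fun j => eLpNorm (fun x => weakGradient Ω w x - gradient (ψ j) x)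
        (ENNReal.ofReal p) (volume.restrict Ω)) atTop (𝓝 0) := by
  have hn' : (1 : ℝ) ≤ n := by exact_mod_cast hn
  have hp1 : 1 ≤ p := by linarith
  have hpos : 0 < p := by linarith
  have hp1' : 1 ≤ ENNReal.ofReal p := by simpa using hp1
  have hfin : IsFiniteMeasure (volume.restrict Ω) := isFiniteMeasure_restrict.2 hb.measure_lt_top.ne
  have hne : Nonempty (Fin n) := ⟨⟨0, hn⟩⟩
  obtain ⟨ψ, hψ, h1, h2⟩ := hw.exists_approx
  set κ := volume.real (Metric.ball (0 : EuclideanSpace ℝ (Fin n)) 1) with hκ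
  have hκ0 : 0 < κ := measureReal_unit_ball_pos n
  have hgrad_mem : ∀ j, MemLp (gradient (ψ j)) (ENNReal.ofReal p) (volume.restrict Ω) := fun j => by
    obtain ⟨K, hK⟩ := (hψ j).exists_lipschitzWith
    exact hK.memLp_gradient hb _
  set a : ℕ → ℝ := fun j => (eLpNorm (fun x => weakGradient Ω w x - gradient (ψ j) x)
    (ENNReal.ofReal p) (volume.restrict Ω)).toReal with ha
  have ha_nonneg : ∀ j, 0 ≤ a j := fun j => ENNReal.toReal_nonneg
  have ha_eq : ∀ j, eLpNorm (fun x => weakGradient Ω w x - gradient (ψ j) x)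
      (ENNReal.ofReal p) (volume.restrict Ω) = ENNReal.ofReal (a j) := fun j =>
    (ENNReal.ofReal_toReal (hw.memW1.memLp_weakGradient.sub (hgrad_mem j)).eLpNorm_ne_top).symm
  have ha0 : Tendsto a atTop (𝓝 0) := by
    simpa [Function.comp_def, ha] using (ENNReal.tendsto_toReal ENNReal.zero_ne_top).comp h2
  -- All test functions vanish at `y₀`, so Morrey's inequality between `x` and `y₀` bounds their
  -- values by their gradients. Applied to differences, it makes the approximating sequence
  -- uniformly Cauchy.
  obtain ⟨y₀, hy₀⟩ : ∃ y, y ∉ Ω := by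
    by_contra hall
    push Not at hall
    have : Ω = Set.univ := Set.eq_univ_of_forall hall
    exact NormedSpace.unbounded_univ ℝ (EuclideanSpace ℝ (Fin n)) (this ▸ hb)
  obtain ⟨D, hD0, hD⟩ : ∃ D : ℝ, 0 ≤ D ∧ ∀ x ∈ Ω, dist x y₀ ≤ D := by
    obtain ⟨D, hD⟩ := hb.subset_closedBall y₀
    exact ⟨max D 0, le_max_right _ _, fun x hx => (Metric.mem_closedBall.1 (hD hx)).trans
      (le_max_left _ _)⟩
  set c : ℝ := 6 * κ ^ (-(1 / p)) * D ^ (1 - n / p) with hc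
  have hc0 : 0 ≤ c := by positivity
  have hexp : 0 ≤ 1 - n / p := by
    rw [sub_nonneg, div_le_one hpos]; linarith
  have hdist : ∀ i j x, |ψ i x - ψ j x| ≤ c * (a i + a j) := by
    intro i j x
    by_cases hx : x ∈ Ω
    · have hsub : IsTestFunction Ω (fun x => ψ i x + -ψ j x) := (hψ i).add (hψ j).neg
      have hg : ∀ x, gradient (fun x => ψ i x + -ψ j x) x = gradient (ψ i) x - gradient (ψ j) x := by
        intro x
        rw [gradient_fun_add ((hψ i).differentiableAt x) ((hψ j).neg.differentiableAt x),
          gradient_fun_neg, sub_eq_add_neg]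
      have := morrey_inequality hn (hsub.contDiff.of_le (by simp)) hp
        (add_nonneg (ha_nonneg i) (ha_nonneg j)) ?_ x y₀
      · simp only [(hψ i).eq_zero_of_notMem hy₀, (hψ j).eq_zero_of_notMem hy₀, neg_zero, add_zero,
          sub_zero, ← sub_eq_add_neg] at this
        refine this.trans (mul_le_mul_of_nonneg_right ?_ (add_nonneg (ha_nonneg i) (ha_nonneg j)))
        exact mul_le_mul_of_nonneg_left (Real.rpow_le_rpow dist_nonneg (hD x hx) hexp)
          (by positivity)
      · rw [← hsub.eLpNorm_gradient_restrict, ENNReal.ofReal_add (ha_nonneg i) (ha_nonneg j),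
          ← ha_eq, ← ha_eq]
        have e : gradient (fun x => ψ i x + -ψ j x) =
            (fun x => weakGradient Ω w x - gradient (ψ j) x) -
              fun x => weakGradient Ω w x - gradient (ψ i) x := by
          ext1 x; rw [hg]; simp
        rw [e, add_comm]
        exact eLpNorm_sub_le (hw.memW1.memLp_weakGradient.sub (hgrad_mem j)).aestronglyMeasurable
          (hw.memW1.memLp_weakGradient.sub (hgrad_mem i)).aestronglyMeasurable hp1'
    · rw [(hψ i).eq_zero_of_notMem hx, (hψ j).eq_zero_of_notMem hx]
      simp only [sub_self, abs_zero]
      exact mul_nonneg hc0 (add_nonneg (ha_nonneg i) (ha_nonneg j))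
  have hcauchy : ∀ x, CauchySeq fun j => ψ j x := by
    intro x
    refine Metric.cauchySeq_iff.2 fun ε hε => ?_
    have : Tendsto (fun j => c * (2 * a j)) atTop (𝓝 0) := by
      simpa using (ha0.const_mul 2).const_mul c
    obtain ⟨M, hM⟩ := eventually_atTop.1 (this.eventually_lt_const hε)
    refine ⟨M, fun i hi j hj => ?_⟩
    rw [Real.dist_eq]
    linarith [hdist i j x, hM i hi, hM j hj]
  choose W hW using fun x => cauchySeq_tendsto_of_complete (hcauchy x)
  have hWψ : ∀ j x, |ψ j x - W x| ≤ c * a j := by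
    intro j x
    have h3 : Tendsto (fun i => |ψ j x - ψ i x|) atTop (𝓝 |ψ j x - W x|) :=
      ((hW x).const_sub (ψ j x)).abs
    have h4 : Tendsto (fun i => c * (a j + a i)) atTop (𝓝 (c * (a j + 0))) :=
      (ha0.const_add (a j)).const_mul c
    rw [add_zero] at h4
    exact le_of_tendsto_of_tendsto' h3 h4 fun i => hdist j i x
  have hca : Tendsto (fun j => c * a j) atTop (𝓝 0) := by simpa using ha0.const_mul c
  have hunif : TendstoUniformly ψ W atTop := by
    refine Metric.tendstoUniformly_iff.2 fun ε hε => ?_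
    filter_upwards [hca.eventually_lt_const hε] with j hj x
    rw [dist_comm, Real.dist_eq]
    exact (hWψ j x).trans_lt hj
  have hWc : Continuous W :=
    hunif.continuous (Frequently.of_forall fun j => (hψ j).contDiff.continuous)
  refine ⟨W, ψ, hWc, ?_, ?_, ?_, hψ, ⟨_, hca, hWψ⟩, h2⟩
  · have h3 : Tendsto (fun j => eLpNorm (fun x => W x - ψ j x) (ENNReal.ofReal p)
        (volume.restrict Ω)) atTop (𝓝 0) :=
      eLpNorm_tendsto_zero_of_uniform _ (Eventually.of_forall fun j => Eventually.of_forall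
        fun x => by rw [norm_sub_rev]; exact hWψ j x) hca
    have h4 : eLpNorm (W - w) (ENNReal.ofReal p) (volume.restrict Ω) ≤ 0 := by
      have h5 := h3.add h1
      rw [add_zero] at h5
      refine ge_of_tendsto' h5 fun j => ?_
      have e : W - w = (fun x => W x - ψ j x) - fun x => w x - ψ j x := by
        ext x; simp
      rw [e]
      exact eLpNorm_sub_le
        (hWc.sub (hψ j).contDiff.continuous).aestronglyMeasurable
        (hw.memW1.memLp.aestronglyMeasurable.sub
          (hψ j).contDiff.continuous.aestronglyMeasurable) hp1'
    have h5 := (eLpNorm_eq_zero_iff (hWc.aestronglyMeasurable.sub hw.memW1.memLp.aestronglyMeasurable)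
      (by simpa using hpos)).1 (le_antisymm h4 zero_le)
    filter_upwards [h5] with x hx
    exact sub_eq_zero.1 hx
  · intro x hx
    refine tendsto_nhds_unique (hW x) ?_
    simp only [fun j => (hψ j).eq_zero_of_notMem hx]
    exact tendsto_const_nhds
  · intro N hN hwN x y
    have h3 : Tendsto (fun j => |ψ j x - ψ j y|) atTop (𝓝 |W x - W y|) := ((hW x).sub (hW y)).abs
    have h4 : Tendsto (fun j => 6 * κ ^ (-(1 / p)) * dist x y ^ (1 - n / p) * (N + a j)) atTop
        (𝓝 (6 * κ ^ (-(1 / p)) * dist x y ^ (1 - n / p) * (N + 0))) :=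
      (ha0.const_add N).const_mul _
    rw [add_zero] at h4
    refine le_of_tendsto_of_tendsto' h3 h4 fun j => ?_
    refine morrey_inequality hn ((hψ j).contDiff.of_le (by simp)) hp
      (add_nonneg hN (ha_nonneg j)) ?_ x y
    rw [← (hψ j).eLpNorm_gradient_restrict, ENNReal.ofReal_add hN (ha_nonneg j), ← ha_eq]
    have e : gradient (ψ j) = weakGradient Ω w -
        fun x => weakGradient Ω w x - gradient (ψ j) x := by
      ext1 x; simp
    calc eLpNorm (gradient (ψ j)) (ENNReal.ofReal p) (volume.restrict Ω)
        = eLpNorm (weakGradient Ω w - fun x => weakGradient Ω w x - gradient (ψ j) x)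
          (ENNReal.ofReal p) (volume.restrict Ω) := by rw [← e]
      _ ≤ _ := eLpNorm_sub_le hw.memW1.memLp_weakGradient.aestronglyMeasurable
          (hw.memW1.memLp_weakGradient.sub (hgrad_mem j)).aestronglyMeasurable hp1'
      _ ≤ _ := add_le_add hwN le_rfl

end

/-! ### The field `|∇φ|^{p-2} ∇φ` and its divergence -/

/-- The tangent inequality at `a` for the convex function `‖·‖ ^ p`, from Cauchy-Schwarz and Young.
The weight is a power of `‖a‖ ^ 2` in order to match `gradSq`. -/
theorem norm_rpow_sub_le_inner {F : Type*} [NormedAddCommGroup F] [InnerProductSpace ℝ F]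
    {p : ℝ} (hp : 2 < p) (a b : F) :
    ‖a‖ ^ p - ‖b‖ ^ p ≤ p * ((‖a‖ ^ 2) ^ ((p - 2) / 2) * inner ℝ a (a - b)) := by
  have hp0 : 0 < p := by linarith
  have hconj : (p / (p - 1)).HolderConjugate p :=
    (Real.HolderConjugate.conjExponent (by linarith)).symm
  have e1 : (‖a‖ ^ 2) ^ ((p - 2) / 2) = ‖a‖ ^ (p - 2) := by
    rw [← Real.rpow_natCast, ← Real.rpow_mul (norm_nonneg a)]
    congr 1; push_cast; ring
  rw [e1]
  have h1 : ‖a‖ ^ (p - 2) * (‖a‖ * ‖b‖) = ‖a‖ ^ (p - 1) * ‖b‖ := by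
    rw [← mul_assoc]
    congr 1
    rw [← Real.rpow_add_one' (norm_nonneg a) (by linarith)]
    congr 1; ring
  have h2 : ‖a‖ ^ (p - 2) * (‖a‖ * ‖a‖) = ‖a‖ ^ p := by
    rw [← pow_two, ← Real.rpow_natCast, ← Real.rpow_add' (norm_nonneg a) (by push_cast; linarith)]
    congr 1; push_cast; ring
  have h3 := Real.young_inequality_of_nonneg (Real.rpow_nonneg (norm_nonneg a) (p - 1))
    (norm_nonneg b) hconj
  rw [← Real.rpow_mul (norm_nonneg a), mul_div_cancel₀ _ (by linarith : p - 1 ≠ 0)] at h3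
  have h4 : ‖a‖ ^ (p - 2) * inner ℝ a b ≤ ‖a‖ ^ (p - 2) * (‖a‖ * ‖b‖) :=
    mul_le_mul_of_nonneg_left (real_inner_le_norm a b) (Real.rpow_nonneg (norm_nonneg a) _)
  rw [inner_sub_right, real_inner_self_eq_norm_mul_norm, mul_sub, h2]
  rw [h1] at h4
  have h5 : p * (‖a‖ ^ p / (p / (p - 1)) + ‖b‖ ^ p / p) = (p - 1) * ‖a‖ ^ p + ‖b‖ ^ p := by
    have : p - 1 ≠ 0 := by linarith
    field_simp
  have h6 := mul_le_mul_of_nonneg_left (h4.trans h3) hp0.le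
  rw [h5] at h6
  linarith

/-- The vector on the left is the convex combination `(1 - b) c + b a`. With `a = ∇φ`, `c = ∇u` and
`b • (a - c)` the gradient of the perturbation, this is the pointwise form of the energy comparison.
-/
theorem norm_add_smul_rpow_le {F : Type*} [NormedAddCommGroup F] [InnerProductSpace ℝ F]
    {p : ℝ} (hp : 2 < p) (a c : F) {b : ℝ} (hb0 : 0 ≤ b) (hb1 : b ≤ 1) :
    ‖c + b • (a - c)‖ ^ p ≤
      ‖c‖ ^ p + p * ((‖a‖ ^ 2) ^ ((p - 2) / 2) * inner ℝ a (b • (a - c))) := by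
  have h1 : ‖c + b • (a - c)‖ ≤ (1 - b) * ‖c‖ + b * ‖a‖ := by
    have e : c + b • (a - c) = (1 - b) • c + b • a := by
      rw [smul_sub, sub_smul, one_smul]; abel
    rw [e]
    refine (norm_add_le _ _).trans ?_
    rw [norm_smul, norm_smul, Real.norm_of_nonneg hb0, Real.norm_of_nonneg (sub_nonneg.2 hb1)]
  have h2 := (convexOn_rpow (by linarith : 1 ≤ p)).2 (norm_nonneg c) (norm_nonneg a)
    (sub_nonneg.2 hb1) hb0 (by ring)
  simp only [smul_eq_mul] at h2
  have h3 := Real.rpow_le_rpow (norm_nonneg _) h1 (by linarith : 0 ≤ p)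
  have h4 := mul_le_mul_of_nonneg_left (norm_rpow_sub_le_inner hp a c) hb0
  rw [inner_smul_right]
  linarith

section

variable {n : ℕ} {φ : EuclideanSpace ℝ (Fin n) → ℝ}

theorem gradient_apply (φ : EuclideanSpace ℝ (Fin n) → ℝ) (x : EuclideanSpace ℝ (Fin n))
    (i : Fin n) : gradient φ x i = fderiv ℝ φ x (EuclideanSpace.single i 1) := by
  rw [← inner_gradient_left, EuclideanSpace.inner_single_right]
  simp

theorem sum_gradient_smul_single (φ : EuclideanSpace ℝ (Fin n) → ℝ)
    (x : EuclideanSpace ℝ (Fin n)) :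
    ∑ i, fderiv ℝ φ x (EuclideanSpace.single i 1) • EuclideanSpace.single i (1 : ℝ) =
      gradient φ x := by
  ext j
  simp [gradient_apply, Pi.single_apply]

/-- `|∇φ|²` -/
noncomputable def gradSq (φ : EuclideanSpace ℝ (Fin n) → ℝ) (x : EuclideanSpace ℝ (Fin n)) : ℝ :=
  ∑ i, fderiv ℝ φ x (EuclideanSpace.single i 1) ^ 2

theorem gradSq_eq (φ : EuclideanSpace ℝ (Fin n) → ℝ) (x : EuclideanSpace ℝ (Fin n)) :
    gradSq φ x = ‖gradient φ x‖ ^ 2 := by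
  rw [EuclideanSpace.real_norm_sq_eq, gradSq]
  simp only [gradient_apply]

/-- The components of `|∇φ|^{p-2} ∇φ`. -/
noncomputable def pFlux (p : ℝ) (φ : EuclideanSpace ℝ (Fin n) → ℝ) (i : Fin n)
    (x : EuclideanSpace ℝ (Fin n)) : ℝ :=
  gradSq φ x ^ ((p - 2) / 2) * fderiv ℝ φ x (EuclideanSpace.single i 1)

/-- The `p`-Laplacian `div(|∇φ|^{p-2} ∇φ)`. -/
noncomputable def pLaplacian (p : ℝ) (φ : EuclideanSpace ℝ (Fin n) → ℝ)
    (x : EuclideanSpace ℝ (Fin n)) : ℝ :=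
  ∑ i, fderiv ℝ (pFlux p φ i) x (EuclideanSpace.single i 1)

theorem contDiff_fderiv_apply_of_two (hφ : ContDiff ℝ 2 φ) (v : EuclideanSpace ℝ (Fin n)) :
    ContDiff ℝ 1 fun x => fderiv ℝ φ x v :=
  (hφ.fderiv_right (m := 1) (by norm_num)).clm_apply contDiff_const

theorem contDiff_gradSq (hφ : ContDiff ℝ 2 φ) : ContDiff ℝ 1 (gradSq φ) :=
  ContDiff.sum fun _ _ => (contDiff_fderiv_apply_of_two hφ _).pow 2

/-- For `p ≥ 4` the exponent `(p - 2) / 2` is at least 1, so the power is `C¹` even where `∇φ`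
vanishes. -/
theorem contDiff_pFlux {p : ℝ} (hp : 4 ≤ p) (hφ : ContDiff ℝ 2 φ) (i : Fin n) :
    ContDiff ℝ 1 (pFlux p φ i) :=
  ((Real.contDiff_rpow_const_of_le (n := 1) (by push_cast; linarith)).comp
    (contDiff_gradSq hφ)).mul (contDiff_fderiv_apply_of_two hφ _)

theorem hasCompactSupport_pFlux (p : ℝ) (hφ : HasCompactSupport φ) (i : Fin n) :
    HasCompactSupport (pFlux p φ i) :=
  (hφ.fderiv_apply ℝ (EuclideanSpace.single i 1)).mul_left

theorem continuous_pLaplacian {p : ℝ} (hp : 4 ≤ p) (hφ : ContDiff ℝ 2 φ) :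
    Continuous (pLaplacian p φ) :=
  continuous_finsetSum _ fun i _ =>
    ((contDiff_pFlux hp hφ i).continuous_fderiv (by simp)).clm_apply continuous_const

/-- The product rule with `|∇φ|^(p-4)` factored out: as `p → ∞` the bracket is governed by `(p - 2)
Δ_∞ φ`. -/
theorem pLaplacian_eq {p : ℝ} (hφ : ContDiff ℝ 2 φ) (x : EuclideanSpace ℝ (Fin n))
    (hx : gradient φ x ≠ 0) :
    pLaplacian p φ x = gradSq φ x ^ ((p - 2) / 2 - 1) *
      ((p - 2) * fderiv ℝ (fderiv ℝ φ) x (gradient φ x) (gradient φ x) + gradSq φ x *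
        ∑ i, fderiv ℝ (fderiv ℝ φ) x (EuclideanSpace.single i 1) (EuclideanSpace.single i 1)) := by
  have hs0 : 0 < gradSq φ x := by rw [gradSq_eq]; positivity
  set D := fderiv ℝ (fderiv ℝ φ) x with hD
  have hD' : HasFDerivAt (fderiv ℝ φ) D x :=
    ((hφ.fderiv_right (m := 1) (by norm_num)).contDiffAt.differentiableAt (by simp)).hasFDerivAt
  have h1 : ∀ v, HasFDerivAt (fun y => fderiv ℝ φ y v) (D.flip v) x := fun v => by
    simpa using hD'.clm_apply (hasFDerivAt_const v x)
  have hs : HasFDerivAt (gradSq φ) (∑ i, (2 * fderiv ℝ φ x (EuclideanSpace.single i 1)) •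
      D.flip (EuclideanSpace.single i 1)) x := by
    refine HasFDerivAt.fun_sum fun i _ => ?_
    simpa using (h1 (EuclideanSpace.single i 1)).pow 2
  have hsv : ∀ v, (∑ i, (2 * fderiv ℝ φ x (EuclideanSpace.single i 1)) •
      D.flip (EuclideanSpace.single i 1)) v = 2 * D v (gradient φ x) := by
    intro v
    rw [← sum_gradient_smul_single φ x, map_sum, Finset.mul_sum]
    simp [mul_assoc]
  have hV : ∀ i, HasFDerivAt (pFlux p φ i) _ x := fun i =>
    (hs.rpow_const (p := (p - 2) / 2) (Or.inl hs0.ne')).mul (h1 (EuclideanSpace.single i 1))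
  have hsum : ∑ i, fderiv ℝ φ x (EuclideanSpace.single i 1) *
      D (EuclideanSpace.single i 1) (gradient φ x) = D (gradient φ x) (gradient φ x) := by
    have := congrArg (D.flip (gradient φ x)) (sum_gradient_smul_single φ x)
    rw [map_sum] at this
    simpa using this
  have hpow : gradSq φ x ^ ((p - 2) / 2) = gradSq φ x ^ ((p - 2) / 2 - 1) * gradSq φ x := by
    rw [← Real.rpow_add_one hs0.ne']; congr 1; ring
  rw [pLaplacian, mul_add, ← hsum, Finset.mul_sum, Finset.mul_sum, Finset.mul_sum, Finset.mul_sum,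
    ← Finset.sum_add_distrib]
  refine Finset.sum_congr rfl fun i _ => ?_
  rw [(hV i).fderiv]
  simp only [add_apply, smul_apply, smul_eq_mul, hsv,
    ContinuousLinearMap.flip_apply]
  rw [hpow]
  ring

/-- Integration by parts for `|∇φ|^{p-2} ∇φ` against a Lipschitz function. -/
theorem integral_pFlux_inner_gradient {p : ℝ} (hp : 4 ≤ p) (hφ : ContDiff ℝ 2 φ)
    (hφc : HasCompactSupport φ) {θ : EuclideanSpace ℝ (Fin n) → ℝ} {K : ℝ≥0}
    (hθ : LipschitzWith K θ) :
    ∫ x, gradSq φ x ^ ((p - 2) / 2) * inner ℝ (gradient φ x) (gradient θ x) =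
      -∫ x, pLaplacian p φ x * θ x := by
  have hlip : ∀ i, ∃ C, LipschitzWith C (pFlux p φ i) := fun i =>
    ContDiff.lipschitzWith_of_hasCompactSupport (hasCompactSupport_pFlux p hφc i)
      (contDiff_pFlux hp hφ i) (by simp)
  have hVc := fun i => hasCompactSupport_pFlux p hφc i
  -- Written in coordinates, each summand is a line derivative of `θ` against a compactly supported
  -- Lipschitz function, which can be integrated by parts.
  have e1 : (fun x => gradSq φ x ^ ((p - 2) / 2) * inner ℝ (gradient φ x) (gradient θ x)) =ᵐ[volume]
      fun x => ∑ i, lineDeriv ℝ θ x (EuclideanSpace.single i 1) * pFlux p φ i x := by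
    filter_upwards [hθ.ae_differentiableAt (μ := volume)] with x hx
    simp only [PiLp.inner_apply, Finset.mul_sum]
    refine Finset.sum_congr rfl fun i _ => ?_
    rw [hx.lineDeriv_eq_fderiv, gradient_apply, gradient_apply, pFlux]
    simp only [RCLike.inner_apply, conj_trivial]
    ring
  have hd : ∀ i x, DifferentiableAt ℝ (pFlux p φ i) x := fun i x =>
    (contDiff_pFlux hp hφ i).contDiffAt.differentiableAt (by simp)
  rw [integral_congr_ae e1, integral_finsetSum]
  · have e2 : (fun x => pLaplacian p φ x * θ x) = fun x =>
        ∑ i, fderiv ℝ (pFlux p φ i) x (EuclideanSpace.single i 1) * θ x := by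
      ext x; rw [pLaplacian, Finset.sum_mul]
    rw [e2, integral_finsetSum, ← Finset.sum_neg_distrib]
    · refine Finset.sum_congr rfl fun i _ => ?_
      obtain ⟨C, hC⟩ := hlip i
      rw [hθ.integral_lineDeriv_mul_eq hC (hVc i), ← integral_neg]
      refine integral_congr_ae (Eventually.of_forall fun x => ?_)
      simp only [(hd i x).lineDeriv_eq_fderiv, map_neg]
      ring
    · intro i _
      refine Continuous.integrable_of_hasCompactSupport ?_ ?_
      · exact (((contDiff_pFlux hp hφ i).continuous_fderiv (by simp)).clm_apply
          continuous_const).mul hθ.continuous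
      · exact ((hVc i).fderiv_apply ℝ _).mul_right
  · intro i _
    obtain ⟨C, hC⟩ := hlip i
    exact ((contDiff_pFlux hp hφ i).continuous.integrable_of_hasCompactSupport
      (hVc i)).mul_of_top_right (hθ.memLp_lineDeriv _)

end

/-! ### Comparison with strict subsolutions of the `p`-Laplace equation -/

/-- The primitive of the ramp `t ↦ max 0 (min t 1)`, a `C¹` substitute of the positive part. -/
noncomputable def smoothPosPart (t : ℝ) : ℝ := ∫ s in (0 : ℝ)..t, max 0 (min s 1)

theorem hasDerivAt_smoothPosPart (t : ℝ) :
    HasDerivAt smoothPosPart (max 0 (min t 1)) t :=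
  intervalIntegral.integral_hasDerivAt_right
    ((by fun_prop : Continuous fun s : ℝ => max 0 (min s 1)).intervalIntegrable _ _)
    ((by fun_prop : Continuous fun s : ℝ => max 0 (min s 1)).stronglyMeasurableAtFilter _ _)
    (by fun_prop)

theorem lipschitzWith_smoothPosPart : LipschitzWith 1 smoothPosPart := by
  refine lipschitzWith_of_nnnorm_deriv_le
    (fun t => (hasDerivAt_smoothPosPart t).differentiableAt) fun t => ?_
  rw [(hasDerivAt_smoothPosPart t).deriv, ← NNReal.coe_le_coe]
  simp only [coe_nnnorm, NNReal.coe_one]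
  rw [Real.norm_of_nonneg (le_max_left _ _)]
  exact max_le zero_le_one (min_le_right _ _)

theorem monotone_smoothPosPart : Monotone smoothPosPart :=
  monotone_of_deriv_nonneg (fun t => (hasDerivAt_smoothPosPart t).differentiableAt) fun t => by
    rw [(hasDerivAt_smoothPosPart t).deriv]; exact le_max_left _ _

theorem smoothPosPart_of_nonpos {t : ℝ} (ht : t ≤ 0) : smoothPosPart t = 0 := by
  rw [smoothPosPart, intervalIntegral.integral_congr (g := fun _ => 0)]
  · simp
  · intro s hs
    rw [Set.uIcc_of_ge ht] at hs
    exact max_eq_left ((min_le_left _ _).trans hs.2)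

theorem smoothPosPart_pos {t : ℝ} (ht : 0 < t) : 0 < smoothPosPart t := by
  refine intervalIntegral.intervalIntegral_pos_of_pos_on
    ((by fun_prop : Continuous fun s : ℝ => max 0 (min s 1)).intervalIntegrable _ _)
    (fun s hs => ?_) ht
  exact lt_max_of_lt_right (lt_min hs.1 one_pos)

theorem smoothPosPart_nonneg (t : ℝ) : 0 ≤ smoothPosPart t := by
  rcases le_or_gt t 0 with h | h
  · exact (smoothPosPart_of_nonpos h).ge
  · exact (smoothPosPart_pos h).le

theorem smoothPosPart_le {t M : ℝ} (hM : 0 ≤ M) (h : t ≤ M) : smoothPosPart t ≤ M := by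
  refine (monotone_smoothPosPart h).trans ?_
  have := lipschitzWith_smoothPosPart.dist_le_mul M 0
  rw [smoothPosPart_of_nonpos le_rfl] at this
  simp only [dist_zero_right, NNReal.coe_one, one_mul, Real.norm_of_nonneg hM] at this
  exact (le_abs_self _).trans this

section

variable {n : ℕ} {Ω : Set (EuclideanSpace ℝ (Fin n))}

/-- `a j` are Lipschitz functions converging to `u` uniformly on `Ω`, and with gradients converging
to the weak gradient of `u` in `L^p(Ω)`. -/
structure LipschitzApprox (Ω : Set (EuclideanSpace ℝ (Fin n))) (p : ℝ≥0∞)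
    (u : EuclideanSpace ℝ (Fin n) → ℝ) (a : ℕ → EuclideanSpace ℝ (Fin n) → ℝ) (ε : ℕ → ℝ) :
    Prop where
  lipschitz : ∀ j, ∃ K, LipschitzWith K (a j)
  tendsto_zero : Tendsto ε atTop (𝓝 0)
  abs_sub_le : ∀ j, ∀ x ∈ Ω, |a j x - u x| ≤ ε j
  tendsto_gradient : Tendsto (fun j => eLpNorm (fun x => weakGradient Ω u x - gradient (a j) x) p
    (volume.restrict Ω)) atTop (𝓝 0)

theorem LipschitzApprox.shift {p : ℝ≥0∞} {u : EuclideanSpace ℝ (Fin n) → ℝ}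
    {a : ℕ → EuclideanSpace ℝ (Fin n) → ℝ} {ε : ℕ → ℝ} (h : LipschitzApprox Ω p u a ε) (J : ℕ) :
    LipschitzApprox Ω p u (fun j => a (j + J)) (fun j => ε (j + J)) where
  lipschitz _ := h.lipschitz _
  tendsto_zero := h.tendsto_zero.comp (tendsto_add_atTop_nat J)
  abs_sub_le _ := h.abs_sub_le _
  tendsto_gradient := h.tendsto_gradient.comp (tendsto_add_atTop_nat J)

theorem LipschitzApprox.neg (hΩ : IsOpen Ω) {p : ℝ≥0∞} {u : EuclideanSpace ℝ (Fin n) → ℝ}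
    {a : ℕ → EuclideanSpace ℝ (Fin n) → ℝ} {ε : ℕ → ℝ} (h : LipschitzApprox Ω p u a ε)
    (hu : MemW1 Ω p u) : LipschitzApprox Ω p (fun x => -u x) (fun j x => -a j x) ε where
  lipschitz j := (h.lipschitz j).imp fun _ hK => hK.neg
  tendsto_zero := h.tendsto_zero
  abs_sub_le j x hx := by
    rw [← abs_neg]; convert h.abs_sub_le j x hx using 2; ring
  tendsto_gradient := by
    refine h.tendsto_gradient.congr fun j => ?_
    rw [← eLpNorm_neg]
    refine eLpNorm_congr_ae ?_
    filter_upwards [hu.weakGradient_neg_ae_eq hΩ] with x hx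
    rw [hx, gradient_fun_neg]
    simp only [Pi.neg_apply]; abel

theorem dirichletEnergy_eq_ofReal {p : ℝ} (hp : 0 < p) {u : EuclideanSpace ℝ (Fin n) → ℝ}
    {G : EuclideanSpace ℝ (Fin n) → EuclideanSpace ℝ (Fin n)}
    (hG : weakGradient Ω u =ᵐ[volume.restrict Ω] G)
    (hGp : MemLp G (ENNReal.ofReal p) (volume.restrict Ω)) :
    IntegrableOn (fun x => ‖G x‖ ^ p) Ω ∧
      dirichletEnergy Ω p u = ENNReal.ofReal (∫ x in Ω, ‖G x‖ ^ p) := by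
  have hint : Integrable (fun x => ‖G x‖ ^ p) (volume.restrict Ω) := by
    simpa [ENNReal.toReal_ofReal hp.le] using
      hGp.integrable_norm_rpow (by simpa using hp) ENNReal.ofReal_ne_top
  refine ⟨hint, ?_⟩
  rw [ofReal_integral_eq_lintegral_ofReal hint
    (Eventually.of_forall fun x => Real.rpow_nonneg (norm_nonneg _) _), dirichletEnergy]
  refine lintegral_congr_ae ?_
  filter_upwards [hG] with x hx
  rw [hx, ← ENNReal.ofReal_rpow_of_nonneg (norm_nonneg _) hp.le, ofReal_norm]

theorem exists_bound_pFlux {p : ℝ} (hp : 4 ≤ p) {φ : EuclideanSpace ℝ (Fin n) → ℝ}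
    (hφ : ContDiff ℝ 2 φ) (hφc : HasCompactSupport φ) :
    Continuous (fun x => gradSq φ x ^ ((p - 2) / 2) • gradient φ x) ∧
      ∃ M : ℝ, ∀ x v, ‖gradSq φ x ^ ((p - 2) / 2) * inner ℝ (gradient φ x) v‖ ≤ M * ‖v‖ := by
  have hVc : Continuous fun x => gradSq φ x ^ ((p - 2) / 2) • gradient φ x :=
    ((contDiff_gradSq hφ).continuous.rpow_const fun x => Or.inr (by linarith)).smul
      (hφ.continuous_gradient (by simp))
  have hgc : HasCompactSupport (gradient φ) :=
    hφc.of_isClosed_subset (isClosed_tsupport _) (tsupport_gradient_subset φ)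
  have hVcs : HasCompactSupport fun x => gradSq φ x ^ ((p - 2) / 2) • gradient φ x :=
    hgc.smul_left (f := fun x => gradSq φ x ^ ((p - 2) / 2))
  obtain ⟨M, hM⟩ := hVcs.exists_bound_of_continuous hVc
  refine ⟨hVc, M, fun x v => ?_⟩
  have := (norm_inner_le_norm (𝕜 := ℝ) (gradSq φ x ^ ((p - 2) / 2) • gradient φ x) v).trans
    (mul_le_mul_of_nonneg_right (hM x) (norm_nonneg _))
  rwa [real_inner_smul_left] at this

theorem integrableOn_pFlux {p : ℝ} (hp : 4 ≤ p) {φ : EuclideanSpace ℝ (Fin n) → ℝ}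
    (hφ : ContDiff ℝ 2 φ) (hφc : HasCompactSupport φ)
    {F : EuclideanSpace ℝ (Fin n) → EuclideanSpace ℝ (Fin n)} (hF : IntegrableOn F Ω) :
    IntegrableOn (fun x => gradSq φ x ^ ((p - 2) / 2) * inner ℝ (gradient φ x) (F x)) Ω := by
  obtain ⟨hc, M, hM⟩ := exists_bound_pFlux hp hφ hφc
  refine (Integrable.const_mul hF.norm M).mono' ?_ (Eventually.of_forall fun x => hM x _)
  have := AEStronglyMeasurable.inner (𝕜 := ℝ) (μ := volume.restrict Ω) hc.aestronglyMeasurable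
    hF.aestronglyMeasurable
  simpa only [real_inner_smul_left] using this

/-- The field `|∇φ|^(p-2) ∇φ` is bounded, so `L^1` convergence of the gradients suffices. This
carries the integration by parts from Lipschitz functions to the Sobolev perturbation. -/
theorem tendsto_setIntegral_pFlux {p : ℝ} (hp : 4 ≤ p) {q : ℝ≥0∞} (hq : 1 ≤ q)
    [IsFiniteMeasure (volume.restrict Ω)]
    {φ : EuclideanSpace ℝ (Fin n) → ℝ} (hφ : ContDiff ℝ 2 φ) (hφc : HasCompactSupport φ)
    {F : EuclideanSpace ℝ (Fin n) → EuclideanSpace ℝ (Fin n)} (hF : MemLp F q (volume.restrict Ω))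
    {H : ℕ → EuclideanSpace ℝ (Fin n) → EuclideanSpace ℝ (Fin n)}
    (hH : ∀ j, MemLp (H j) q (volume.restrict Ω))
    (hlim : Tendsto (fun j => eLpNorm (fun x => F x - H j x) q (volume.restrict Ω)) atTop (𝓝 0)) :
    Tendsto (fun j => ∫ x in Ω, gradSq φ x ^ ((p - 2) / 2) * inner ℝ (gradient φ x) (H j x)) atTop
      (𝓝 (∫ x in Ω, gradSq φ x ^ ((p - 2) / 2) * inner ℝ (gradient φ x) (F x))) := by
  obtain ⟨-, M, hM⟩ := exists_bound_pFlux hp hφ hφc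
  refine tendsto_integral_of_L1' _
    (integrableOn_pFlux hp hφ hφc (hF.integrable hq)).aestronglyMeasurable
    (Eventually.of_forall fun j => integrableOn_pFlux hp hφ hφc ((hH j).integrable hq)) ?_
  have h1 := eLpNorm_one_tendsto_zero hq (fun j => (hF.sub (hH j)).aestronglyMeasurable) hlim
  refine tendsto_of_tendsto_of_tendsto_of_le_of_le tendsto_const_nhds
    (?_ : Tendsto (fun j => ENNReal.ofReal M * eLpNorm (fun x => F x - H j x) 1
      (volume.restrict Ω)) _ _) (fun _ => zero_le) fun j =>
      eLpNorm_le_mul_eLpNorm_of_ae_le_mul (Eventually.of_forall fun x => ?_) 1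
  · have h2 := ENNReal.Tendsto.const_mul h1 (a := ENNReal.ofReal M) (Or.inr ENNReal.ofReal_ne_top)
    rw [mul_zero] at h2
    exact h2
  · simp only [Pi.sub_apply]
    rw [← mul_sub, ← inner_sub_right, norm_sub_rev (F x)]
    exact hM x _

/-- If a strict `p`-subsolution, translated vertically, crosses `u` from below inside a ball, then
the energy of `u` can be decreased by a nonnegative perturbation in this ball. -/
theorem exists_dirichletEnergy_lt (hΩ : IsOpen Ω) (hb : Bornology.IsBounded Ω) {p : ℝ} (hp : 4 ≤ p)
    {u : EuclideanSpace ℝ (Fin n) → ℝ} {a : ℕ → EuclideanSpace ℝ (Fin n) → ℝ} {ε : ℕ → ℝ}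
    (hu : MemW1 Ω (ENNReal.ofReal p) u) (huc : ContinuousOn u Ω)
    (ha : LipschitzApprox Ω (ENNReal.ofReal p) u a ε)
    {φ : EuclideanSpace ℝ (Fin n) → ℝ} (hφ : ContDiff ℝ 2 φ) (hφc : HasCompactSupport φ)
    {x₀ : EuclideanSpace ℝ (Fin n)} {r' r : ℝ} (hr' : 0 < r') (hr : r' < r)
    (hball : Metric.closedBall x₀ r ⊆ Ω) {m δ : ℝ} (hδ : 0 < δ)
    (hann : ∀ x ∈ Metric.closedBall x₀ r, r' ≤ dist x x₀ → φ x + m + δ ≤ u x)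
    (h0 : u x₀ < φ x₀ + m) (hlap : ∀ x ∈ Metric.closedBall x₀ r, 0 < pLaplacian p φ x) :
    ∃ θ : EuclideanSpace ℝ (Fin n) → ℝ, (∀ x, 0 ≤ θ x) ∧ (∀ x ∉ Metric.ball x₀ r, θ x = 0) ∧
      MemW1Zero Ω (ENNReal.ofReal p) θ ∧
      dirichletEnergy Ω p (fun x => u x + θ x) < dirichletEnergy Ω p u := by
  -- The bound `δ / 2` keeps `a j` strictly above `φ + m` on the annulus; the bound 1 is absorbed by
  -- the `T + 1` in the cutoff.
  wlog hε : ∀ j, ε j ≤ min (δ / 2) 1 generalizing a ε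
  · obtain ⟨J, hJ⟩ := eventually_atTop.1
      (ha.tendsto_zero.eventually_le_const (lt_min (half_pos hδ) one_pos))
    exact this (ha.shift J) fun j => hJ _ (Nat.le_add_left _ _)
  have hp0 : 0 < p := by linarith
  have hp1 : 1 ≤ ENNReal.ofReal p := by simpa using (by linarith : (1 : ℝ) ≤ p)
  have hfin : IsFiniteMeasure (volume.restrict Ω) := isFiniteMeasure_restrict.2 hb.measure_lt_top.ne
  obtain ⟨Kφ, hKφ⟩ := ContDiff.lipschitzWith_of_hasCompactSupport hφc hφ (by simp)
  have hφd : ∀ x, DifferentiableAt ℝ φ x := fun x => hφ.contDiffAt.differentiableAt (by simp)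
  obtain ⟨T, hT⟩ := (isCompact_closedBall x₀ r).exists_bound_of_continuousOn
    (f := fun x => φ x + m - u x)
    ((hφ.continuous.add continuous_const).continuousOn.sub (huc.mono hball))
  have hx₀ : x₀ ∈ Metric.closedBall x₀ r := Metric.mem_closedBall_self (by linarith)
  have hT0 : 0 ≤ T := (norm_nonneg _).trans (hT x₀ hx₀)
  -- This slope makes the cone `C * (r - dist x x₀)` at least `T + 1` on the ball of radius `r'`.
  -- There the minimum in `cut g` is `φ + m - g` whenever `|g - u| ≤ 1`; outside the ball of radius
  -- `r` the cone forces the value 0.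
  set C : ℝ := (T + 1) / (r - r') with hC
  have hrr : 0 < r - r' := by linarith
  have hC0 : 0 ≤ C := by positivity
  set cut : (EuclideanSpace ℝ (Fin n) → ℝ) → EuclideanSpace ℝ (Fin n) → ℝ :=
    fun g x => min (φ x + m - g x) (C * (r - dist x x₀)) with hcut
  set Θ : (EuclideanSpace ℝ (Fin n) → ℝ) → EuclideanSpace ℝ (Fin n) → ℝ :=
    fun g x => smoothPosPart (cut g x) with hΘ
  set θ := Θ u with hθ
  have hΘ_off : ∀ g, ∀ x ∉ Metric.ball x₀ r, Θ g x = 0 := by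
    intro g x hx
    refine smoothPosPart_of_nonpos ((min_le_right _ _).trans ?_)
    rw [Metric.mem_ball, not_lt] at hx
    exact mul_nonpos_of_nonneg_of_nonpos hC0 (by linarith)
  have hΘ_le : ∀ g x, Θ g x ≤ C * r := fun g x =>
    smoothPosPart_le (mul_nonneg hC0 (by linarith)) ((min_le_right _ _).trans
      (mul_le_mul_of_nonneg_left (by linarith [dist_nonneg (x := x) (y := x₀)]) hC0))
  have hnear : ∀ j, ∀ x ∈ Ω, |a j x - u x| ≤ δ / 2 ∧ |a j x - u x| ≤ 1 := fun j x hx =>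
    ⟨(ha.abs_sub_le j x hx).trans ((hε j).trans (min_le_left _ _)),
      (ha.abs_sub_le j x hx).trans ((hε j).trans (min_le_right _ _))⟩
  have hcut_in : ∀ g, (∀ x ∈ Ω, |g x - u x| ≤ 1) → ∀ x ∈ Metric.ball x₀ r',
      cut g x = φ x + m - g x := by
    intro g hg x hx
    have hxr : x ∈ Metric.closedBall x₀ r := Metric.closedBall_subset_closedBall hr.le
      (Metric.ball_subset_closedBall hx)
    refine min_eq_left ?_
    have h1 := (abs_le.1 (hg x (hball hxr))).1
    have h2 := (abs_le.1 (hT x hxr)).2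
    have h3 : T + 1 ≤ C * (r - dist x x₀) := by
      calc T + 1 = C * (r - r') := by rw [hC]; field_simp
        _ ≤ _ := mul_le_mul_of_nonneg_left (by linarith [Metric.mem_ball.1 hx]) hC0
    linarith
  have hΘ_sub : ∀ j x, |Θ (a j) x - θ x| ≤ ε j := by
    intro j x
    by_cases hx : x ∈ Metric.ball x₀ r
    · have hxΩ := hball (Metric.ball_subset_closedBall hx)
      have h1 := lipschitzWith_smoothPosPart.dist_le_mul (cut (a j) x) (cut u x)
      rw [NNReal.coe_one, one_mul, Real.dist_eq, Real.dist_eq] at h1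
      refine h1.trans ((abs_min_sub_min_le_max _ _ _ _).trans ?_)
      rw [sub_self, abs_zero, max_eq_left (abs_nonneg _), sub_sub_sub_cancel_left, abs_sub_comm]
      exact ha.abs_sub_le j x hxΩ
    · rw [hθ, hΘ_off _ x hx, hΘ_off _ x hx, sub_self, abs_zero]
      exact (abs_nonneg _).trans (ha.abs_sub_le j x₀ (hball hx₀))
  choose K hK using ha.lipschitz
  have hdistL : LipschitzWith 1 fun x : EuclideanSpace ℝ (Fin n) => dist x x₀ :=
    LipschitzWith.dist_left x₀
  have hΘL : ∀ j, ∃ L, LipschitzWith L (Θ (a j)) := fun j =>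
    ⟨_, lipschitzWith_smoothPosPart.comp (((hKφ.add (LipschitzWith.const m)).sub (hK j)).min
      ((lipschitzWith_smul C).comp ((LipschitzWith.const r).sub hdistL)))⟩
  choose L hL using hΘL
  have hΘW : ∀ j, MemW1Zero Ω (ENNReal.ofReal p) (Θ (a j)) := fun j =>
    (hL j).memW1Zero_of_eq_zero hΩ hb hp1 ENNReal.ofReal_ne_top fun x hx =>
      hΘ_off _ x fun h => hx (hball (Metric.ball_subset_closedBall h))
  -- The chain rule factor of `Θ g`: the derivative of `smoothPosPart` at `φ + m - g`. Being a
  -- continuous ramp, it converges uniformly along `a j`, which the indicator from the ordinary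
  -- positive part would not do.
  set b : (EuclideanSpace ℝ (Fin n) → ℝ) → EuclideanSpace ℝ (Fin n) → ℝ := fun g =>
    (Metric.ball x₀ r').indicator fun x => max 0 (min (φ x + m - g x) 1) with hbdef
  have hb0 : ∀ g x, 0 ≤ b g x := fun g x => Set.indicator_nonneg (fun _ _ => le_max_left _ _) x
  have hb1 : ∀ g x, b g x ≤ 1 := fun g x =>
    Set.indicator_le' (fun _ _ => max_le zero_le_one (min_le_right _ _)) (fun _ _ => zero_le_one) x
  have hb_sub : ∀ j, ∀ x ∈ Ω, |b u x - b (a j) x| ≤ ε j := by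
    intro j x hx
    by_cases hxb : x ∈ Metric.ball x₀ r'
    · simp only [hbdef, Set.indicator_of_mem hxb]
      refine (abs_max_sub_max_le_max _ _ _ _).trans ?_
      rw [sub_self, abs_zero, max_eq_right (abs_nonneg _)]
      refine (abs_min_sub_min_le_max _ _ _ _).trans ?_
      rw [sub_self, abs_zero, max_eq_left (abs_nonneg _), sub_sub_sub_cancel_left]
      exact ha.abs_sub_le j x hx
    · simp only [hbdef, Set.indicator_of_notMem hxb, sub_self, abs_zero]
      exact (abs_nonneg _).trans (ha.abs_sub_le j x hx)
  have hgrad : ∀ j x, DifferentiableAt ℝ (a j) x →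
      gradient (Θ (a j)) x = b (a j) x • (gradient φ x - gradient (a j) x) := by
    intro j x hx
    by_cases hxb : x ∈ Metric.ball x₀ r'
    · have hev : Θ (a j) =ᶠ[𝓝 x] fun y => smoothPosPart (φ y + m - a j y) := by
        filter_upwards [Metric.isOpen_ball.mem_nhds hxb] with y hy
        simp only [hΘ, hcut_in (a j) (fun z hz => (hnear j z hz).2) y hy]
      have hd : HasFDerivAt (fun y => φ y + m - a j y) (fderiv ℝ φ x - fderiv ℝ (a j) x) x :=
        ((hφd x).hasFDerivAt.add_const m).sub hx.hasFDerivAt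
      have hcomp : HasFDerivAt (fun y => smoothPosPart (φ y + m - a j y)) _ x :=
        (hasDerivAt_smoothPosPart _).comp_hasFDerivAt x hd
      rw [gradient, hev.fderiv_eq, hcomp.fderiv]
      simp only [hbdef, Set.indicator_of_mem hxb, gradient, map_smulₛₗ, map_sub]
      simp
    -- Outside the inner ball either `φ + m - a j` is negative (on the closed annulus) or the cone
    -- is (beyond radius `r`); both persist near `x`.
    · have hev : Θ (a j) =ᶠ[𝓝 x] fun _ => 0 := by
        rcases le_or_gt (dist x x₀) r with hxr | hxr
        · have h1 := hann x hxr (not_lt.1 hxb)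
          have h2 := (abs_le.1 (hnear j x (hball hxr)).1).1
          have h3 : φ x + m - a j x < 0 := by linarith
          have hc : Continuous fun y => φ y + m - a j y :=
            (hφ.continuous.add continuous_const).sub (hK j).continuous
          filter_upwards [hc.continuousAt.eventually_lt_const h3] with y hy
          exact smoothPosPart_of_nonpos ((min_le_left _ _).trans hy.le)
        · filter_upwards [(continuous_id.dist continuous_const).continuousAt.eventually_const_lt
            (f := fun y => dist y x₀) hxr] with y hy
          exact hΘ_off _ y (by rw [Metric.mem_ball, not_lt]; exact hy.le)
      rw [gradient, hev.fderiv_eq]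
      simp [hbdef, Set.indicator_of_notMem hxb]
  set G : EuclideanSpace ℝ (Fin n) → EuclideanSpace ℝ (Fin n) := fun x =>
    b u x • (gradient φ x - weakGradient Ω u x) with hG
  have hbm : AEStronglyMeasurable (b u) (volume.restrict Ω) := by
    refine AEStronglyMeasurable.indicator ?_ measurableSet_ball
    refine (by fun_prop : Continuous fun t : ℝ => max 0 (min t 1)).comp_aestronglyMeasurable ?_
    exact (hφ.continuous.add continuous_const).aestronglyMeasurable.sub
      hu.memLp.aestronglyMeasurable
  have hφu : MemLp (fun x => gradient φ x - weakGradient Ω u x) (ENNReal.ofReal p)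
      (volume.restrict Ω) := (hKφ.memLp_gradient hb _).sub hu.memLp_weakGradient
  have hGp : MemLp G (ENNReal.ofReal p) (volume.restrict Ω) := by
    refine hφu.of_le (hbm.smul hφu.aestronglyMeasurable) (Eventually.of_forall fun x => ?_)
    rw [hG, norm_smul, Real.norm_of_nonneg (hb0 u x)]
    exact mul_le_of_le_one_left (norm_nonneg _) (hb1 u x)
  have hθc : Continuous θ := by
    refine (Metric.tendstoUniformly_iff.2 fun η hη => ?_ : TendstoUniformly (fun j => Θ (a j)) θ
      atTop).continuous (Frequently.of_forall fun j => (hL j).continuous)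
    filter_upwards [ha.tendsto_zero.eventually_lt_const hη] with j hj x
    rw [dist_comm, Real.dist_eq]
    exact (hΘ_sub j x).trans_lt hj
  have hθ_nonneg : ∀ x, 0 ≤ θ x := fun x => smoothPosPart_nonneg _
  have hθp : MemLp θ (ENNReal.ofReal p) (volume.restrict Ω) := by
    refine MemLp.of_bound hθc.aestronglyMeasurable (C * r) (Eventually.of_forall fun x => ?_)
    rw [Real.norm_of_nonneg (hθ_nonneg x)]
    exact hΘ_le u x
  have hgrad_ae : ∀ j, ∀ᵐ x ∂(volume.restrict Ω),
      gradient (Θ (a j)) x = b (a j) x • (gradient φ x - gradient (a j) x) := fun j => by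
    filter_upwards [ae_restrict_of_ae ((hK j).ae_differentiableAt (μ := volume))] with x hx
    exact hgrad j x hx
  have hGlim : Tendsto (fun j => eLpNorm (fun x => G x - gradient (Θ (a j)) x) (ENNReal.ofReal p)
      (volume.restrict Ω)) atTop (𝓝 0) := by
    have h1 : Tendsto (fun j => eLpNorm (fun x => weakGradient Ω u x - gradient (a j) x)
        (ENNReal.ofReal p) (volume.restrict Ω) + ENNReal.ofReal (ε j) *
        eLpNorm (fun x => gradient φ x - weakGradient Ω u x) (ENNReal.ofReal p)
        (volume.restrict Ω)) atTop (𝓝 0) := by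
      have h2 : Tendsto (fun j => ENNReal.ofReal (ε j)) atTop (𝓝 0) := by
        simpa using ENNReal.tendsto_ofReal ha.tendsto_zero
      simpa using ha.tendsto_gradient.add
        (ENNReal.Tendsto.mul_const h2 (Or.inr hφu.eLpNorm_ne_top))
    refine tendsto_of_tendsto_of_tendsto_of_le_of_le tendsto_const_nhds h1 (fun _ => zero_le)
      fun j => ?_
    have haj : AEStronglyMeasurable (fun x => weakGradient Ω u x - gradient (a j) x)
        (volume.restrict Ω) :=
      hu.memLp_weakGradient.aestronglyMeasurable.sub (measurable_gradient _).aestronglyMeasurable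
    have hbj : AEStronglyMeasurable (b (a j)) (volume.restrict Ω) := by
      refine AEStronglyMeasurable.indicator ?_ measurableSet_ball
      refine (by fun_prop : Continuous fun t : ℝ => max 0 (min t 1)).comp_aestronglyMeasurable ?_
      exact ((hφ.continuous.add continuous_const).sub (hK j).continuous).aestronglyMeasurable
    -- The first term is small because `b ≤ 1` and the gradients of `a j` converge, the second
    -- because `b (a j)` converges to `b u` uniformly.
    have e : (fun x => G x - gradient (Θ (a j)) x) =ᵐ[volume.restrict Ω]
        (fun x => -(b (a j) x • (weakGradient Ω u x - gradient (a j) x))) +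
          fun x => (b u x - b (a j) x) • (gradient φ x - weakGradient Ω u x) := by
      filter_upwards [hgrad_ae j] with x hx
      rw [hx]
      simp only [hG, Pi.add_apply, smul_sub, sub_smul]
      abel
    rw [eLpNorm_congr_ae e]
    refine (eLpNorm_add_le (hbj.smul haj).neg ((hbm.sub hbj).smul hφu.aestronglyMeasurable)
      hp1).trans (add_le_add ?_ ?_)
    · refine eLpNorm_mono fun x => ?_
      change ‖-(b (a j) x • (weakGradient Ω u x - gradient (a j) x))‖ ≤ _
      rw [norm_neg, norm_smul, Real.norm_of_nonneg (hb0 _ x)]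
      exact mul_le_of_le_one_left (norm_nonneg _) (hb1 _ x)
    · refine eLpNorm_le_mul_eLpNorm_of_ae_le_mul ?_ _
      rw [ae_restrict_iff' hΩ.measurableSet]
      refine Eventually.of_forall fun x hx => ?_
      change ‖(b u x - b (a j) x) • (gradient φ x - weakGradient Ω u x)‖ ≤ _
      rw [norm_smul, Real.norm_eq_abs]
      exact mul_le_mul_of_nonneg_right (hb_sub j x hx) (norm_nonneg _)
  obtain ⟨hθW, hθG⟩ : MemW1Zero Ω (ENNReal.ofReal p) θ ∧ HasWeakGradient Ω θ G := by
    refine MemW1Zero.of_tendsto hΩ hb hp1 hθp hGp hΘW ?_ ?_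
    · refine eLpNorm_tendsto_zero_of_uniform _ (Eventually.of_forall fun j =>
        Eventually.of_forall fun x => ?_) ha.tendsto_zero
      rw [norm_sub_rev, Real.norm_eq_abs]
      exact hΘ_sub j x
    · refine hGlim.congr fun j => eLpNorm_congr_ae ?_
      filter_upwards [(hL j).weakGradient_ae_eq hΩ] with x hx
      rw [hx]
  refine ⟨θ, hθ_nonneg, hΘ_off u, hθW, ?_⟩
  have hsub : Function.support θ ⊆ Metric.closedBall x₀ r := fun x hx => by
    by_contra h
    exact hx (hΘ_off u x fun h' => h (Metric.ball_subset_closedBall h'))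
  have hθcs : HasCompactSupport θ :=
    (isCompact_closedBall x₀ r).of_isClosed_subset (isClosed_tsupport _)
      (closure_minimal hsub Metric.isClosed_closedBall)
  -- Only a nonnegative continuous integrand that is positive at `x₀` is needed: the crossing `h0`
  -- gives `θ x₀ > 0`.
  have hpos : 0 < ∫ x, pLaplacian p φ x * θ x := by
    refine Continuous.integral_pos_of_hasCompactSupport_nonneg_nonzero (x := x₀)
      ((continuous_pLaplacian hp hφ).mul hθc) hθcs.mul_left (fun x => ?_) ?_
    · by_cases hx : x ∈ Metric.closedBall x₀ r
      · exact mul_nonneg (hlap x hx).le (hθ_nonneg x)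
      · have : θ x = 0 := hΘ_off u x fun h' => hx (Metric.ball_subset_closedBall h')
        simp [this]
    · refine (mul_pos (hlap x₀ hx₀) (smoothPosPart_pos (lt_min (by linarith) ?_))).ne'
      have : 0 < C := by positivity
      rw [dist_self, sub_zero]
      exact mul_pos this (by linarith)
  have hIlim : Tendsto (fun j => ∫ x, pLaplacian p φ x * Θ (a j) x) atTop
      (𝓝 (∫ x, pLaplacian p φ x * θ x)) := by
    obtain ⟨M, hM⟩ := (isCompact_closedBall x₀ r).exists_bound_of_continuousOn
      (continuous_pLaplacian hp hφ).continuousOn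
    refine tendsto_integral_of_dominated_convergence
      ((Metric.closedBall x₀ r).indicator fun _ => M * (C * r)) (fun j =>
        ((continuous_pLaplacian hp hφ).mul (hL j).continuous).aestronglyMeasurable) ?_
      (fun j => Eventually.of_forall fun x => ?_) (Eventually.of_forall fun x => ?_)
    · exact (integrable_indicator_iff measurableSet_closedBall).2
        (integrableOn_const measure_closedBall_lt_top.ne)
    · by_cases hx : x ∈ Metric.closedBall x₀ r
      · rw [Set.indicator_of_mem hx, norm_mul]
        refine mul_le_mul (hM x hx) ?_ (norm_nonneg _) ((norm_nonneg _).trans (hM x hx))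
        rw [Real.norm_of_nonneg (smoothPosPart_nonneg _)]
        exact hΘ_le _ x
      · rw [Set.indicator_of_notMem hx, hΘ_off _ x fun h' => hx (Metric.ball_subset_closedBall h')]
        simp
    · refine Tendsto.const_mul _ (tendsto_iff_norm_sub_tendsto_zero.2 ?_)
      exact squeeze_zero (fun _ => norm_nonneg _) (fun j => hΘ_sub j x) ha.tendsto_zero
  have hJlim := tendsto_setIntegral_pFlux hp hp1 hφ hφc hGp
    (fun j => (hL j).memLp_gradient hb _) hGlim
  have hJeq : ∀ j, ∫ x in Ω, gradSq φ x ^ ((p - 2) / 2) *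
      inner ℝ (gradient φ x) (gradient (Θ (a j)) x) = -∫ x, pLaplacian p φ x * Θ (a j) x := by
    intro j
    rw [← integral_pFlux_inner_gradient hp hφ hφc (hL j)]
    refine setIntegral_eq_integral_of_forall_compl_eq_zero fun x hx => ?_
    have : gradient (Θ (a j)) x = 0 := by
      by_contra h
      refine hx (hball (closure_minimal (fun y hy => ?_) Metric.isClosed_closedBall
        (support_gradient_subset _ h)))
      by_contra hyb
      exact hy (hΘ_off _ y fun h' => hyb (Metric.ball_subset_closedBall h'))
    rw [this, inner_zero_right, mul_zero]
  -- The first variation, equal to `-∫ Δ_p φ θ` by passage to the limit in the identity for the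
  -- Lipschitz functions `Θ (a j)`.
  have hJ : ∫ x in Ω, gradSq φ x ^ ((p - 2) / 2) * inner ℝ (gradient φ x) (G x) < 0 := by
    simp only [hJeq] at hJlim
    rw [tendsto_nhds_unique hJlim hIlim.neg]
    linarith
  obtain ⟨hiu, heu⟩ := dirichletEnergy_eq_ofReal hp0 EventuallyEq.rfl hu.memLp_weakGradient
  have hint := integrableOn_pFlux hp hφ hφc (hGp.integrable hp1)
  obtain ⟨hiv, hev⟩ := dirichletEnergy_eq_ofReal hp0
    ((hu.hasWeakGradient.add hθG).weakGradient_ae_eq hΩ) (hu.memLp_weakGradient.add hGp)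
  rw [heu, hev]
  have hle : ∫ x in Ω, ‖weakGradient Ω u x + G x‖ ^ p ≤ ∫ x in Ω, (‖weakGradient Ω u x‖ ^ p +
      p * (gradSq φ x ^ ((p - 2) / 2) * inner ℝ (gradient φ x) (G x))) := by
    refine integral_mono hiv (hiu.add (hint.const_mul p)) fun x => ?_
    simp only [gradSq_eq]
    exact norm_add_smul_rpow_le (by linarith) _ _ (hb0 u x) (hb1 u x)
  rw [integral_add hiu (hint.const_mul p), integral_const_mul] at hle
  have hlt : ∫ x in Ω, ‖weakGradient Ω u x + G x‖ ^ p < ∫ x in Ω, ‖weakGradient Ω u x‖ ^ p := by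
    have := mul_neg_of_pos_of_neg hp0 hJ
    linarith
  exact (ENNReal.ofReal_lt_ofReal_iff_of_nonneg
    (integral_nonneg fun x => Real.rpow_nonneg (norm_nonneg _) _)).2 hlt

end

/-! ### Sharp Lipschitz bounds for the limit -/

section

variable {n : ℕ} {Ω : Set (EuclideanSpace ℝ (Fin n))}

/-- Jensen's inequality for the mollification of an `L^p` vector field. -/
theorem norm_setIntegral_normed_smul_le
    (φ : ContDiffBump (0 : EuclideanSpace ℝ (Fin n))) {S : ℝ} (hS : ∀ y, φ.normed volume y ≤ S)
    {p : ℝ} (hp : 1 ≤ p) {G : EuclideanSpace ℝ (Fin n) → EuclideanSpace ℝ (Fin n)}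
    (hGm : AEStronglyMeasurable G (volume.restrict Ω)) {N : ℝ} (hN : 0 ≤ N)
    (hGN : eLpNorm G (ENNReal.ofReal p) (volume.restrict Ω) ≤ ENNReal.ofReal N)
    (z : EuclideanSpace ℝ (Fin n)) :
    ‖∫ y in Ω, φ.normed volume (z - y) • G y‖ ≤ S ^ (1 / p) * N := by
  have hp0 : 0 < p := by linarith
  have hS0 : 0 ≤ S := (φ.nonneg_normed 0).trans (hS 0)
  set η : EuclideanSpace ℝ (Fin n) → ℝ≥0∞ := fun y => ENNReal.ofReal (φ.normed volume (z - y))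
    with hη
  have hηm : Measurable η :=
    (φ.continuous_normed.comp (continuous_const.sub continuous_id)).measurable.ennreal_ofReal
  -- The mollifier as a measure: mass at most 1 gives `L^1 ≤ L^p` without a constant, and density at
  -- most `S` costs only `S ^ (1 / p)`, which tends to 1.
  set ν := (volume.restrict Ω).withDensity η with hν
  have hνS : ν ≤ ENNReal.ofReal S • volume.restrict Ω := by
    rw [← withDensity_const]
    exact withDensity_mono (Eventually.of_forall fun y => ENNReal.ofReal_le_ofReal (hS _))
  have hν1 : ν Set.univ ≤ 1 := by
    rw [hν, withDensity_apply _ MeasurableSet.univ, Measure.restrict_univ]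
    refine (setLIntegral_le_lintegral _ _).trans (le_of_eq ?_)
    rw [← ofReal_integral_eq_lintegral_ofReal (φ.integrable_normed.comp_sub_left z)
      (Eventually.of_forall fun y => φ.nonneg_normed _),
      integral_sub_left_eq_self (fun t => φ.normed volume t), φ.integral_normed, ENNReal.ofReal_one]
  have hac : ν ≪ volume.restrict Ω := withDensity_absolutelyContinuous _ _
  have h1 : ‖∫ y in Ω, φ.normed volume (z - y) • G y‖ₑ ≤ eLpNorm G 1 ν := by
    rw [eLpNorm_one_eq_lintegral_enorm, hν,
      lintegral_withDensity_eq_lintegral_mul₀ hηm.aemeasurable hGm.enorm]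
    refine (enorm_integral_le_lintegral_enorm _).trans (lintegral_mono fun y => ?_)
    simp only [Pi.mul_apply, hη, enorm_smul, Real.enorm_of_nonneg (φ.nonneg_normed (z - y))]
    exact le_rfl
  have h2 : eLpNorm G 1 ν ≤ eLpNorm G (ENNReal.ofReal p) ν := by
    have := eLpNorm_le_eLpNorm_mul_rpow_measure_univ (p := 1) (q := ENNReal.ofReal p)
      (by simpa using hp) (hGm.mono_ac hac)
    refine this.trans ((mul_le_mul_right (ENNReal.rpow_le_one hν1 ?_) _).trans (mul_one _).le)
    rw [ENNReal.toReal_one, ENNReal.toReal_ofReal hp0.le, div_one, sub_nonneg, div_le_one hp0]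
    exact hp
  have h3 : eLpNorm G (ENNReal.ofReal p) ν ≤ ENNReal.ofReal (S ^ (1 / p) * N) := by
    refine (eLpNorm_mono_measure _ hνS).trans ?_
    rw [eLpNorm_smul_measure_of_ne_top ENNReal.ofReal_ne_top, smul_eq_mul,
      ENNReal.ofReal_mul (by positivity), ← ENNReal.ofReal_rpow_of_nonneg hS0 (by positivity)]
    simp only [ENNReal.toReal_ofReal hp0.le, one_div,
      ENNReal.toReal_inv]
    exact mul_le_mul_right hGN _
  have h4 := h1.trans (h2.trans h3)
  rw [← ofReal_norm] at h4
  exact (ENNReal.ofReal_le_ofReal_iff (by positivity)).1 h4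

/-- If `U` is the uniform limit of functions with `‖∇U_k‖_{L^{p_k}} ≤ M V^{1/p_k}` and `p_k → ∞`,
then `U` is `M`-Lipschitz along segments in `Ω`. -/
theorem abs_sub_le_of_segment_subset (hΩ : IsOpen Ω) {M V : ℝ} (hM : 0 ≤ M) (hV : 0 < V)
    {p : ℕ → ℝ} (hp : ∀ k, 1 ≤ p k) (hp_lim : Tendsto p atTop atTop)
    {U : EuclideanSpace ℝ (Fin n) → ℝ} {L : ℝ≥0} (hU : LipschitzWith L U)
    {Uk : ℕ → EuclideanSpace ℝ (Fin n) → ℝ} (hUk : ∀ k, Continuous (Uk k))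
    {η : ℕ → ℝ} (hη : Tendsto η atTop (𝓝 0)) (hUη : ∀ k x, |Uk k x - U x| ≤ η k)
    {G : ℕ → EuclideanSpace ℝ (Fin n) → EuclideanSpace ℝ (Fin n)}
    (hG : ∀ k, HasWeakGradient Ω (Uk k) (G k))
    (hGm : ∀ k, AEStronglyMeasurable (G k) (volume.restrict Ω))
    (hGN : ∀ k, eLpNorm (G k) (ENNReal.ofReal (p k)) (volume.restrict Ω) ≤
      ENNReal.ofReal (M * V ^ (1 / p k)))
    {x y : EuclideanSpace ℝ (Fin n)} (hxy : segment ℝ x y ⊆ Ω) :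
    |U x - U y| ≤ M * dist x y := by
  have hseg : IsCompact (segment ℝ x y) := by
    rw [segment_eq_image_lineMap]
    exact isCompact_Icc.image AffineMap.lineMap_continuous
  obtain ⟨δ, hδ, hδΩ⟩ := hseg.exists_cthickening_subset_open hΩ hxy
  -- The mollification radius `r` is fixed while `k → ∞`, since the kernel bound blows up as `r →
  -- 0`. Only afterwards does `r` tend to 0.
  have key : ∀ r ∈ Set.Ioo 0 δ, |U x - U y| ≤ M * dist x y + 2 * (L * r) := by
    intro r hr
    let φ : ContDiffBump (0 : EuclideanSpace ℝ (Fin n)) :=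
      ⟨r / 2, r, half_pos hr.1, half_lt_self hr.1⟩
    obtain ⟨S, hS⟩ := (φ.hasCompactSupport_normed (μ := volume)).exists_bound_of_continuous
      φ.continuous_normed
    -- The maximum with 1 makes the base visibly positive, so that its powers `1 / p k` tend to 1.
    have hS' : ∀ y, φ.normed volume y ≤ max S 1 := fun y =>
      (le_abs_self _).trans ((hS y).trans (le_max_left _ _))
    have hS0 : 0 < max S 1 := lt_max_of_lt_right one_pos
    let m : ℕ → EuclideanSpace ℝ (Fin n) → ℝ := fun k =>
      convolution (φ.normed volume) (Uk k) (ContinuousLinearMap.lsmul ℝ ℝ) volume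
    have hnear : ∀ k z, |m k z - Uk k z| ≤ 2 * η k + L * r := by
      intro k z
      rw [← Real.dist_eq]
      refine ContDiffBump.dist_normed_convolution_le (hUk k).aestronglyMeasurable fun w hw => ?_
      rw [Real.dist_eq]
      have h1 := abs_le.1 (hUη k w)
      have h2 := abs_le.1 (hUη k z)
      have h3 := hU.dist_le_mul w z
      rw [Real.dist_eq] at h3
      have h4 := abs_le.1 (h3.trans (mul_le_mul_of_nonneg_left (Metric.mem_ball.1 hw).le L.2))
      have h5 : φ.rOut = r := rfl
      rw [h5] at h4
      rw [abs_le]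
      constructor <;> linarith [h4.1, h4.2]
    have hmv : ∀ k, |m k x - m k y| ≤ (max S 1) ^ (1 / p k) * (M * V ^ (1 / p k)) * dist x y := by
      intro k
      have hd : ∀ z ∈ segment ℝ x y, HasGradientAt (m k)
          (∫ w in Ω, φ.normed volume (z - w) • G k w) z := by
        intro z hz
        refine (hG k).hasGradientAt_convolution (hUk k).locallyIntegrable φ fun w hw => hδΩ ?_
        exact Metric.mem_cthickening_of_dist_le _ z _ _ hz
          ((Metric.mem_closedBall.1 hw).trans hr.2.le)
      have := (convex_segment x y).norm_image_sub_le_of_norm_hasFDerivWithin_le (𝕜 := ℝ)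
        (fun z hz => (hasGradientAt_iff_hasFDerivAt.1 (hd z hz)).hasFDerivWithinAt) (fun z _ => by
          rw [LinearIsometryEquiv.norm_map]
          exact norm_setIntegral_normed_smul_le φ hS' (hp k) (hGm k)
            (by positivity) (hGN k) z)
        (right_mem_segment ℝ x y) (left_mem_segment ℝ x y)
      rwa [Real.norm_eq_abs, ← dist_eq_norm] at this
    have hinv : Tendsto (fun k => 1 / p k) atTop (𝓝 0) := by
      simpa [Function.comp_def, one_div] using tendsto_inv_atTop_zero.comp hp_lim
    have hpow : ∀ c : ℝ, 0 < c → Tendsto (fun k => c ^ (1 / p k)) atTop (𝓝 1) := by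
      intro c hc
      have := (Real.continuousAt_const_rpow (b := 0) hc.ne').tendsto.comp hinv
      simpa [Function.comp_def] using this
    have hlim : Tendsto (fun k => (max S 1) ^ (1 / p k) * (M * V ^ (1 / p k)) * dist x y +
        2 * (2 * η k + L * r) + 2 * η k) atTop
        (𝓝 (1 * (M * 1) * dist x y + 2 * (2 * 0 + L * r) + 2 * 0)) :=
      ((((hpow _ hS0).mul ((hpow V hV).const_mul M)).mul_const _).add
        (((hη.const_mul 2).add_const _).const_mul 2)).add (hη.const_mul 2)
    have hfin := ge_of_tendsto' hlim (b := |U x - U y|) fun k => by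
      have h1 := abs_le.1 (hUη k x)
      have h2 := abs_le.1 (hUη k y)
      have h3 := abs_le.1 (hnear k x)
      have h4 := abs_le.1 (hnear k y)
      have h5 := abs_le.1 (hmv k)
      rw [abs_le]
      constructor <;> linarith
    linarith
  have hlim : Tendsto (fun r : ℝ => M * dist x y + 2 * (L * r)) (𝓝[>] 0)
      (𝓝 (M * dist x y + 2 * (L * 0))) :=
    ((by fun_prop : Continuous fun r : ℝ => M * dist x y + 2 * (L * r)).tendsto 0).mono_left
      nhdsWithin_le_nhds
  rw [mul_zero, mul_zero, add_zero] at hlim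
  exact ge_of_tendsto hlim (by filter_upwards [Ioo_mem_nhdsGT hδ] with r hr using key r hr)

/-- A function which is `M`-Lipschitz along segments in `Ω` and on `∂Ω` is `M`-Lipschitz. -/
theorem abs_sub_le_of_segment_of_frontier (hΩ : IsOpen Ω) {M : ℝ}
    {U : EuclideanSpace ℝ (Fin n) → ℝ} (hU : Continuous U)
    (hseg : ∀ x y, segment ℝ x y ⊆ Ω → |U x - U y| ≤ M * dist x y)
    (hfr : ∀ x ∈ frontier Ω, ∀ y ∈ frontier Ω, |U x - U y| ≤ M * dist x y)
    {x y : EuclideanSpace ℝ (Fin n)} (hx : x ∈ Ω) (hy : y ∈ Ω) :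
    |U x - U y| ≤ M * dist x y := by
  -- A segment that lies in `Ω` except possibly for its end `z`: the bound holds on shorter pieces
  -- and passes to the limit.
  have half : ∀ a z : EuclideanSpace ℝ (Fin n),
      (∀ t ∈ Set.Ico (0 : ℝ) 1, AffineMap.lineMap a z t ∈ Ω) →
      z ∈ closure Ω ∧ |U a - U z| ≤ M * dist a z := by
    intro a z h
    have hcont : Tendsto (fun t : ℝ => AffineMap.lineMap (k := ℝ) a z t) (𝓝[<] 1) (𝓝 z) := by
      have : Continuous fun t : ℝ => AffineMap.lineMap (k := ℝ) a z t :=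
        AffineMap.lineMap_continuous
      simpa using (this.tendsto 1).mono_left nhdsWithin_le_nhds
    have hmem : ∀ᶠ t in 𝓝[<] (1 : ℝ), t ∈ Set.Ico (0 : ℝ) 1 := Ico_mem_nhdsLT one_pos
    refine ⟨mem_closure_of_tendsto hcont (hmem.mono h), ?_⟩
    refine le_of_tendsto_of_tendsto (((hU.tendsto z).comp hcont).const_sub (U a)).abs
      ((tendsto_const_nhds.dist hcont).const_mul M) ?_
    filter_upwards [hmem] with t ht
    refine hseg _ _ ?_
    rw [segment_eq_image_lineMap]
    rintro _ ⟨s, hs, rfl⟩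
    have e : AffineMap.lineMap a (AffineMap.lineMap a z t) s = AffineMap.lineMap (k := ℝ) a z (s * t) := by
      simp only [AffineMap.lineMap_apply, vsub_eq_sub, vadd_eq_add, add_sub_cancel_right, smul_smul]
    rw [e]
    refine h _ ⟨mul_nonneg hs.1 ht.1, ?_⟩
    exact (mul_le_of_le_one_left ht.1 hs.2).trans_lt ht.2
  by_cases hsub : segment ℝ x y ⊆ Ω
  · exact hseg x y hsub
  let γ : ℝ → EuclideanSpace ℝ (Fin n) := fun t => AffineMap.lineMap x y t
  have hγ : Continuous γ := AffineMap.lineMap_continuous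
  -- The least and greatest parameters outside `Ω` give two points of `∂Ω`. The end pieces are
  -- covered by `half` and the middle one by the boundary bound, wherever the segment runs in
  -- between; the three lengths add up to `dist x y`.
  set A := Set.Icc (0 : ℝ) 1 ∩ γ ⁻¹' Ωᶜ with hA
  have hAc : IsCompact A := isCompact_Icc.inter_right (hΩ.isClosed_compl.preimage hγ)
  have hAne : A.Nonempty := by
    rw [segment_eq_image_lineMap, Set.not_subset] at hsub
    obtain ⟨_, ⟨t, ht, rfl⟩, h⟩ := hsub
    exact ⟨t, ht, h⟩
  obtain ⟨t₀, ht₀, hmin⟩ := hAc.exists_isLeast hAne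
  obtain ⟨t₁, ht₁, hmax⟩ := hAc.exists_isGreatest hAne
  have h01 : t₀ ≤ t₁ := hmin ht₁
  obtain ⟨hc0, hl0⟩ := half x (γ t₀) fun s hs => by
    have e : AffineMap.lineMap x (γ t₀) s = γ (s * t₀) := by
      simp only [γ, AffineMap.lineMap_apply, vsub_eq_sub, vadd_eq_add, add_sub_cancel_right,
        smul_smul]
    rw [e]
    by_contra h
    have ht0 : t₀ ≠ 0 := by
      rintro rfl
      exact ht₀.2 (by simpa [γ] using hx)
    have ht0' : 0 < t₀ := lt_of_le_of_ne ht₀.1.1 ht0.symm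
    have := hmin (⟨⟨mul_nonneg hs.1 ht₀.1.1,
      (mul_le_of_le_one_left ht₀.1.1 hs.2.le).trans ht₀.1.2⟩, h⟩ : s * t₀ ∈ A)
    nlinarith [hs.2]
  obtain ⟨hc1, hl1⟩ := half y (γ t₁) fun s hs => by
    have e : AffineMap.lineMap y (γ t₁) s = γ (1 - s * (1 - t₁)) := by
      simp only [γ, AffineMap.lineMap_apply, vsub_eq_sub, vadd_eq_add]
      module
    rw [e]
    by_contra h
    have ht1 : t₁ ≠ 1 := by
      rintro rfl
      exact ht₁.2 (by simpa [γ] using hy)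
    have ht1' : t₁ < 1 := lt_of_le_of_ne ht₁.1.2 ht1
    have h5 := mul_le_of_le_one_left (sub_nonneg.2 ht₁.1.2) hs.2.le
    have h6 := mul_nonneg hs.1 (sub_nonneg.2 ht₁.1.2)
    have := hmax (⟨⟨by linarith [ht₁.1.1], by linarith⟩, h⟩ : 1 - s * (1 - t₁) ∈ A)
    nlinarith [hs.2]
  have hf0 : γ t₀ ∈ frontier Ω := by rw [hΩ.frontier_eq]; exact ⟨hc0, ht₀.2⟩
  have hf1 : γ t₁ ∈ frontier Ω := by rw [hΩ.frontier_eq]; exact ⟨hc1, ht₁.2⟩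
  have hmid := hfr _ hf0 _ hf1
  have d0 : dist x (γ t₀) = t₀ * dist x y := by
    simp only [γ, dist_left_lineMap, Real.norm_of_nonneg ht₀.1.1]
  have d1 : dist y (γ t₁) = (1 - t₁) * dist x y := by
    simp only [γ, dist_right_lineMap, Real.norm_of_nonneg (sub_nonneg.2 ht₁.1.2)]
  have d01 : dist (γ t₀) (γ t₁) = (t₁ - t₀) * dist x y := by
    simp only [γ, dist_lineMap_lineMap, Real.dist_eq]
    rw [abs_sub_comm, abs_of_nonneg (sub_nonneg.2 h01)]
  rw [d0, abs_le] at hl0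
  rw [d1, abs_le] at hl1
  rw [d01, abs_le] at hmid
  rw [abs_le]
  constructor <;> nlinarith [hl0.1, hl0.2, hl1.1, hl1.2, hmid.1, hmid.2]

end

/-! ### The viscosity equation in the limit -/

section

variable {n : ℕ} {Ω : Set (EuclideanSpace ℝ (Fin n))}

/-- Viscosity test functions live on `U` only and just their germ matters. Multiplying by a bump
function gives the global, compactly supported version needed for integration by parts. -/
theorem ContDiffOn.exists_contDiff_eventuallyEq {U : Set (EuclideanSpace ℝ (Fin n))}
    (hU : IsOpen U) {φ : EuclideanSpace ℝ (Fin n) → ℝ} {m : ℕ∞} (hφ : ContDiffOn ℝ m φ U)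
    {x₀ : EuclideanSpace ℝ (Fin n)} (hx₀ : x₀ ∈ U) :
    ∃ φ' : EuclideanSpace ℝ (Fin n) → ℝ, ContDiff ℝ m φ' ∧ HasCompactSupport φ' ∧
      φ' =ᶠ[𝓝 x₀] φ := by
  obtain ⟨r, hr, hrU⟩ := Metric.nhds_basis_closedBall.mem_iff.1 (hU.mem_nhds hx₀)
  let χ : ContDiffBump x₀ := ⟨r / 2, r, half_pos hr, half_lt_self hr⟩
  refine ⟨fun x => χ x * φ x, contDiff_iff_contDiffAt.2 fun x => ?_, χ.hasCompactSupport.mul_right,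
    ?_⟩
  · by_cases hx : x ∈ U
    · exact χ.contDiff.contDiffAt.mul (hφ.contDiffAt (hU.mem_nhds hx))
    · have hx' : x ∉ tsupport χ := by
        rw [χ.tsupport_eq]
        exact fun h => hx (hrU h)
      refine (contDiffAt_const (c := (0 : ℝ))).congr_of_eventuallyEq ?_
      filter_upwards [notMem_tsupport_iff_eventuallyEq.1 hx'] with y hy
      simp [hy]
  · filter_upwards [χ.eventuallyEq_one] with x hx
    simp [hx]

/-- Where `D²φ(∇φ, ∇φ) > 0`, the `p`-Laplacian is locally positive for all large `p`. -/
theorem exists_forall_pLaplacian_pos {φ : EuclideanSpace ℝ (Fin n) → ℝ} (hφ : ContDiff ℝ 2 φ)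
    {x₀ : EuclideanSpace ℝ (Fin n)}
    (h : 0 < fderiv ℝ (fderiv ℝ φ) x₀ (gradient φ x₀) (gradient φ x₀)) :
    ∃ P : ℝ, ∀ᶠ x in 𝓝 x₀, ∀ p ≥ P, 0 < pLaplacian p φ x := by
  have hg : Continuous (gradient φ) := hφ.continuous_gradient (by simp)
  have hD : Continuous (fderiv ℝ (fderiv ℝ φ)) :=
    (hφ.fderiv_right (m := 1) (by norm_num)).continuous_fderiv (by simp)
  have hQ : Continuous fun x => fderiv ℝ (fderiv ℝ φ) x (gradient φ x) (gradient φ x) :=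
    (hD.clm_apply hg).clm_apply hg
  have hB : Continuous fun x => gradSq φ x * ∑ i, fderiv ℝ (fderiv ℝ φ) x
      (EuclideanSpace.single i 1) (EuclideanSpace.single i 1) :=
    (contDiff_gradSq hφ).continuous.mul (continuous_finsetSum _ fun i _ =>
      (hD.clm_apply continuous_const).clm_apply continuous_const)
  set Q := fderiv ℝ (fderiv ℝ φ) x₀ (gradient φ x₀) (gradient φ x₀) with hQdef
  set B := gradSq φ x₀ * ∑ i, fderiv ℝ (fderiv ℝ φ) x₀
      (EuclideanSpace.single i 1) (EuclideanSpace.single i 1) with hBdef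
  -- Near `x₀` the leading term exceeds `Q / 2` and the remainder exceeds `B - 1`; this `P` makes
  -- `(p - 2) * (Q / 2)` at least `|B| + 1`.
  refine ⟨2 + (|B| + 1) / (Q / 2), ?_⟩
  filter_upwards [hQ.continuousAt.eventually (lt_mem_nhds (half_lt_self h)),
    hB.continuousAt.eventually (lt_mem_nhds (sub_one_lt B))] with x h1 h2 p hp
  have hx : gradient φ x ≠ 0 := by
    intro h0
    rw [h0] at h1
    simp only [map_zero] at h1
    linarith
  have hs : 0 < gradSq φ x := by rw [gradSq_eq]; positivity
  rw [pLaplacian_eq hφ x hx]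
  refine mul_pos (Real.rpow_pos_of_pos hs _) ?_
  have h3 : |B| + 1 ≤ (p - 2) * (Q / 2) := by
    rw [← div_le_iff₀ (half_pos h)]; linarith
  have h4 : 0 ≤ p - 2 := by
    have : 0 ≤ (|B| + 1) / (Q / 2) := by positivity
    linarith
  have h5 := mul_le_mul_of_nonneg_left h1.le h4
  linarith [neg_abs_le B]

/-- If `φ` touches `v` from below at `x₀` and `Δ_∞ φ(x₀) > 0`, then functions uniformly close
to `v` are not `p`-superharmonic near `x₀`, for large `p`. -/
theorem eventually_exists_dirichletEnergy_lt (hΩ : IsOpen Ω) (hb : Bornology.IsBounded Ω)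
    {p : ℕ → ℝ} (hp_lim : Tendsto p atTop atTop) {v : EuclideanSpace ℝ (Fin n) → ℝ}
    (hv : ContinuousOn v Ω) {vk : ℕ → EuclideanSpace ℝ (Fin n) → ℝ}
    (hvk : ∀ k, MemW1 Ω (ENNReal.ofReal (p k)) (vk k)) (hvkc : ∀ k, ContinuousOn (vk k) Ω)
    {a : ℕ → ℕ → EuclideanSpace ℝ (Fin n) → ℝ} {ε : ℕ → ℕ → ℝ}
    (ha : ∀ k, LipschitzApprox Ω (ENNReal.ofReal (p k)) (vk k) (a k) (ε k))
    {η : ℕ → ℝ} (hη : Tendsto η atTop (𝓝 0)) (hvη : ∀ k, ∀ x ∈ Ω, |vk k x - v x| ≤ η k)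
    {U : Set (EuclideanSpace ℝ (Fin n))} (hU : IsOpen U) (hUΩ : U ⊆ Ω)
    {φ : EuclideanSpace ℝ (Fin n) → ℝ} (hφ : ContDiffOn ℝ 2 φ U)
    {x₀ : EuclideanSpace ℝ (Fin n)} (hx₀ : x₀ ∈ U) (h0 : v x₀ = φ x₀)
    (htouch : ∀ᶠ x in 𝓝[≠] x₀, φ x < v x)
    (hpos : 0 < fderiv ℝ (fderiv ℝ φ) x₀ (gradient φ x₀) (gradient φ x₀))
    {ρ : ℝ} (hρ : 0 < ρ) :
    ∀ᶠ k in atTop, ∃ θ : EuclideanSpace ℝ (Fin n) → ℝ, (∀ x, 0 ≤ θ x) ∧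
      (∀ x ∉ Metric.ball x₀ ρ, θ x = 0) ∧ MemW1Zero Ω (ENNReal.ofReal (p k)) θ ∧
      dirichletEnergy Ω (p k) (fun x => vk k x + θ x) < dirichletEnergy Ω (p k) (vk k) := by
  obtain ⟨φ', hφ', hφ'c, heq⟩ := ContDiffOn.exists_contDiff_eventuallyEq (m := 2) hU hφ hx₀
  have hgrad : gradient φ' x₀ = gradient φ x₀ := by
    simp only [gradient, heq.fderiv_eq]
  have hpos' : 0 < fderiv ℝ (fderiv ℝ φ') x₀ (gradient φ' x₀) (gradient φ' x₀) := by
    rwa [hgrad, heq.fderiv.fderiv_eq]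
  obtain ⟨P, hP⟩ := exists_forall_pLaplacian_pos hφ' hpos'
  have hnear : ∀ᶠ x in 𝓝 x₀, x ≠ x₀ → φ' x < v x := by
    filter_upwards [eventually_nhdsWithin_iff.1 htouch, heq] with x h1 h2 h3
    rw [h2]; exact h1 h3
  obtain ⟨r, hr, hall⟩ := Metric.nhds_basis_closedBall.mem_iff.1
    (hP.and (hnear.and ((hU.eventually_mem hx₀).and
      (Metric.isOpen_ball.eventually_mem (Metric.mem_ball_self hρ)))))
  have hball : Metric.closedBall x₀ r ⊆ Ω := fun x hx => hUΩ (hall hx).2.2.1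
  -- Strict touching and compactness of the annulus give a uniform gap.
  obtain ⟨d, hd, hdle⟩ : ∃ d > 0, ∀ x ∈ Metric.closedBall x₀ r, r / 2 ≤ dist x x₀ →
      φ' x + d ≤ v x := by
    set A := Metric.closedBall x₀ r ∩ {x | r / 2 ≤ dist x x₀} with hA
    have hAc : IsCompact A := (isCompact_closedBall x₀ r).inter_right
      (isClosed_le continuous_const (continuous_id.dist continuous_const))
    rcases A.eq_empty_or_nonempty with hAe | hAne
    · refine ⟨1, one_pos, fun x hx hx' => ?_⟩
      have : x ∈ A := ⟨hx, hx'⟩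
      rw [hAe] at this
      exact this.elim
    · obtain ⟨y, hy, hmin⟩ := hAc.exists_isMinOn hAne
        ((hv.mono (Set.inter_subset_left.trans hball)).sub hφ'.continuous.continuousOn)
      refine ⟨v y - φ' y, sub_pos.2 ((hall hy.1).2.1 ?_), fun x hx hx' => ?_⟩
      · rintro rfl
        have := hy.2
        simp only [Set.mem_ofPred_eq, dist_self] at this
        linarith
      · have := hmin (⟨hx, hx'⟩ : x ∈ A)
        simp only [Set.mem_ofPred_eq, Pi.sub_apply] at this
        linarith
  filter_upwards [hp_lim.eventually_ge_atTop P, hp_lim.eventually_ge_atTop 4,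
    hη.eventually_le_const (show (0 : ℝ) < d / 4 by linarith)] with k h1 h2 h3
  have hx₀Ω := hUΩ hx₀
  -- With an error of at most `d / 4`, raising `φ'` by `d / 2` leaves a gap `d / 4` below `vk k` on
  -- the annulus and still puts `φ'` above `vk k` at `x₀`.
  obtain ⟨θ, hθ0, hθb, hθ⟩ := exists_dirichletEnergy_lt hΩ hb h2 (hvk k) (hvkc k) (ha k) hφ' hφ'c
    (half_pos hr) (half_lt_self hr) hball (m := d / 2) (δ := d / 4) (by linarith)
    (fun x hx hx' => by
      have := hdle x hx hx'
      have := abs_le.1 (hvη k x (hball hx))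
      linarith [this.1])
    (by
      have := abs_le.1 (hvη k x₀ hx₀Ω)
      rw [heq.eq_of_nhds, ← h0]
      linarith [this.2])
    (fun x hx => (hall hx).1 _ h1)
  refine ⟨θ, hθ0, fun x hx => hθb x fun h => hx ?_, hθ⟩
  exact (hall (Metric.ball_subset_closedBall h)).2.2.2

theorem dirichletEnergy_neg (hΩ : IsOpen Ω) {p : ℝ} {q : ℝ≥0∞}
    {u : EuclideanSpace ℝ (Fin n) → ℝ} (hu : MemW1 Ω q u) :
    dirichletEnergy Ω p (fun x => -u x) = dirichletEnergy Ω p u := by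
  refine lintegral_congr_ae ?_
  filter_upwards [hu.weakGradient_neg_ae_eq hΩ] with x hx
  rw [hx, enorm_neg]

theorem isOpen_positivitySet (hΩ : IsOpen Ω) {u : EuclideanSpace ℝ (Fin n) → ℝ}
    (hu : ContinuousOn u Ω) : IsOpen (positivitySet Ω u) :=
  hu.isOpen_inter_preimage hΩ isOpen_Ioi

/-- A perturbation in `W_0^{1,p}` keeps the trace, and one that does not enlarge the positivity set
keeps the volume constraint, so it yields a competitor. -/
theorem IsMinimizerP.not_dirichletEnergy_lt (hΩ : IsOpen Ω) {f : EuclideanSpace ℝ (Fin n) → ℝ}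
    {α p : ℝ} (hp : 1 ≤ p) {u θ : EuclideanSpace ℝ (Fin n) → ℝ} (hu : IsMinimizerP Ω f α p u)
    (hθ : MemW1Zero Ω (ENNReal.ofReal p) θ)
    (hpos : positivitySet Ω (fun x => u x + θ x) ⊆ positivitySet Ω u) :
    ¬dirichletEnergy Ω p (fun x => u x + θ x) < dirichletEnergy Ω p u := by
  refine not_lt.2 (hu.2 _ ⟨hu.1.memW1.add hΩ hθ.memW1, ?_,
    (measure_mono hpos).trans hu.1.volume_le⟩)
  obtain ⟨g, hg, hgf, hgu⟩ := hu.1.boundary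
  refine ⟨g, hg, hgf, ?_⟩
  convert hgu.add hΩ (by simpa using hp) hθ using 2
  ring

/-- Uniform limits of minimizers as `p → ∞` are infinity harmonic where they are positive. -/
theorem isInfinityHarmonic_of_isMinimizerP (hΩ : IsOpen Ω) (hb : Bornology.IsBounded Ω)
    {f : EuclideanSpace ℝ (Fin n) → ℝ} {α : ℝ} {p : ℕ → ℝ} (hp : ∀ k, 1 ≤ p k)
    (hp_lim : Tendsto p atTop atTop) {u : EuclideanSpace ℝ (Fin n) → ℝ}
    (hu : ContinuousOn u Ω) {uk : ℕ → EuclideanSpace ℝ (Fin n) → ℝ}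
    (huk : ∀ k, IsMinimizerP Ω f α (p k) (uk k)) (hukc : ∀ k, ContinuousOn (uk k) Ω)
    {a : ℕ → ℕ → EuclideanSpace ℝ (Fin n) → ℝ} {ε : ℕ → ℕ → ℝ}
    (ha : ∀ k, LipschitzApprox Ω (ENNReal.ofReal (p k)) (uk k) (a k) (ε k))
    {η : ℕ → ℝ} (hη : Tendsto η atTop (𝓝 0)) (huη : ∀ k, ∀ x ∈ Ω, |uk k x - u x| ≤ η k) :
    IsInfinityHarmonic (positivitySet Ω u) u := by
  have hU := isOpen_positivitySet hΩ hu
  have hUΩ : positivitySet Ω u ⊆ Ω := fun x hx => hx.1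
  have huU : ContinuousOn u (positivitySet Ω u) := hu.mono hUΩ
  refine ⟨⟨huU.lowerSemicontinuousOn, fun φ hφ x₀ hx₀ h0 ht => ?_⟩,
    ⟨huU.upperSemicontinuousOn, fun φ hφ x₀ hx₀ h0 ht => ?_⟩⟩
  · by_contra hneg
    -- Raising `uk k` must not create new positive points: the perturbation is confined to a ball
    -- where `u > u x₀ / 2`, and an error of at most `u x₀ / 2` makes `uk k` positive there already.
    have hnear : ∀ᶠ x in 𝓝 x₀, x ∈ Ω → u x₀ / 2 < u x := by
      filter_upwards [(hu.continuousAt (hΩ.mem_nhds hx₀.1)).eventually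
        (lt_mem_nhds (half_lt_self hx₀.2))] with x hx _ using hx
    obtain ⟨ρ, hρ, hρu⟩ := Metric.nhds_basis_ball.mem_iff.1 hnear
    obtain ⟨k, ⟨θ, -, hθb, hθ, hlt⟩, hk⟩ := ((eventually_exists_dirichletEnergy_lt hΩ hb hp_lim hu
      (fun k => (huk k).1.memW1) hukc ha hη huη hU hUΩ hφ hx₀ h0 ht (by linarith) hρ).and
      (hη.eventually_le_const (half_pos hx₀.2))).exists
    refine (huk k).not_dirichletEnergy_lt hΩ (hp k) hθ (fun x hx => ⟨hx.1, ?_⟩) hlt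
    by_cases hxb : x ∈ Metric.ball x₀ ρ
    · have h1 : u x₀ / 2 < u x := hρu hxb hx.1
      have h2 := abs_le.1 (huη k x hx.1)
      linarith [h2.1]
    · simpa [hθb x hxb] using hx.2
  · by_contra hneg
    have hgrad : gradient (fun x => -φ x) x₀ = -gradient φ x₀ := gradient_fun_neg φ x₀
    have hD : fderiv ℝ (fderiv ℝ fun x => -φ x) x₀ = -fderiv ℝ (fderiv ℝ φ) x₀ := by
      have : (fderiv ℝ fun x => -φ x) = fun x => -fderiv ℝ φ x := by
        ext1 x; exact fderiv_fun_neg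
      rw [this, fderiv_fun_neg]
    -- For the subsolution property everything is negated. Now `uk k` is lowered by `θ`, so the
    -- volume constraint is automatic and the radius 1 is arbitrary.
    obtain ⟨k, θ, hθ0, -, hθ, hlt⟩ := (eventually_exists_dirichletEnergy_lt hΩ hb hp_lim hu.neg
      (fun k => (huk k).1.memW1.neg hΩ) (fun k => (hukc k).neg)
      (fun k => (ha k).neg hΩ (huk k).1.memW1) hη
      (fun k x hx => by
        have := huη k x hx
        rw [abs_sub_comm] at this
        simpa [← sub_eq_neg_add] using this) hU hUΩ hφ.neg hx₀ (by simp [h0])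
      (by filter_upwards [ht] with x hx using neg_lt_neg hx)
      (by
        simp only [hgrad, hD, neg_apply, map_neg, neg_neg]
        linarith) one_pos).exists
    refine (huk k).not_dirichletEnergy_lt hΩ (hp k) (hθ.neg hΩ) (fun x hx => ⟨hx.1, ?_⟩) ?_
    · have := hx.2
      have := hθ0 x
      linarith
    · rw [dirichletEnergy_neg hΩ (huk k).1.memW1] at hlt
      have h2 := dirichletEnergy_neg (p := p k) hΩ ((huk k).1.memW1.add hΩ (hθ.neg hΩ).memW1)
      rw [← h2]
      simpa [add_comm] using hlt

end

/-! ### Competitors, and bounds for minimizers -/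

section

variable {n : ℕ} {Ω : Set (EuclideanSpace ℝ (Fin n))} {f : EuclideanSpace ℝ (Fin n) → ℝ}
  {α p : ℝ}

theorem Bornology.IsBounded.ne_univ_of_euclideanSpace (hn : 1 ≤ n) (hb : Bornology.IsBounded Ω) :
    Ω ≠ Set.univ := by
  rintro rfl
  have : Nonempty (Fin n) := ⟨⟨0, hn⟩⟩
  exact NormedSpace.unbounded_univ ℝ (EuclideanSpace ℝ (Fin n)) hb

theorem positivitySet_ae_eq {u v : EuclideanSpace ℝ (Fin n) → ℝ}
    (hΩ : MeasurableSet Ω) (huv : u =ᵐ[volume.restrict Ω] v) :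
    volume (positivitySet Ω u) = volume (positivitySet Ω v) := by
  refine measure_congr ?_
  filter_upwards [(ae_restrict_iff' hΩ).1 huv] with x hx
  refine propext ⟨fun h => ⟨h.1, ?_⟩, fun h => ⟨h.1, ?_⟩⟩
  · rw [← hx h.1]; exact h.2
  · rw [hx h.1]; exact h.2

theorem dirichletEnergy_congr_ae (hΩ : IsOpen Ω) {q : ℝ≥0∞} {u v : EuclideanSpace ℝ (Fin n) → ℝ}
    (hu : MemW1 Ω q u) (huv : u =ᵐ[volume.restrict Ω] v) :
    dirichletEnergy Ω p u = dirichletEnergy Ω p v := by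
  refine lintegral_congr_ae ?_
  filter_upwards [weakGradient_congr_ae hΩ hu.exists_weakGradient huv] with x hx
  rw [hx]

theorem IsMinimizerP.congr_ae (hΩ : IsOpen Ω) {u v : EuclideanSpace ℝ (Fin n) → ℝ}
    (hu : IsMinimizerP Ω f α p u) (huv : u =ᵐ[volume.restrict Ω] v) :
    IsMinimizerP Ω f α p v := by
  refine ⟨⟨hu.1.memW1.congr_ae hΩ huv, ?_, ?_⟩, fun w hw => ?_⟩
  · obtain ⟨g, hg, hgf, hgu⟩ := hu.1.boundary
    refine ⟨g, hg, hgf, hgu.congr_ae hΩ ?_⟩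
    filter_upwards [huv] with x hx
    rw [hx]
  · rw [← positivitySet_ae_eq hΩ.measurableSet huv]
    exact hu.1.volume_le
  · rw [← dirichletEnergy_congr_ae hΩ hu.1.memW1 huv]
    exact hu.2 w hw

theorem LipschitzWith.isAdmissibleP {M : ℝ≥0} {v : EuclideanSpace ℝ (Fin n) → ℝ}
    (hv : LipschitzWith M v) (hΩ : IsOpen Ω) (hb : Bornology.IsBounded Ω) (hp : 1 ≤ p)
    (hvf : ∀ x ∈ frontier Ω, v x = f x) (hvol : volume (positivitySet Ω v) ≤ ENNReal.ofReal α) :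
    IsAdmissibleP Ω f α p v := by
  refine ⟨hv.memW1 hΩ hb _, ⟨v, ⟨M, hv⟩, hvf, ?_⟩, hvol⟩
  have h0 : LipschitzWith 0 fun x => v x - v x := by
    simp [LipschitzWith]
  exact h0.memW1Zero_of_eq_zero hΩ hb (by simpa using hp) ENNReal.ofReal_ne_top fun x _ => sub_self _

theorem eLpNorm_weakGradient_eq_dirichletEnergy_rpow (hp : 0 < p)
    (u : EuclideanSpace ℝ (Fin n) → ℝ) :
    eLpNorm (weakGradient Ω u) (ENNReal.ofReal p) (volume.restrict Ω) =
      dirichletEnergy Ω p u ^ (1 / p) := by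
  rw [eLpNorm_eq_lintegral_rpow_enorm_toReal (by simpa using hp) ENNReal.ofReal_ne_top,
    ENNReal.toReal_ofReal hp.le, dirichletEnergy]

theorem LipschitzWith.eLpNorm_gradient_le {M : ℝ≥0} {v : EuclideanSpace ℝ (Fin n) → ℝ}
    (hv : LipschitzWith M v) (hb : Bornology.IsBounded Ω) (hp : 0 < p) :
    eLpNorm (gradient v) (ENNReal.ofReal p) (volume.restrict Ω) ≤
      ENNReal.ofReal (M * volume.real Ω ^ (1 / p)) := by
  refine (eLpNorm_le_of_ae_bound (Eventually.of_forall hv.norm_gradient_le)).trans (le_of_eq ?_)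
  rw [Measure.restrict_apply_univ, ENNReal.toReal_ofReal hp.le, mul_comm (M : ℝ),
    ENNReal.ofReal_mul (by positivity), ← ENNReal.ofReal_rpow_of_nonneg (by positivity)
      (by positivity), measureReal_def, ENNReal.ofReal_toReal hb.measure_lt_top.ne, one_div]

/-- Used twice: with a crude `v` for compactness, and with an arbitrary competitor of the limit
problem for minimality, where it matters that the bound tends to `M` itself. -/
theorem IsMinimizerP.eLpNorm_weakGradient_le (hΩ : IsOpen Ω) (hb : Bornology.IsBounded Ω)
    (hp : 1 ≤ p) {u v : EuclideanSpace ℝ (Fin n) → ℝ} (hu : IsMinimizerP Ω f α p u) {M : ℝ≥0}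
    (hv : LipschitzWith M v) (hvf : ∀ x ∈ frontier Ω, v x = f x)
    (hvol : volume (positivitySet Ω v) ≤ ENNReal.ofReal α) :
    eLpNorm (weakGradient Ω u) (ENNReal.ofReal p) (volume.restrict Ω) ≤
      ENNReal.ofReal (M * volume.real Ω ^ (1 / p)) := by
  have hp0 : 0 < p := by linarith
  refine le_trans ?_ (hv.eLpNorm_gradient_le hb hp0)
  rw [← eLpNorm_congr_ae (hv.weakGradient_ae_eq hΩ),
    eLpNorm_weakGradient_eq_dirichletEnergy_rpow hp0,
    eLpNorm_weakGradient_eq_dirichletEnergy_rpow hp0]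
  exact ENNReal.rpow_le_rpow (hu.2 v (hv.isAdmissibleP hΩ hb hp hvf hvol)) (by positivity)

/-- Lipschitz boundary data have Lipschitz extensions with small positivity set. -/
theorem exists_lipschitzWith_volume_positivitySet_le (hΩ : IsOpen Ω) (hb : Bornology.IsBounded Ω)
    (hne : Ω ≠ Set.univ) (hα : 0 < α) {K : ℝ≥0} {g : EuclideanSpace ℝ (Fin n) → ℝ}
    (hg : LipschitzWith K g) :
    ∃ (M : ℝ≥0) (v : EuclideanSpace ℝ (Fin n) → ℝ), LipschitzWith M v ∧
      (∀ x ∈ frontier Ω, v x = g x) ∧ volume (positivitySet Ω v) ≤ ENNReal.ofReal α := by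
  let d : EuclideanSpace ℝ (Fin n) → ℝ := fun x => Metric.infDist x Ωᶜ
  have hd : LipschitzWith 1 d := Metric.lipschitz_infDist_pt _
  have hd0 : ∀ x, 0 ≤ d x := fun x => Metric.infDist_nonneg
  have hdpos : ∀ x ∈ Ω, 0 < d x := fun x hx =>
    (hΩ.isClosed_compl.notMem_iff_infDist_pos (Set.nonempty_compl.2 hne)).1 (by simpa using hx)
  -- As `d > 0` in `Ω`, the positivity sets decrease to the empty set, so their finite measures tend
  -- to 0; on `∂Ω` nothing changes.
  let v : ℕ → EuclideanSpace ℝ (Fin n) → ℝ := fun j x => g x - j * d x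
  have hv : ∀ j : ℕ, LipschitzWith (K + ‖(j : ℝ)‖₊ * 1) (v j) := fun j =>
    hg.sub ((lipschitzWith_smul (j : ℝ)).comp hd)
  have hanti : Antitone fun j => positivitySet Ω (v j) := fun i j hij x hx => by
    refine ⟨hx.1, hx.2.trans_le ?_⟩
    have : (i : ℝ) ≤ j := by exact_mod_cast hij
    have := mul_le_mul_of_nonneg_right this (hd0 x)
    simp only [v]; linarith
  have hempty : ⋂ j, positivitySet Ω (v j) = ∅ := by
    refine Set.eq_empty_of_forall_notMem fun x hx => ?_
    rw [Set.mem_iInter] at hx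
    obtain ⟨j, hj⟩ := exists_nat_gt (g x / d x)
    have h1 := (hx j).2
    rw [div_lt_iff₀ (hdpos x (hx 0).1)] at hj
    simp only [v] at h1
    linarith
  have hlim := tendsto_measure_iInter_atTop (μ := volume)
    (fun j => (isOpen_positivitySet hΩ
      (hv j).continuous.continuousOn).measurableSet.nullMeasurableSet)
    hanti ⟨0, ((measure_mono fun x hx => hx.1).trans_lt hb.measure_lt_top).ne⟩
  rw [hempty, measure_empty] at hlim
  obtain ⟨j, hj⟩ := (hlim.eventually_le_const (ENNReal.ofReal_pos.2 hα)).exists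
  refine ⟨_, v j, hv j, fun x hx => ?_, hj⟩
  have : x ∈ Ωᶜ := by rw [hΩ.frontier_eq] at hx; exact hx.2
  simp [v, d, Metric.infDist_zero_of_mem this]

/-- For `x ∈ Ω` and `y ∉ Ω`, some zero of `h` on `∂Ω` lies at distance `infDist x Ωᶜ ≤ dist x y`
from `x`, so cutting off outside `Ω` does not increase the constant. -/
theorem LipschitzWith.indicator_of_frontier {K : ℝ≥0} {h : EuclideanSpace ℝ (Fin n) → ℝ}
    (hh : LipschitzWith K h) (hne : Ω ≠ Set.univ) (h0 : ∀ x ∈ frontier Ω, h x = 0) :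
    LipschitzWith K (Ω.indicator h) := by
  have key : ∀ x ∈ Ω, ∀ y ∉ Ω, |h x| ≤ K * dist x y := by
    intro x hx y hy
    obtain ⟨z, hz, hxz⟩ := exists_mem_frontier_infDist_compl_eq_dist hx hne
    have h1 := hh.dist_le_mul x z
    rw [Real.dist_eq, h0 z hz, sub_zero, ← hxz] at h1
    exact h1.trans (mul_le_mul_of_nonneg_left (Metric.infDist_le_dist_of_mem hy) K.2)
  refine LipschitzWith.of_dist_le_mul fun x y => ?_
  by_cases hx : x ∈ Ω <;> by_cases hy : y ∈ Ω
  · simpa [hx, hy] using hh.dist_le_mul x y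
  · simpa [hx, hy, Real.dist_eq] using key x hx y hy
  · simpa [hx, hy, Real.dist_eq, dist_comm] using key y hy x hx
  · simpa [hx, hy] using mul_nonneg K.2 dist_nonneg

/-- The trace does not depend on the choice of the Lipschitz extension. -/
theorem HasBoundaryTrace.memW1Zero_sub (hΩ : IsOpen Ω) (hb : Bornology.IsBounded Ω)
    (hne : Ω ≠ Set.univ) (hp : 1 ≤ p) {u g : EuclideanSpace ℝ (Fin n) → ℝ}
    (hu : HasBoundaryTrace Ω (ENNReal.ofReal p) u f) {K : ℝ≥0} (hg : LipschitzWith K g)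
    (hgf : ∀ x ∈ frontier Ω, g x = f x) :
    MemW1Zero Ω (ENNReal.ofReal p) fun x => u x - g x := by
  obtain ⟨g', ⟨K', hg'⟩, hgf', hgu⟩ := hu
  have hp' : 1 ≤ ENNReal.ofReal p := by simpa using hp
  have h1 : LipschitzWith (K' + K) fun x => g' x - g x := hg'.sub hg
  have h2 := h1.indicator_of_frontier hne fun x hx => by rw [hgf x hx, hgf' x hx, sub_self]
  have h3 := h2.memW1Zero_of_eq_zero hΩ hb hp' ENNReal.ofReal_ne_top
    fun x hx => Set.indicator_of_notMem hx _
  refine (hgu.add hΩ hp' h3).congr_ae hΩ ?_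
  filter_upwards [ae_restrict_mem hΩ.measurableSet] with x hx
  rw [Set.indicator_of_mem hx]
  ring

/-- Minimizers for large `p` have continuous representatives which attain the boundary values,
with a Hölder estimate. -/
theorem IsMinimizerP.exists_continuous_representative (hn : 1 ≤ n) (hΩ : IsOpen Ω)
    (hb : Bornology.IsBounded Ω) (hp : 2 * n ≤ p) {u : EuclideanSpace ℝ (Fin n) → ℝ}
    (hu : IsMinimizerP Ω f α p u) {g : EuclideanSpace ℝ (Fin n) → ℝ} {K : ℝ≥0}
    (hg : LipschitzWith K g) (hgf : ∀ x ∈ frontier Ω, g x = f x) :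
    ∃ (W : EuclideanSpace ℝ (Fin n) → ℝ) (a : ℕ → EuclideanSpace ℝ (Fin n) → ℝ) (ε : ℕ → ℝ),
      Continuous W ∧ (∀ x ∉ Ω, W x = 0) ∧ u =ᵐ[volume.restrict Ω] (fun x => g x + W x) ∧
      LipschitzApprox Ω (ENNReal.ofReal p) (fun x => g x + W x) a ε ∧
      ∀ N : ℝ, 0 ≤ N →
        eLpNorm (weakGradient Ω u) (ENNReal.ofReal p) (volume.restrict Ω) ≤ ENNReal.ofReal N →
        ∀ x y, |W x - W y| ≤
          6 * (volume.real (Metric.ball (0 : EuclideanSpace ℝ (Fin n)) 1)) ^ (-(1 / p)) *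
            dist x y ^ (1 - n / p) * (N + K * volume.real Ω ^ (1 / p)) := by
  have hn' : (1 : ℝ) ≤ n := by exact_mod_cast hn
  have hp1 : 1 ≤ p := by linarith
  have hp1' : 1 ≤ ENNReal.ofReal p := by simpa using hp1
  have hw := hu.1.boundary.memW1Zero_sub hΩ hb (hb.ne_univ_of_euclideanSpace hn) hp1 hg hgf
  have hgm : MemW1 Ω (ENNReal.ofReal p) g := hg.memW1 hΩ hb _
  have hgg := hg.weakGradient_ae_eq (Ω := Ω) hΩ
  have hwg := hu.1.memW1.weakGradient_sub_ae_eq hΩ hgm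
  obtain ⟨W, ψ, hW, hWw, hW0, hWN, hψ, ⟨ε, hε, hψε⟩, hψg⟩ :=
    hw.exists_continuous_representative hn hb hp
  have huW : u =ᵐ[volume.restrict Ω] fun x => g x + W x := by
    filter_upwards [hWw] with x hx
    rw [hx]; ring
  refine ⟨W, fun j x => g x + ψ j x, ε, hW, hW0, huW, ⟨fun j => ?_, hε, fun j x _ => ?_, ?_⟩, ?_⟩
  · obtain ⟨K', hK'⟩ := (hψ j).exists_lipschitzWith
    exact ⟨_, hg.add hK'⟩
  · rw [add_sub_add_left_eq_sub]; exact hψε j x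
  · refine hψg.congr fun j => eLpNorm_congr_ae ?_
    filter_upwards [weakGradient_congr_ae hΩ hu.1.memW1.exists_weakGradient huW, hgg, hwg,
      ae_restrict_of_ae (hg.ae_differentiableAt (μ := volume))] with x h1 h2 h3 h4
    rw [← h1, h3, h2, gradient_fun_add h4 ((hψ j).differentiableAt x)]
    abel
  · intro N hN hNu x y
    refine hWN _ (by positivity) ?_ x y
    rw [eLpNorm_congr_ae hwg, ENNReal.ofReal_add hN (by positivity)]
    refine (eLpNorm_sub_le hu.1.memW1.memLp_weakGradient.1 hgm.memLp_weakGradient.1 hp1').trans ?_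
    rw [eLpNorm_congr_ae hgg]
    exact add_le_add hNu (hg.eLpNorm_gradient_le hb (by linarith))

end

/-! ### Compactness -/

section

variable {n : ℕ} {Ω : Set (EuclideanSpace ℝ (Fin n))}

/-- One modulus of continuity for all the Hölder exponents `1 - n / p ∈ [1/2, 1]`, as equicontinuity
requires. -/
theorem Real.rpow_le_sqrt_add_self {d e : ℝ} (hd : 0 ≤ d) (he : 1 / 2 ≤ e) (he' : e ≤ 1) :
    d ^ e ≤ √d + d := by
  rcases le_total d 1 with h | h
  · rcases hd.eq_or_lt with rfl | hd'
    · rw [Real.zero_rpow (by linarith)]; positivity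
    · have := Real.rpow_le_rpow_of_exponent_ge hd' h he
      rw [← Real.sqrt_eq_rpow] at this
      linarith
  · have := Real.rpow_le_rpow_of_exponent_le h he'
    rw [Real.rpow_one] at this
    linarith [Real.sqrt_nonneg d]

theorem tendsto_const_rpow_one_div {p : ℕ → ℝ} (hp_lim : Tendsto p atTop atTop) {c : ℝ}
    (hc : 0 < c) : Tendsto (fun k => c ^ (1 / p k)) atTop (𝓝 1) := by
  have hinv : Tendsto (fun k => 1 / p k) atTop (𝓝 0) := by
    simpa [Function.comp_def, one_div] using tendsto_inv_atTop_zero.comp hp_lim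
  simpa [Function.comp_def] using
    (Real.continuousAt_const_rpow (b := 0) hc.ne').tendsto.comp hinv

/-- Compactness for functions with Hölder seminorms of exponent `1 - n / p_k → 1`. -/
theorem exists_subseq_tendsto_lipschitzWith (hb : Bornology.IsBounded Ω) (hne : Ω ≠ Set.univ)
    {p : ℕ → ℝ} (hp : ∀ k, 1 ≤ p k) (hp' : ∀ k, 2 * n ≤ p k) (hp_lim : Tendsto p atTop atTop)
    {W : ℕ → EuclideanSpace ℝ (Fin n) → ℝ} (hW : ∀ k, Continuous (W k))
    (hW0 : ∀ k, ∀ x ∉ Ω, W k x = 0) {κ V : ℝ} (hκ : 0 < κ) (hV : 0 < V) {A : ℝ≥0}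
    (hWA : ∀ k x y, |W k x - W k y| ≤
      6 * κ ^ (-(1 / p k)) * dist x y ^ (1 - n / p k) * (A * V ^ (1 / p k))) :
    ∃ (σ : ℕ → ℕ) (U : EuclideanSpace ℝ (Fin n) → ℝ) (η : ℕ → ℝ), StrictMono σ ∧
      (∃ L : ℝ≥0, LipschitzWith L U) ∧ (∀ x ∉ Ω, U x = 0) ∧ Tendsto η atTop (𝓝 0) ∧
      ∀ k x, |W (σ k) x - U x| ≤ η k := by
  have hB_lim : Tendsto (fun k => 6 * κ ^ (-(1 / p k)) * (A * V ^ (1 / p k))) atTop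
      (𝓝 (6 * 1⁻¹ * (A * 1))) := by
    refine Tendsto.mul (Tendsto.const_mul 6 ?_) ((tendsto_const_rpow_one_div hp_lim hV).const_mul _)
    simp only [Real.rpow_neg hκ.le]
    exact (tendsto_const_rpow_one_div hp_lim hκ).inv₀ one_ne_zero
  obtain ⟨B, hB⟩ := hB_lim.bddAbove_range
  have hB' : ∀ k, 6 * κ ^ (-(1 / p k)) * (A * V ^ (1 / p k)) ≤ B := fun k => hB ⟨k, rfl⟩
  have hB0 : 0 ≤ B := le_trans (by positivity) (hB' 0)
  have hmod : ∀ k x y, |W k x - W k y| ≤ B * (√(dist x y) + dist x y) := by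
    intro k x y
    have hpk : 0 < p k := by linarith [hp k]
    have h1 : (n : ℝ) / p k ≤ 1 / 2 := by rw [div_le_iff₀ hpk]; linarith [hp' k]
    have h2 : 0 ≤ (n : ℝ) / p k := by positivity
    have h3 := Real.rpow_le_sqrt_add_self (dist_nonneg (x := x) (y := y))
      (e := 1 - n / p k) (by linarith) (by linarith)
    refine (hWA k x y).trans ?_
    rw [mul_right_comm]
    exact mul_le_mul (hB' k) h3 (by positivity) hB0
  obtain ⟨z, hz⟩ := Set.nonempty_compl.2 hne
  obtain ⟨R, hR⟩ := hb.closure.subset_closedBall z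
  have : CompactSpace (closure Ω) := isCompact_iff_compactSpace.1 hb.isCompact_closure
  let F : ℕ → BoundedContinuousFunction (closure Ω) ℝ := fun k =>
    BoundedContinuousFunction.mkOfCompact ⟨fun x => W k x, (hW k).comp continuous_subtype_val⟩
  have hcomp : IsCompact (closure (Set.range F)) := by
    refine BoundedContinuousFunction.arzela_ascoli (Metric.closedBall 0 (B * (√R + R)))
      (isCompact_closedBall _ _) _ ?_ ?_
    · rintro _ x ⟨k, rfl⟩
      have h1 : dist (x : EuclideanSpace ℝ (Fin n)) z ≤ R := hR x.2
      have h2 := hmod k x z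
      rw [hW0 k z hz, sub_zero] at h2
      rw [mem_closedBall_zero_iff, Real.norm_eq_abs]
      exact h2.trans (mul_le_mul_of_nonneg_left (add_le_add (Real.sqrt_le_sqrt h1) h1) hB0)
    · refine Metric.equicontinuous_of_continuity_modulus (fun d => B * (√d + d)) ?_ _ ?_
      · have : Continuous fun d : ℝ => B * (√d + d) := by fun_prop
        simpa using this.tendsto 0
      · rintro x y ⟨_, k, rfl⟩
        exact hmod k x y
  obtain ⟨F₀, -, σ, hσ, hF⟩ := hcomp.tendsto_subseq fun k => subset_closure (Set.mem_range_self k)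
  classical
  let U : EuclideanSpace ℝ (Fin n) → ℝ := fun x => if h : x ∈ closure Ω then F₀ ⟨x, h⟩ else 0
  have hη : Tendsto (fun k => dist (F (σ k)) F₀) atTop (𝓝 0) := tendsto_iff_dist_tendsto_zero.1 hF
  have hWU : ∀ k x, |W (σ k) x - U x| ≤ dist (F (σ k)) F₀ := by
    intro k x
    by_cases hx : x ∈ closure Ω
    · simp only [U, hx, dif_pos]
      exact BoundedContinuousFunction.dist_coe_le_dist (f := F (σ k)) (g := F₀) ⟨x, hx⟩
    · simp only [U, hx, dif_neg, not_false_eq_true, hW0 _ x fun h => hx (subset_closure h),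
        sub_zero, abs_zero]
      exact dist_nonneg
  have hlim : ∀ x, Tendsto (fun k => W (σ k) x) atTop (𝓝 (U x)) := fun x =>
    tendsto_iff_dist_tendsto_zero.2 (squeeze_zero (fun _ => dist_nonneg) (fun k => hWU k x) hη)
  -- In the Hölder bounds the exponents tend to 1 and the constants to `6 * A`.
  refine ⟨σ, U, _, hσ, ⟨6 * A, LipschitzWith.of_dist_le_mul fun x y => ?_⟩, fun x hx => ?_, hη, hWU⟩
  · rcases eq_or_ne x y with rfl | hxy
    · simp
    have hd : 0 < dist x y := dist_pos.2 hxy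
    have hσ' := hσ.tendsto_atTop
    have h1 : Tendsto (fun k => dist x y ^ (1 - n / p (σ k))) atTop (𝓝 (dist x y)) := by
      have h2 : Tendsto (fun k => 1 - n / p (σ k)) atTop (𝓝 (1 - 0)) :=
        ((hp_lim.comp hσ').const_div_atTop (n : ℝ)).const_sub 1
      simpa [Function.comp_def] using
        (Real.continuousAt_const_rpow (b := 1 - 0) hd.ne').tendsto.comp h2
    have h3 := le_of_tendsto_of_tendsto' ((hlim x).sub (hlim y)).abs
      ((hB_lim.comp hσ').mul h1) fun k => (hWA (σ k) x y).trans (le_of_eq (mul_right_comm _ _ _))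
    rw [Real.dist_eq]
    refine h3.trans (le_of_eq ?_)
    push_cast
    ring
  · exact tendsto_nhds_unique (hlim x) (by simp [hW0 _ x hx])

end

/-! ### Weak convergence -/

section

variable {n : ℕ} {Ω : Set (EuclideanSpace ℝ (Fin n))}

/-- `C_c^∞(Ω)` is dense in `L^r(Ω)`, `1 ≤ r < ∞`. -/
theorem MeasureTheory.MemLp.exists_isTestFunction_eLpNorm_sub_le (hΩ : IsOpen Ω)
    (hb : Bornology.IsBounded Ω) (hne : Ω ≠ Set.univ) {r : ℝ≥0∞} (hr : 1 ≤ r) (hr' : r ≠ ⊤)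
    {h : EuclideanSpace ℝ (Fin n) → ℝ} (hh : MemLp h r (volume.restrict Ω)) {δ : ℝ} (hδ : 0 < δ) :
    ∃ ψ : EuclideanSpace ℝ (Fin n) → ℝ, IsTestFunction Ω ψ ∧
      eLpNorm (fun x => h x - ψ x) r (volume.restrict Ω) ≤ ENNReal.ofReal δ := by
  have hfin : IsFiniteMeasure (volume.restrict Ω) := isFiniteMeasure_restrict.2 hb.measure_lt_top.ne
  obtain ⟨g, hgc, hg, hhg⟩ := hh.exist_eLpNorm_sub_le hr' hr (ε := δ / 3) (by positivity)
  obtain ⟨K, hK⟩ := ContDiff.lipschitzWith_of_hasCompactSupport hgc hg (by simp)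
  obtain ⟨B, hB⟩ := hgc.exists_bound_of_continuous hg.continuous
  let d : EuclideanSpace ℝ (Fin n) → ℝ := fun x => Metric.infDist x Ωᶜ
  have hd : LipschitzWith 1 d := Metric.lipschitz_infDist_pt _
  have hd0 : ∀ x, 0 ≤ d x := fun x => Metric.infDist_nonneg
  have hdpos : ∀ x ∈ Ω, 0 < d x := fun x hx =>
    (hΩ.isClosed_compl.notMem_iff_infDist_pos (Set.nonempty_compl.2 hne)).1 (by simpa using hx)
  -- Clamping `g` between `± j d` keeps it Lipschitz, makes it vanish outside `Ω`, and changes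
  -- nothing at a point of `Ω` once `j` is large.
  let T : ℕ → EuclideanSpace ℝ (Fin n) → ℝ := fun j x => max (-(j * d x)) (min (g x) (j * d x))
  have hjd : ∀ j : ℕ, ∃ K', LipschitzWith K' fun x => j * d x := fun j =>
    ⟨_, (lipschitzWith_smul (j : ℝ)).comp hd⟩
  have hT : ∀ j, ∃ K', LipschitzWith K' (T j) := fun j => by
    obtain ⟨K', hK'⟩ := hjd j
    exact ⟨_, hK'.neg.max (hK.min hK')⟩
  have hT0 : ∀ j, ∀ x ∉ Ω, T j x = 0 := fun j x hx => by
    have : d x = 0 := Metric.infDist_zero_of_mem (by simpa using hx)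
    simp [T, this]
  have hsub : ∀ j x, |g x - T j x| ≤ B := by
    intro j x
    have h1 : |g x| ≤ B := hB x
    have h2 : 0 ≤ j * d x := mul_nonneg (Nat.cast_nonneg j) (hd0 x)
    rw [abs_le] at h1 ⊢
    simp only [T]
    rcases max_cases (-(j * d x)) (min (g x) (j * d x)) with h3 | h3 <;>
    rcases min_cases (g x) (j * d x) with h4 | h4 <;> constructor <;> linarith
  have hTlim : Tendsto (fun j => eLpNorm (fun x => g x - T j x) r (volume.restrict Ω)) atTop
      (𝓝 0) := by
    refine eLpNorm_tendsto_zero_of_bounded hr hr' (fun j => ?_)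
      (fun j => Eventually.of_forall (hsub j)) ?_
    · obtain ⟨K', hK'⟩ := hT j
      exact (hg.continuous.sub hK'.continuous).aestronglyMeasurable
    · filter_upwards [ae_restrict_mem hΩ.measurableSet] with x hx
      refine tendsto_const_nhds.congr' ?_
      have h1 : Tendsto (fun j : ℕ => (j : ℝ) * d x) atTop atTop :=
        tendsto_natCast_atTop_atTop.atTop_mul_const (hdpos x hx)
      filter_upwards [h1.eventually_ge_atTop |g x|] with j hj
      rw [abs_le] at hj
      simp only [T]
      rw [min_eq_left hj.2, max_eq_right hj.1, sub_self]
  have hδ3 : 0 < ENNReal.ofReal (δ / 3) := ENNReal.ofReal_pos.2 (by positivity)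
  obtain ⟨j, hj⟩ := (hTlim.eventually_le_const hδ3).exists
  obtain ⟨K', hK'⟩ := hT j
  obtain ⟨ψ, hψ, h1, -⟩ := (hK'.memW1Zero_of_eq_zero hΩ hb hr hr' (hT0 j)).exists_approx
  obtain ⟨i, hi⟩ := (h1.eventually_le_const hδ3).exists
  refine ⟨ψ i, hψ i, ?_⟩
  have e : (fun x => h x - ψ i x) =
      (h - g) + ((fun x => g x - T j x) + fun x => T j x - ψ i x) := by
    ext x; simp
  have m1 : AEStronglyMeasurable (fun x => g x - T j x) (volume.restrict Ω) :=
    (hg.continuous.sub hK'.continuous).aestronglyMeasurable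
  have m2 : AEStronglyMeasurable (fun x => T j x - ψ i x) (volume.restrict Ω) :=
    (hK'.continuous.sub (hψ i).contDiff.continuous).aestronglyMeasurable
  have e3 : ENNReal.ofReal δ =
      ENNReal.ofReal (δ / 3) + (ENNReal.ofReal (δ / 3) + ENNReal.ofReal (δ / 3)) := by
    rw [← ENNReal.ofReal_add (by positivity) (by positivity),
      ← ENNReal.ofReal_add (by positivity) (by positivity)]
    congr 1; ring
  rw [e, e3]
  refine (eLpNorm_add_le (hh.1.sub hg.continuous.aestronglyMeasurable) (m1.add m2) hr).trans
    (add_le_add hhg ((eLpNorm_add_le m1 m2 hr).trans (add_le_add hj hi)))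

/-- A bounded sequence in `L^q` which converges to `0` in the sense of distributions converges
weakly to `0`. -/
theorem tendsto_setIntegral_mul_of_isTestFunction (hΩ : IsOpen Ω) (hb : Bornology.IsBounded Ω)
    (hne : Ω ≠ Set.univ) {q r : ℝ≥0∞} [q.HolderConjugate r] (hr : r ≠ ⊤)
    {F : ℕ → EuclideanSpace ℝ (Fin n) → ℝ} {C : ℝ≥0∞} (hC : C ≠ ⊤)
    (hF : ∀ᶠ k in atTop, AEStronglyMeasurable (F k) (volume.restrict Ω) ∧
      eLpNorm (F k) q (volume.restrict Ω) ≤ C)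
    (htest : ∀ ψ, IsTestFunction Ω ψ → Tendsto (fun k => ∫ x in Ω, F k x * ψ x) atTop (𝓝 0))
    {h : EuclideanSpace ℝ (Fin n) → ℝ} (hh : MemLp h r (volume.restrict Ω)) :
    Tendsto (fun k => ∫ x in Ω, F k x * h x) atTop (𝓝 0) := by
  have hr1 : 1 ≤ r := ENNReal.HolderConjugate.one_le r q
  rw [Metric.tendsto_atTop']
  intro ε hε
  have hC0 : 0 ≤ C.toReal := ENNReal.toReal_nonneg
  -- The density error is multiplied by at most `C`; the `+ 1` covers `C = 0`.
  have hδ : 0 < ε / 2 / (C.toReal + 1) := by positivity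
  obtain ⟨ψ, hψ, hhψ⟩ := hh.exists_isTestFunction_eLpNorm_sub_le hΩ hb hne hr1 hr hδ
  obtain ⟨K, hK⟩ := hψ.exists_lipschitzWith
  have hψm : MemLp ψ r (volume.restrict Ω) := hK.memLp_restrict hb r
  obtain ⟨k₀, hk₀⟩ := eventually_atTop.1 (hF.and
    ((htest ψ hψ).eventually (Metric.ball_mem_nhds 0 (half_pos hε))))
  refine ⟨k₀, fun k hk => ?_⟩
  obtain ⟨⟨hFm, hFC⟩, hFψ⟩ := hk₀ k hk.le
  have hFq : MemLp (F k) q (volume.restrict Ω) := ⟨hFm, hFC.trans_lt hC.lt_top⟩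
  have i1 : Integrable (fun x => F k x * ψ x) (volume.restrict Ω) := hFq.integrable_mul hψm
  have i2 : Integrable (fun x => F k x * (h x - ψ x)) (volume.restrict Ω) :=
    hFq.integrable_mul (hh.sub hψm)
  have e : ∫ x in Ω, F k x * h x = (∫ x in Ω, F k x * ψ x) + ∫ x in Ω, F k x * (h x - ψ x) := by
    rw [← integral_add i1 i2]
    congr 1; ext x; ring
  have h2 : ‖∫ x in Ω, F k x * (h x - ψ x)‖ₑ ≤ C * ENNReal.ofReal (ε / 2 / (C.toReal + 1)) := by
    refine (enorm_integral_le_lintegral_enorm _).trans ?_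
    rw [← eLpNorm_one_eq_lintegral_enorm]
    exact (eLpNorm_smul_le_mul_eLpNorm (p := q) (q := r) (r := 1) (hh.sub hψm).1 hFm).trans
      (mul_le_mul' hFC hhψ)
  rw [← ENNReal.ofReal_toReal hC, ← ENNReal.ofReal_mul hC0, ← ofReal_norm,
    ENNReal.ofReal_le_ofReal_iff (by positivity), ENNReal.toReal_ofReal hC0] at h2
  have h3 : C.toReal * (ε / 2 / (C.toReal + 1)) ≤ ε / 2 := by
    rw [mul_div_assoc', div_le_iff₀ (by positivity)]
    nlinarith
  have h4 : ‖∫ x in Ω, F k x * ψ x‖ < ε / 2 := by simpa using hFψ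
  rw [e, dist_zero_right]
  linarith [norm_add_le (∫ x in Ω, F k x * ψ x) (∫ x in Ω, F k x * (h x - ψ x))]

/-- For the functions the uniform bound `η` suffices. For the gradients, tested with `C_c^∞`, the
derivative moves to the test function and the same bound applies; density and boundedness in `L^q`
do the rest, coordinate by coordinate. -/
theorem tendstoWeaklyW1_of_bounded (hΩ : IsOpen Ω) (hb : Bornology.IsBounded Ω)
    (hne : Ω ≠ Set.univ) {q : ℝ} (hq : 1 < q) {v : ℕ → EuclideanSpace ℝ (Fin n) → ℝ}
    {w : EuclideanSpace ℝ (Fin n) → ℝ} (hw : MemW1 Ω (ENNReal.ofReal q) w) {C : ℝ≥0∞}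
    (hC : C ≠ ⊤) (hv : ∀ᶠ k in atTop, MemW1 Ω (ENNReal.ofReal q) (v k) ∧
      eLpNorm (weakGradient Ω (v k)) (ENNReal.ofReal q) (volume.restrict Ω) ≤ C)
    {η : ℕ → ℝ} (hη : Tendsto η atTop (𝓝 0))
    (hvη : ∀ k, ∀ᵐ x ∂volume.restrict Ω, |v k x - w x| ≤ η k) :
    TendstoWeaklyW1 Ω q v w := by
  have hfin : IsFiniteMeasure (volume.restrict Ω) := isFiniteMeasure_restrict.2 hb.measure_lt_top.ne
  have hqr : (ENNReal.ofReal q).HolderConjugate (ENNReal.ofReal (Real.conjExponent q)) :=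
    (Real.HolderConjugate.conjExponent hq).ennrealOfReal
  have hr1 : 1 ≤ ENNReal.ofReal (Real.conjExponent q) := ENNReal.HolderConjugate.one_le _
    (ENNReal.ofReal q)
  have hq1 : 1 ≤ ENNReal.ofReal q := by simpa using hq.le
  have hη' : ∀ c : ℝ, Tendsto (fun k => η k * c) atTop (𝓝 0) := fun c => by
    simpa using hη.mul_const c
  refine ⟨hv.mono fun _ h => h.1, hw, fun h hh => ?_, fun h hh => ?_⟩
  · have hhi : Integrable h (volume.restrict Ω) := hh.integrable hr1
    refine (tendsto_iff_norm_sub_tendsto_zero).2 (squeeze_zero' (Eventually.of_forall fun _ =>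
      norm_nonneg _) ?_ (hη' (∫ x in Ω, ‖h x‖)))
    filter_upwards [hv] with k hk
    have i1 : Integrable (fun x => v k x * h x) (volume.restrict Ω) :=
      hk.1.memLp.integrable_mul hh
    have i2 : Integrable (fun x => w x * h x) (volume.restrict Ω) := hw.memLp.integrable_mul hh
    rw [← integral_sub i1 i2, ← integral_const_mul]
    refine norm_integral_le_of_norm_le (hhi.norm.const_mul _) ?_
    filter_upwards [hvη k] with x hx
    rw [← sub_mul, norm_mul]
    exact mul_le_mul_of_nonneg_right hx (norm_nonneg _)
  · let D : ℕ → EuclideanSpace ℝ (Fin n) → EuclideanSpace ℝ (Fin n) := fun k x =>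
      weakGradient Ω (v k) x - weakGradient Ω w x
    have hcoord : ∀ i, Tendsto (fun k => ∫ x in Ω, D k x i * h x i) atTop (𝓝 0) := by
      intro i
      refine tendsto_setIntegral_mul_of_isTestFunction hΩ hb hne ENNReal.ofReal_ne_top
        (q := ENNReal.ofReal q) (r := ENNReal.ofReal (Real.conjExponent q))
        (ENNReal.add_ne_top.2 ⟨hC, hw.memLp_weakGradient.2.ne⟩)
        (hv.mono fun k hk => ?_) (fun ψ hψ => ?_) (hh.continuousLinearMap_comp
          (EuclideanSpace.proj i : EuclideanSpace ℝ (Fin n) →L[ℝ] ℝ))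
      · have hD : AEStronglyMeasurable (D k) (volume.restrict Ω) :=
          hk.1.memLp_weakGradient.1.sub hw.memLp_weakGradient.1
        refine ⟨(EuclideanSpace.proj i : EuclideanSpace ℝ (Fin n) →L[ℝ] ℝ).continuous
          |>.comp_aestronglyMeasurable hD, ?_⟩
        refine (eLpNorm_mono (g := D k) fun x => PiLp.norm_apply_le _ _).trans ?_
        exact (eLpNorm_sub_le hk.1.memLp_weakGradient.1 hw.memLp_weakGradient.1 hq1).trans
          (add_le_add_left hk.2 _)
      · obtain ⟨K, hK⟩ := hψ.exists_lipschitzWith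
        have hgi : Integrable (gradient ψ) (volume.restrict Ω) :=
          (hK.memLp_gradient hb 1).integrable le_rfl
        refine squeeze_zero_norm' ?_ (hη' (∫ x in Ω, ‖gradient ψ x‖))
        filter_upwards [hv] with k hk
        have hwg := hk.1.hasWeakGradient.sub hw.hasWeakGradient
        have e : ∫ x in Ω, D k x i * ψ x = (∫ x in Ω, ψ x • D k x) i := by
          have := (EuclideanSpace.proj i : EuclideanSpace ℝ (Fin n) →L[ℝ] ℝ).integral_comp_comm
            (hwg.locallyIntegrableOn_gradient.integrableOn_test_smul hψ)
          refine Eq.trans ?_ this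
          congr 1; ext x
          simp [D, mul_comm]
        rw [e]
        refine (PiLp.norm_apply_le _ _).trans ?_
        rw [← norm_neg, ← hwg.integral_eq ψ hψ, ← integral_const_mul]
        refine norm_integral_le_of_norm_le (hgi.norm.const_mul _) ?_
        filter_upwards [hvη k] with x hx
        rw [norm_smul]
        exact mul_le_mul_of_nonneg_right hx (norm_nonneg _)
    have hsum := tendsto_finsetSum Finset.univ fun i _ => hcoord i
    rw [Finset.sum_const_zero] at hsum
    refine tendsto_sub_nhds_zero_iff.1 (hsum.congr' ?_)
    filter_upwards [hv] with k hk
    have hint : ∀ G : EuclideanSpace ℝ (Fin n) → EuclideanSpace ℝ (Fin n),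
        MemLp G (ENNReal.ofReal q) (volume.restrict Ω) →
        ∀ i, Integrable (fun x => G x i * h x i) (volume.restrict Ω) := fun G hG i =>
      (hG.continuousLinearMap_comp
        (EuclideanSpace.proj i : EuclideanSpace ℝ (Fin n) →L[ℝ] ℝ)).integrable_mul
        (hh.continuousLinearMap_comp (EuclideanSpace.proj i : EuclideanSpace ℝ (Fin n) →L[ℝ] ℝ))
    have hinner : ∀ G : EuclideanSpace ℝ (Fin n) → EuclideanSpace ℝ (Fin n),
        MemLp G (ENNReal.ofReal q) (volume.restrict Ω) →
        ∫ x in Ω, inner ℝ (G x) (h x) = ∑ i, ∫ x in Ω, G x i * h x i := by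
      intro G hG
      rw [← integral_finsetSum _ fun i _ => hint G hG i]
      congr 1; ext x
      simp [PiLp.inner_apply, mul_comm]
    rw [hinner _ hk.1.memLp_weakGradient, hinner _ hw.memLp_weakGradient, ← Finset.sum_sub_distrib]
    refine Finset.sum_congr rfl fun i _ => ?_
    rw [← integral_sub (hint _ hk.1.memLp_weakGradient i) (hint _ hw.memLp_weakGradient i)]
    congr 1; ext x
    simp [D, sub_mul]

end

/-! ### The limit problem -/

section

variable {n : ℕ} {Ω : Set (EuclideanSpace ℝ (Fin n))}

theorem MemW1.mono_exponent (hΩ : IsOpen Ω) (hb : Bornology.IsBounded Ω) {p q : ℝ≥0∞}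
    (hqp : q ≤ p) {u : EuclideanSpace ℝ (Fin n) → ℝ} (hu : MemW1 Ω p u) : MemW1 Ω q u := by
  have hfin : IsFiniteMeasure (volume.restrict Ω) := isFiniteMeasure_restrict.2 hb.measure_lt_top.ne
  exact hu.hasWeakGradient.memW1 hΩ (hu.memLp.mono_exponent hqp)
    (hu.memLp_weakGradient.mono_exponent hqp)

/-- Hölder's inequality: divided by `V ^ (1 / p)`, the norms increase with the exponent, so `M` does
not change. -/
theorem eLpNorm_le_of_eLpNorm_le {α F : Type*} [MeasurableSpace α] [NormedAddCommGroup F]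
    {μ : Measure α} {G : α → F} (hG : AEStronglyMeasurable G μ) {p q : ℝ} (hq : 1 ≤ q)
    (hqp : q ≤ p) {M V : ℝ} (hM : 0 ≤ M) (hV : 0 < V) (hμ : μ Set.univ = ENNReal.ofReal V)
    (h : eLpNorm G (ENNReal.ofReal p) μ ≤ ENNReal.ofReal (M * V ^ (1 / p))) :
    eLpNorm G (ENNReal.ofReal q) μ ≤ ENNReal.ofReal (M * V ^ (1 / q)) := by
  refine (eLpNorm_le_eLpNorm_mul_rpow_measure_univ (ENNReal.ofReal_le_ofReal hqp) hG).trans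
    ((mul_le_mul_left h _).trans (le_of_eq ?_))
  rw [hμ, ENNReal.toReal_ofReal (by linarith), ENNReal.toReal_ofReal (by linarith),
    ENNReal.ofReal_rpow_of_pos hV, ← ENNReal.ofReal_mul (by positivity), mul_assoc,
    ← Real.rpow_add hV]
  congr 3
  ring

theorem lipConst_le_coe_iff {M : ℝ≥0} {u : EuclideanSpace ℝ (Fin n) → ℝ} :
    lipConst Ω u ≤ M ↔ LipschitzOnWith M u Ω := by
  simp only [lipConst, iSup_le_iff, LipschitzOnWith]
  refine forall₂_congr fun x _ => forall₂_congr fun y _ => ?_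
  rw [ENNReal.div_le_iff_le_mul (Or.inr ENNReal.coe_ne_top) (Or.inl (edist_ne_top _ _))]

/-- The sets `{u > 1 / (m + 1)}` exhaust `{u > 0}`, and each lies in `{uk k > 0}` as soon as `η k ≤
1 / (m + 1)`. -/
theorem volume_positivitySet_le_of_tendsto {u : EuclideanSpace ℝ (Fin n) → ℝ}
    {uk : ℕ → EuclideanSpace ℝ (Fin n) → ℝ} {η : ℕ → ℝ} (hη : Tendsto η atTop (𝓝 0))
    (huη : ∀ k, ∀ x ∈ Ω, |uk k x - u x| ≤ η k) {c : ℝ≥0∞}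
    (hc : ∀ k, volume (positivitySet Ω (uk k)) ≤ c) : volume (positivitySet Ω u) ≤ c := by
  have hmono : Monotone fun m : ℕ => {x | x ∈ Ω ∧ 1 / ((m : ℝ) + 1) < u x} :=
    fun i j hij x hx => ⟨hx.1, (one_div_le_one_div_of_le (by positivity)
      (by gcongr)).trans_lt hx.2⟩
  have hU : positivitySet Ω u = ⋃ m : ℕ, {x | x ∈ Ω ∧ 1 / ((m : ℝ) + 1) < u x} := by
    ext x
    simp only [positivitySet, Set.mem_iUnion, Set.mem_ofPred_eq]
    refine ⟨fun h => ?_, fun ⟨m, h1, h2⟩ => ⟨h1, lt_trans (by positivity) h2⟩⟩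
    obtain ⟨m, hm⟩ := exists_nat_one_div_lt h.2
    exact ⟨m, h.1, hm⟩
  rw [hU, hmono.measure_iUnion]
  refine iSup_le fun m => ?_
  obtain ⟨k, hk⟩ := (hη.eventually_le_const
    (show (0 : ℝ) < 1 / ((m : ℝ) + 1) by positivity)).exists
  refine le_trans (measure_mono (t := positivitySet Ω (uk k)) fun x hx => ?_) (hc k)
  refine ⟨hx.1, ?_⟩
  have h1 := abs_le.1 (huη k x hx.1)
  have h2 : 1 / ((m : ℝ) + 1) < u x := hx.2
  linarith [h1.1]

/-- A uniform limit of minimizers as `p → ∞` has minimal Lipschitz constant. -/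
theorem lipConst_le_of_isMinimizerP (hΩ : IsOpen Ω) (hb : Bornology.IsBounded Ω)
    (hV : 0 < volume.real Ω) {f : EuclideanSpace ℝ (Fin n) → ℝ} {α : ℝ} {p : ℕ → ℝ}
    (hp : ∀ k, 1 ≤ p k) (hp_lim : Tendsto p atTop atTop) {u : EuclideanSpace ℝ (Fin n) → ℝ}
    {L : ℝ≥0} (hu : LipschitzWith L u) (huf : ∀ x ∈ frontier Ω, u x = f x)
    {uk : ℕ → EuclideanSpace ℝ (Fin n) → ℝ} (huk : ∀ k, IsMinimizerP Ω f α (p k) (uk k))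
    (hukc : ∀ k, Continuous (uk k)) {η : ℕ → ℝ} (hη : Tendsto η atTop (𝓝 0))
    (huη : ∀ k x, |uk k x - u x| ≤ η k) {v : EuclideanSpace ℝ (Fin n) → ℝ}
    (hv : IsAdmissibleInfty Ω f α v) : lipConst Ω u ≤ lipConst Ω v := by
  rcases eq_or_ne (lipConst Ω v) ⊤ with h | h
  · rw [h]; exact le_top
  lift lipConst Ω v to ℝ≥0 using h with M hM
  -- Extended from the closure to the whole space with the same constant, `v` becomes a competitor
  -- for every finite exponent.
  have hvM : LipschitzOnWith M v (closure Ω) :=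
    (lipConst_le_coe_iff.1 hM.symm.le).closure hv.continuousOn
  obtain ⟨v', hv', hvv'⟩ := hvM.extend_real
  have hfr : ∀ x ∈ frontier Ω, v' x = f x := fun x hx => by
    rw [← hvv' (frontier_subset_closure hx), hv.boundary x hx]
  have hvol : volume (positivitySet Ω v') ≤ ENNReal.ofReal α := by
    refine le_trans (measure_mono (t := positivitySet Ω v) fun x hx => ?_) hv.volume_le
    refine ⟨hx.1, ?_⟩
    rw [hvv' (subset_closure hx.1)]
    exact hx.2
  refine lipConst_le_coe_iff.2 (LipschitzOnWith.of_dist_le_mul fun x hx y hy => ?_)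
  refine abs_sub_le_of_segment_of_frontier hΩ hu.continuous (fun x y hxy => ?_)
    (fun x hx y hy => ?_) hx hy
  · exact abs_sub_le_of_segment_subset hΩ M.2 hV hp hp_lim hu hukc hη huη
      (fun k => (huk k).1.memW1.hasWeakGradient)
      (fun k => (huk k).1.memW1.memLp_weakGradient.1)
      (fun k => (huk k).eLpNorm_weakGradient_le hΩ hb (hp k) hv' hfr hvol) hxy
  · rw [huf x hx, huf y hy, ← hfr x hx, ← hfr y hy]
    exact hv'.dist_le_mul x y

end

/-! ### The limit `p → ∞`: assembly of the theorem -/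

theorem mainTheorem2 {n : ℕ} (hn : 1 ≤ n) (Ω : Set (EuclideanSpace ℝ (Fin n)))
    (hΩ : IsSmoothBoundedDomain Ω)
    (f : EuclideanSpace ℝ (Fin n) → ℝ) (hf : ∃ K : ℝ≥0, LipschitzOnWith K f (frontier Ω))
    (hfpos : ∀ x ∈ frontier Ω, 0 < f x)
    (α : ℝ) (hα : 0 < α) (hαΩ : ENNReal.ofReal α < volume Ω)
    (p : ℕ → ℝ) (hp : ∀ k, 1 < p k) (hp_lim : Tendsto p atTop atTop)
    (u : ℕ → EuclideanSpace ℝ (Fin n) → ℝ) (hu : ∀ k, IsMinimizerP Ω f α (p k) (u k)) :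
    ∃ (σ : ℕ → ℕ) (uInf : EuclideanSpace ℝ (Fin n) → ℝ), StrictMono σ ∧
      (∃ w : ℕ → EuclideanSpace ℝ (Fin n) → ℝ,
        (∀ k, ContinuousOn (w k) (closure Ω) ∧ w k =ᵐ[volume.restrict Ω] u (σ k)) ∧
        TendstoUniformlyOn w uInf atTop (closure Ω)) ∧
      (∀ q : ℝ, 1 < q → TendstoWeaklyW1 Ω q (fun k => u (σ k)) uInf) ∧
      IsMinimizerInfty Ω f α uInf ∧
      IsInfinityHarmonic (positivitySet Ω uInf) uInf := by
  have hO := hΩ.isOpen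
  have hb := hΩ.isBounded
  have hne := hb.ne_univ_of_euclideanSpace hn
  have hV : 0 < volume.real Ω :=
    ENNReal.toReal_pos (ne_bot_of_gt hαΩ) hb.measure_lt_top.ne
  obtain ⟨K, hK⟩ := hf
  obtain ⟨g, hg, hfg⟩ := hK.extend_real
  have hgf : ∀ x ∈ frontier Ω, g x = f x := fun x hx => (hfg hx).symm
  obtain ⟨M, v, hv, hvg, hvol⟩ := exists_lipschitzWith_volume_positivitySet_le hO hb hne hα hg
  have hvf : ∀ x ∈ frontier Ω, v x = f x := fun x hx => by rw [hvg x hx, hgf x hx]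
  -- Indices with `p k < 2 n`, to which Morrey's inequality does not apply, are dropped by the shift
  -- `k + k₀`.
  obtain ⟨k₀, hk₀⟩ := eventually_atTop.1 (hp_lim.eventually_ge_atTop (2 * n : ℝ))
  have hN : ∀ k, eLpNorm (weakGradient Ω (u k)) (ENNReal.ofReal (p k)) (volume.restrict Ω) ≤
      ENNReal.ofReal (M * volume.real Ω ^ (1 / p k)) := fun k =>
    (hu k).eLpNorm_weakGradient_le hO hb (hp k).le hv hvf hvol
  choose W a ε hW hW0 huW hWa hWN using fun k =>
    (hu (k + k₀)).exists_continuous_representative hn hO hb (hk₀ _ (Nat.le_add_left _ _)) hg hgf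
  have hτ : StrictMono fun k => k + k₀ := fun i j hij => Nat.add_lt_add_right hij k₀
  -- Compactness is applied to `W = u - g`, which vanishes outside `Ω`; its gradient bound adds `M`
  -- for `u` and `K` for `g`.
  obtain ⟨σ, U, η, hσ, ⟨L, hL⟩, hU0, hη, hWU⟩ := exists_subseq_tendsto_lipschitzWith hb hne
    (p := fun k => p (k + k₀)) (fun k => (hp _).le) (fun k => hk₀ _ (Nat.le_add_left _ _))
    (hp_lim.comp hτ.tendsto_atTop) hW hW0 (measureReal_unit_ball_pos n) hV (A := M + K)
    (fun k x y => by
      have := hWN k _ (by positivity) (hN _) x y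
      rwa [← add_mul] at this)
  have hσ' : StrictMono fun k => σ k + k₀ := hτ.comp hσ
  have hpσ : Tendsto (fun k => p (σ k + k₀)) atTop atTop := hp_lim.comp hσ'.tendsto_atTop
  have hη' : ∀ k x, |(g x + W (σ k) x) - (g x + U x)| ≤ η k := fun k x => by
    rw [add_sub_add_left_eq_sub]; exact hWU k x
  have hmin : ∀ k, IsMinimizerP Ω f α (p (σ k + k₀)) fun x => g x + W (σ k) x := fun k =>
    (hu _).congr_ae hO (huW _)
  have huL : LipschitzWith (K + L) fun x => g x + U x := hg.add hL
  have hfr : ∀ x ∈ frontier Ω, g x + U x = f x := fun x hx => by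
    rw [hO.frontier_eq] at hx
    rw [hU0 x hx.2, add_zero, hgf x (by rw [hO.frontier_eq]; exact hx)]
  refine ⟨fun k => σ k + k₀, fun x => g x + U x, hσ', ⟨fun k x => g x + W (σ k) x,
    fun k => ⟨(hg.continuous.add (hW _)).continuousOn, (huW _).symm⟩, ?_⟩, fun q hq => ?_,
    ⟨⟨huL.memW1 hO hb _, huL.continuous.continuousOn, hfr, ?_⟩, fun v' hv' => ?_⟩, ?_⟩
  · refine Metric.tendstoUniformlyOn_iff.2 fun δ hδ => ?_
    filter_upwards [hη.eventually (gt_mem_nhds hδ)] with k hk x _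
    rw [dist_comm, Real.dist_eq]
    exact (hη' k x).trans_lt hk
  · refine tendstoWeaklyW1_of_bounded hO hb hne hq (huL.memW1 hO hb _)
      (ENNReal.ofReal_ne_top (r := M * volume.real Ω ^ (1 / q))) ?_ hη fun k => ?_
    · filter_upwards [hpσ.eventually_ge_atTop q] with k hk
      refine ⟨(hu _).1.memW1.mono_exponent hO hb (ENNReal.ofReal_le_ofReal hk),
        eLpNorm_le_of_eLpNorm_le (hu _).1.memW1.memLp_weakGradient.1 hq.le hk M.2 hV ?_ (hN _)⟩
      rw [Measure.restrict_apply_univ, measureReal_def,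
        ENNReal.ofReal_toReal hb.measure_lt_top.ne]
    · filter_upwards [huW (σ k)] with x hx
      rw [hx]; exact hη' k x
  · exact volume_positivitySet_le_of_tendsto hη (fun k x _ => hη' k x) fun k => (hmin k).1.volume_le
  · exact lipConst_le_of_isMinimizerP hO hb hV (fun k => (hp _).le) hpσ huL hfr hmin
      (fun k => hg.continuous.add (hW _)) hη hη' hv'
  · exact isInfinityHarmonic_of_isMinimizerP hO hb (fun k => (hp _).le) hpσ
      huL.continuous.continuousOn hmin (fun k => (hg.continuous.add (hW _)).continuousOn)
      (fun k => hWa (σ k)) hη fun k x _ => hη' k x
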